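/- **Setting.** Let $\mathbb S^2$ be the round unit sphere with area measure $|\gamma|^{1/2}=\sin\theta\,d\theta\,d\sigma$ in spherical coordinates $(\theta,\sigma)$, let $Y_{\ell m}$ be the spherical harmonics, so that $Y_{\ell0}=\big(\tfrac{2\ell+1}{4\pi}\big)^{1/2}\mathscr P_\ell(\cos\theta)$, and write $\langle f,g\rangle=\int_{\mathbb S^2}|\gamma|^{1/2}fg$ and $f_\ell=\langle Y_{\ell0},f\rangle$. Let $\mathscr S=\{f\in C^\infty(\mathbb S^2;\mathbb R):\mathcal L_{\partial_\sigma}f=0\}$ with the $C^\infty$ topology (uniform convergence of all derivatives), and let $\mathscr S'$ be its topological dual, with the $\sigma$-algebra generated by the cylinder sets. For $\tilde Q\in\mathscr S'$ put $\tilde Q_\ell=\tilde Q(Y_{\ell0})$. Let $\rho_\ell>0$ and $\nu_\ell\in\mathbb R$ $(\ell\ge0)$ satisfy $(\rho_\ell-\sqrt{\pi/2})_\ell\in\ell^2$ and $(\nu_\ell)_\ell\in\ell^2$, and let $$z_\ell(t)=\sqrt{\tfrac{\sin t}{2}}\,\big(\rho_\ell\,\mathscr P_\ell(\cos t)+(\nu_\ell+i\rho_\ell^{-1})\,\mathscr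 Q_\ell(\cos t)\big),\qquad t\in(0,\pi),$$ where $\mathscr P_\ell,\mathscr Q_\ell$ are the Legendre functions of the first and second kind. Fix $t_0\in(0,\pi)$. **Statement.** 1. There is a unique linear map $J_{t_0}:\mathscr S\times\mathscr S\to\mathscr S\times\mathscr S$ with the following property: whenever $(Q,P)$ are the Cauchy data $(\xi(t_0),\dot\xi(t_0))$, computed mode by mode, of $\xi=\sum_\ell\big(b_\ell z_\ell+\overline{b_\ell z_\ell}\big)Y_{\ell0}$ with $b_\ell\in\mathbb C$, that is, $Q_\ell=b_\ell z_\ell(t_0)+\overline{b_\ell z_\ell(t_0)}$ and $P_\ell=b_\ell\dot z_\ell(t_0)+\overline{b_\ell\dot z_\ell(t_0)}$ for all $\ell$, then $J_{t_0}(Q,P)$ are those obtained when every $b_\ell$ is replaced by $ib_\ell$. Write $J_{t_0}(Q,P)=(A(t_0)Q+B(t_0)P,\;D(t_0)Q+C(t_0)P)$. Then $z_\ell(t_0)\ne0$ for all $\ell$, and $-B(t_0)/2=\mathrm{diag}(|z_\ell(t_0)|^2)$, i.e. $\big(-\tfrac12B(t_0)P\big)(s)=\sum_{\ell}|z_\ell(t_0)|^2P_\ell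 Y_{\ell0}(s)$ for all $P\in\mathscr S$ and $s\in\mathbb S^2$. 2. There is a unique probability measure $\mu_{t_0}$ on $\mathscr S'$ with $\int_{\mathscr S'}e^{i\tilde Q(f)}\,d\mu_{t_0}[\tilde Q]=\exp\big(\tfrac14\langle f,B(t_0)f\rangle\big)$ for all $f\in\mathscr S$. It has mean zero and covariance $\mathcal C(t_0)=-B(t_0)/2$, that is, $\int\tilde Q(f)\tilde Q(g)\,d\mu_{t_0}=\langle f,-\tfrac12B(t_0)g\rangle$ for all $f,g\in\mathscr S$, and for every $n$ the joint law of $(\tilde Q_0,\dots,\tilde Q_n)$ is the product of the centred Gaussian measures on $\mathbb R$ with variances $|z_\ell(t_0)|^2$, $0\le\ell\le n$. 3. For $\epsilon>0$ let $\mathfrak h_\epsilon$ be the space of axisymmetric functions in the Sobolev space $H^\epsilon(\mathbb S^2)=\{f\in L^2(\mathbb S^2;\mathbb R):\sum_\ell(\ell+\tfrac12)^{2\epsilon}\sum_{|m|\le\ell}|f_{\ell m}|^2<\infty\}$, where $f_{\ell m}=\int_{\mathbb S^2}|\gamma|^{1/2}f\,\overline{Y}_{\ell m}$, with the norm $\|f\|_\epsilon^2=\sum_\ell(\ell+\tfrac12)^{2\epsilon}f_\ell^2$.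 For every $\epsilon>0$ the dual $\mathfrak h_\epsilon'$, viewed in $\mathscr S'$ by restriction of functionals to $\mathscr S$, is measurable and $\mu_{t_0}(\mathfrak h_\epsilon')=1$. 4. The set $\mathfrak b\subset\mathscr S'$ of the functionals $f\mapsto\int_{\mathbb S^2}|\gamma|^{1/2}fg$ with $g\in L^2(\mathbb S^2;\mathbb R)$ axisymmetric is measurable and $\mu_{t_0}(\mathfrak b)=0$; in particular the image of $\mathscr S$ in $\mathscr S'$ has $\mu_{t_0}$-measure zero. 5. For a sequence $\Delta=(\Delta_\ell)_{\ell\ge0}$ of reals with $\Delta_k>1$ for $k\ge1$ put $$Z_{t_0}(\Delta)=\big\{\tilde Q\in\mathscr S':\ \exists N\ \forall\ell\ge N:\ |\tilde Q_\ell|<|z_\ell(t_0)|\sqrt{2\log\Delta_\ell}\big\}.$$ This set is measurable, and its $\mu_{t_0}$-measure is $1$ if $\sum_{k\ge1}1/(\Delta_k\sqrt{\log\Delta_k})$ converges and $0$ if it diverges. In particular, $\mu_{t_0}\big(Z_{t_0}((1+\ell)^\alpha)\big)=1$ for every $\alpha>1$, and $\mu_{t_0}\big(Z_{t_0}((1+\ell)^\alpha)\big)=0$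 for $\alpha=1$. -/

import Mathlib

open MeasureTheory ProbabilityTheory Set Filter Topology
open scoped Manifold ContDiff NNReal ENNReal ComplexConjugate

namespace Gowdy

noncomputable section

/-! ### The round sphere -/

/-- Euclidean three-space. -/
abbrev R3 : Type := EuclideanSpace ℝ (Fin 3)

/-- The unit two-sphere. -/
abbrev S2 : Type := Metric.sphere (0 : R3) 1

/-- The point with polar angle `θ` and azimuth `σ`. -/
def sph (θ σ : ℝ) : S2 :=
  ⟨!₂[Real.sin θ * Real.cos σ, Real.sin θ * Real.sin σ, Real.cos θ], by
    rw [mem_sphere_zero_iff_norm, EuclideanSpace.norm_eq, Real.sqrt_eq_one, Fin.sum_univ_three]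
    simp only [Real.norm_eq_abs, sq_abs]
    simp only [Matrix.cons_val_zero, Matrix.cons_val_one, Matrix.cons_val]
    nlinarith [Real.sin_sq_add_cos_sq θ, Real.sin_sq_add_cos_sq σ]⟩

/-- The rotation by the angle `a` about the symmetry axis (the third coordinate axis), i.e. the
flow at time `a` of the Killing field `∂/∂σ`. -/
def rot (a : ℝ) (s : S2) : S2 :=
  ⟨!₂[Real.cos a * s.1 0 - Real.sin a * s.1 1, Real.sin a * s.1 0 + Real.cos a * s.1 1, s.1 2], by
    have hs : ‖s.1‖ = 1 := mem_sphere_zero_iff_norm.1 s.2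
    rw [EuclideanSpace.norm_eq, Real.sqrt_eq_one, Fin.sum_univ_three] at hs
    simp only [Real.norm_eq_abs, sq_abs] at hs
    rw [mem_sphere_zero_iff_norm, EuclideanSpace.norm_eq, Real.sqrt_eq_one, Fin.sum_univ_three]
    simp only [Real.norm_eq_abs, sq_abs]
    simp only [Matrix.cons_val_zero, Matrix.cons_val_one, Matrix.cons_val]
    have h := Real.sin_sq_add_cos_sq a
    linear_combination hs + (s.1 0 ^ 2 + s.1 1 ^ 2) * h⟩

/-- The Riemannian area measure of the round metric `dθ² + sin²θ dσ²`, which has the density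
`sin θ` in the spherical coordinates `(θ, σ) ∈ (0, π) × (0, 2π)`. -/
def area : Measure S2 :=
  (((volume : Measure (ℝ × ℝ)).restrict (Ioo 0 Real.pi ×ˢ Ioo 0 (2 * Real.pi))).withDensity
    (fun p => ENNReal.ofReal (Real.sin p.1))).map (fun p => sph p.1 p.2)

instance : IsFiniteMeasure area := by
  unfold area
  have : IsFiniteMeasure
      ((volume : Measure (ℝ × ℝ)).restrict (Ioo 0 Real.pi ×ˢ Ioo 0 (2 * Real.pi))) := by
    refine ⟨?_⟩
    rw [Measure.restrict_apply_univ, Measure.volume_eq_prod, Measure.prod_prod]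
    simp only [Real.volume_Ioo]
    exact ENNReal.mul_lt_top ENNReal.ofReal_lt_top ENNReal.ofReal_lt_top
  have : IsFiniteMeasure
      (((volume : Measure (ℝ × ℝ)).restrict (Ioo 0 Real.pi ×ˢ Ioo 0 (2 * Real.pi))).withDensity
        (fun p => ENNReal.ofReal (Real.sin p.1))) := by
    refine isFiniteMeasure_withDensity (ne_of_lt ?_)
    refine lt_of_le_of_lt (lintegral_mono (g := fun _ => (1 : ℝ≥0∞)) fun p => ?_) ?_
    · exact (ENNReal.ofReal_le_ofReal (Real.sin_le_one p.1)).trans (by simp)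
    · rw [lintegral_one]
      exact measure_lt_top _ _
  infer_instance

/-! ### Legendre functions and spherical harmonics -/

/-- Legendre polynomials, by Bonnet's recursion. -/
def legP : ℕ → Polynomial ℝ
  | 0 => 1
  | 1 => Polynomial.X
  | n + 2 => Polynomial.C (1 / ((n : ℝ) + 2)) *
      (Polynomial.C (2 * (n : ℝ) + 3) * Polynomial.X * legP (n + 1)
        - Polynomial.C ((n : ℝ) + 1) * legP n)

/-- Legendre functions of the second kind on the cut `(-1, 1)`, by Bonnet's recursion. -/
def legQ : ℕ → ℝ → ℝ
  | 0, x => (1 / 2) * Real.log ((1 + x) / (1 - x))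
  | 1, x => x * ((1 / 2) * Real.log ((1 + x) / (1 - x))) - 1
  | n + 2, x => (1 / ((n : ℝ) + 2)) *
      ((2 * (n : ℝ) + 3) * x * legQ (n + 1) x - ((n : ℝ) + 1) * legQ n x)

/-- The spherical harmonic `Y_{ℓ m}`, `0 ≤ m ≤ ℓ`, with the Condon-Shortley phase. It uses
`P_ℓ^m(cos θ) e^{imσ} = (-1)^m P_ℓ^{(m)}(cos θ) (sin θ e^{iσ})^m`. -/
def sphHarmNat (l m : ℕ) (s : S2) : ℂ :=
  (Real.sqrt ((2 * (l : ℝ) + 1) / (4 * Real.pi) * (((l - m).factorial : ℝ) / ((l + m).factorial : ℝ))) : ℂ)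
    * (-1) ^ m * (((Polynomial.derivative^[m] (legP l)).eval (s.1 2) : ℝ) : ℂ)
    * ((s.1 0 : ℂ) + (s.1 1 : ℂ) * Complex.I) ^ m

/-- The spherical harmonic `Y_{ℓ m}`, `-ℓ ≤ m ≤ ℓ`, with
`Y_{ℓ, -m} = (-1)^m` times the conjugate of `Y_{ℓ m}`. -/
def sphHarm (l : ℕ) (m : ℤ) (s : S2) : ℂ :=
  if 0 ≤ m then sphHarmNat l m.toNat s
  else (-1) ^ m.natAbs * conj (sphHarmNat l m.natAbs s)

/-! ### Test functions and distributions -/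

/-- Smooth real functions on the sphere. -/
abbrev Smooth : Type := C^∞⟮𝓡 2, S2; 𝓘(ℝ, ℝ), ℝ⟯

/-- The radial projection to the sphere (with an arbitrary value at the origin). -/
def radial (x : R3) : S2 :=
  if h : x = 0 then sph 0 0
  else ⟨‖x‖⁻¹ • x, by
    rw [mem_sphere_zero_iff_norm, norm_smul, norm_inv, norm_norm,
      inv_mul_cancel₀ (norm_ne_zero_iff.2 h)]⟩

/-- The standard topology of `C^∞(S²)`, that of uniform convergence of all derivatives. The
derivatives of order `n` of a function on the sphere are those of its extension that is constant
along rays, taken at the points of the sphere. -/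
instance : TopologicalSpace Smooth :=
  ⨅ n : ℕ, TopologicalSpace.induced
    (fun f : Smooth => UniformFun.ofFun
      (fun s : S2 => iteratedFDeriv ℝ n (fun x : R3 => f (radial x)) (s : R3))) inferInstance

/-- The test space `𝒮`: smooth real functions on the sphere whose Lie derivative along the
rotation field `∂/∂σ` vanishes, with the topology induced from `C^∞(S²)`. -/
def testSpace : Submodule ℝ Smooth where
  carrier := {f | ∀ s : S2, HasDerivAt (fun a : ℝ => f (rot a s)) 0 0}
  zero_mem' := fun s => hasDerivAt_const (0 : ℝ) (0 : ℝ)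
  add_mem' := fun {f g} hf hg s => by
    have h := (hf s).add (hg s)
    rw [add_zero] at h
    exact h
  smul_mem' := fun c f hf s => by
    have h := (hf s).const_mul c
    rw [mul_zero] at h
    exact h

/-- The test space `𝒮`, as a type. -/
abbrev TestFn : Type := testSpace

/-- The quantum configuration space `𝒮'`: continuous linear functionals on `𝒮`. -/
abbrev Distr : Type := TestFn →L[ℝ] ℝ

/-- The `σ`-algebra on `𝒮'` generated by the cylinder sets. -/
instance : MeasurableSpace Distr :=
  ⨆ f : TestFn, MeasurableSpace.comap (fun T : Distr => T f) inferInstance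

/-- The pairing `⟨f, g⟩ = ∫ f g` over the sphere. -/
def pairing (f g : TestFn) : ℝ := ∫ s, f.1 s * g.1 s ∂area

/-- The zonal harmonic `Y_{ℓ 0}`, an element of `𝒮`. -/
def Y (l : ℕ) : TestFn :=
  ⟨⟨fun s => Real.sqrt ((2 * (l : ℝ) + 1) / (4 * Real.pi)) * (legP l).eval (s.1 2), by
    have h : ContDiff ℝ ∞ (fun x : R3 =>
        Real.sqrt ((2 * (l : ℝ) + 1) / (4 * Real.pi)) * (legP l).eval (x 2)) := by
      have h2 : ContDiff ℝ ∞ (fun x : R3 => x 2) :=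
        (EuclideanSpace.proj (2 : Fin 3) : R3 →L[ℝ] ℝ).contDiff
      exact contDiff_const.mul (((Polynomial.contDiff_aeval (legP l) ∞).comp h2))
    have := Fact.mk (@finrank_euclideanSpace_fin ℝ _ (2 + 1))
    exact h.contMDiff.comp (contMDiff_coe_sphere (n := 2))⟩,
   fun s => hasDerivAt_const (0 : ℝ)
    (Real.sqrt ((2 * (l : ℝ) + 1) / (4 * Real.pi)) * (legP l).eval (s.1 2))⟩

/-- The Fourier coefficient `f_ℓ = ∫ Y_{ℓ 0} f` of a test function. -/
def coeff (f : TestFn) (l : ℕ) : ℝ := pairing (Y l) f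

/-! ### Mode functions, complex structure and measure -/

/-- The mode function `z_ℓ(t) = ρ_ℓ ũ_ℓ(t) + (ν_ℓ + i/ρ_ℓ) ṽ_ℓ(t)`, where
`ũ_ℓ = (sin t / 2)^{1/2} P_ℓ(cos t)` and `ṽ_ℓ = (sin t / 2)^{1/2} Q_ℓ(cos t)`. -/
def mode (ρ ν : ℕ → ℝ) (l : ℕ) (t : ℝ) : ℂ :=
  (ρ l : ℂ) * ((Real.sqrt (Real.sin t) * (1 / Real.sqrt 2 * (legP l).eval (Real.cos t)) : ℝ) : ℂ)
  + ((ν l : ℂ) + Complex.I * ((ρ l)⁻¹ : ℝ))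
    * ((Real.sqrt (Real.sin t) * (1 / Real.sqrt 2 * legQ l (Real.cos t)) : ℝ) : ℂ)

/-- The Cauchy data `X = (Q, P)` at time `t` are those of the field
`ξ = ∑ (b_ℓ z_ℓ + conj (b_ℓ z_ℓ)) Y_{ℓ 0}`, that is, `Q = ξ(t)` and `P = ξ'(t)`. -/
def HasModes (ρ ν : ℕ → ℝ) (t : ℝ) (b : ℕ → ℂ) (X : TestFn × TestFn) : Prop :=
  ∀ l : ℕ,
    (coeff X.1 l : ℂ) = b l * mode ρ ν l t + conj (b l * mode ρ ν l t) ∧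
    (coeff X.2 l : ℂ) = b l * deriv (mode ρ ν l) t + conj (b l * deriv (mode ρ ν l) t)

/-- `J` is the complex structure `J_t` induced on Cauchy data at time `t` by the complex structure
on fields with `z_ℓ Y_{ℓ 0} ↦ i z_ℓ Y_{ℓ 0}`: it replaces the amplitudes `b_ℓ` by `i b_ℓ`. -/
def IsComplexStructureAt (ρ ν : ℕ → ℝ) (t : ℝ) (J : (TestFn × TestFn) →ₗ[ℝ] (TestFn × TestFn)) :
    Prop :=
  ∀ (X : TestFn × TestFn) (b : ℕ → ℂ), HasModes ρ ν t b X →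
    HasModes ρ ν t (fun l => Complex.I * b l) (J X)

/-- The block `B` of `J (Q, P) = (A Q + B P, D Q + C P)`. -/
def blockB (J : (TestFn × TestFn) →ₗ[ℝ] (TestFn × TestFn)) : TestFn →ₗ[ℝ] TestFn :=
  LinearMap.fst ℝ TestFn TestFn ∘ₗ J ∘ₗ LinearMap.inr ℝ TestFn TestFn

/-- `μ` is the centred Gaussian measure on `𝒮'` with covariance operator `C`: a probability
measure with generating function `∫ exp (i T(f)) dμ(T) = exp (-⟨f, C f⟩ / 2)`. -/
def IsGaussianWithCov (C : TestFn →ₗ[ℝ] TestFn) (μ : Measure Distr) : Prop :=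
  IsProbabilityMeasure μ ∧
    ∀ f : TestFn, ∫ T : Distr, Complex.exp (Complex.I * (T f : ℂ)) ∂μ
      = Complex.exp (-((pairing f (C f) / 2 : ℝ) : ℂ))

/-! ### The sets of distributions -/

/-- Real `L²` functions on the sphere. -/
abbrev L2S2 : Type := Lp ℝ 2 area

/-- The spherical Fourier coefficient `f_{ℓ m} = ∫ f conj(Y_{ℓ m})`. -/
def coeffLM (f : L2S2) (l : ℕ) (m : ℤ) : ℂ := ∫ s, (f s : ℂ) * conj (sphHarm l m s) ∂area

/-- A square integrable function that is invariant under the rotations about the axis (up to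
a set of measure zero). -/
def IsSymmetricL2 (f : L2S2) : Prop :=
  ∃ h : S2 → ℝ, (∀ a s, h (rot a s) = h s) ∧ f =ᵐ[area] h

/-- `f` is in the Sobolev space `H^ε(S²)`. -/
def MemSobolev (ε : ℝ) (f : L2S2) : Prop :=
  Summable fun l : ℕ => ((l : ℝ) + 1 / 2) ^ (2 * ε) *
    ∑ m ∈ Finset.Icc (-(l : ℤ)) (l : ℤ), ‖coeffLM f l m‖ ^ 2

lemma continuous_sphHarm (l : ℕ) (m : ℤ) : Continuous (sphHarm l m) := by
  have h (k : ℕ) : Continuous (sphHarmNat l k) := by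
    unfold sphHarmNat
    have c (i : Fin 3) : Continuous fun s : S2 => s.1 i :=
      (EuclideanSpace.proj i : R3 →L[ℝ] ℝ).continuous.comp continuous_subtype_val
    refine (continuous_const.mul ?_).mul (Continuous.pow ?_ k)
    · exact Complex.continuous_ofReal.comp ((Polynomial.continuous _).comp (c 2))
    · exact (Complex.continuous_ofReal.comp (c 0)).add
        ((Complex.continuous_ofReal.comp (c 1)).mul continuous_const)
  unfold sphHarm
  split_ifs
  · exact h _
  · exact continuous_const.mul (Complex.continuous_conj.comp (h _))

lemma integrable_coeffLM (f : L2S2) (l : ℕ) (m : ℤ) :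
    Integrable (fun s => (f s : ℂ) * conj (sphHarm l m s)) area := by
  have hf : Integrable (fun s => (f s : ℂ)) area :=
    ((Lp.memLp f).integrable one_le_two).ofReal
  have hc : Continuous fun s => conj (sphHarm l m s) :=
    Complex.continuous_conj.comp (continuous_sphHarm l m)
  obtain ⟨C, hC⟩ := isCompact_univ.exists_bound_of_continuousOn hc.continuousOn
  exact hf.mul_bdd (c := C) hc.aestronglyMeasurable (ae_of_all _ fun s => hC s (mem_univ s))

lemma coeffLM_add (f g : L2S2) (l : ℕ) (m : ℤ) :
    coeffLM (f + g) l m = coeffLM f l m + coeffLM g l m := by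
  unfold coeffLM
  rw [← integral_add (integrable_coeffLM f l m) (integrable_coeffLM g l m)]
  refine integral_congr_ae ?_
  filter_upwards [Lp.coeFn_add f g] with s hs
  rw [hs, Pi.add_apply]
  push_cast
  ring

lemma coeffLM_smul (c : ℝ) (f : L2S2) (l : ℕ) (m : ℤ) :
    coeffLM (c • f) l m = c * coeffLM f l m := by
  unfold coeffLM
  rw [← integral_const_mul]
  refine integral_congr_ae ?_
  filter_upwards [Lp.coeFn_smul c f] with s hs
  rw [hs, Pi.smul_apply, smul_eq_mul]
  push_cast
  ring

/-- The space `𝔥_ε` of symmetric functions in the Sobolev space `H^ε(S²)`. -/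
def symSobolev (ε : ℝ) : Submodule ℝ L2S2 where
  carrier := {f | MemSobolev ε f ∧ IsSymmetricL2 f}
  zero_mem' := by
    refine ⟨?_, fun _ => 0, fun _ _ => rfl, Lp.coeFn_zero _ _ _⟩
    have h (l : ℕ) (m : ℤ) : coeffLM 0 l m = 0 := by
      have := coeffLM_smul 0 0 l m
      simpa using this
    unfold MemSobolev
    simp [h, summable_zero]
  add_mem' := by
    rintro f g ⟨hf, a, ha, hfa⟩ ⟨hg, b, hb, hgb⟩
    refine ⟨?_, fun s => a s + b s, fun x s => congrArg₂ (· + ·) (ha x s) (hb x s), ?_⟩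
    · unfold MemSobolev at hf hg ⊢
      refine Summable.of_nonneg_of_le (fun l => by positivity) (fun l => ?_)
        ((hf.add hg).mul_left (2 : ℝ))
      rw [← mul_add, mul_left_comm, ← Finset.sum_add_distrib, Finset.mul_sum (a := (2 : ℝ))]
      refine mul_le_mul_of_nonneg_left (Finset.sum_le_sum fun m _ => ?_)
        (Real.rpow_nonneg (by positivity) _)
      rw [coeffLM_add]
      have h := norm_add_le (coeffLM f l m) (coeffLM g l m)
      nlinarith [sq_nonneg (‖coeffLM f l m‖ - ‖coeffLM g l m‖),
        norm_nonneg (coeffLM f l m + coeffLM g l m),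
        norm_nonneg (coeffLM f l m), norm_nonneg (coeffLM g l m)]
    · filter_upwards [Lp.coeFn_add f g, hfa, hgb] with s h1 h2 h3
      rw [h1, Pi.add_apply, h2, h3]
  smul_mem' := by
    rintro c f ⟨hf, a, ha, hfa⟩
    refine ⟨?_, fun s => c * a s, fun x s => congrArg (c * ·) (ha x s), ?_⟩
    · unfold MemSobolev at hf ⊢
      refine (hf.mul_left (c ^ 2)).congr fun l => ?_
      rw [mul_left_comm, Finset.mul_sum (a := c ^ 2)]
      refine congrArg _ (Finset.sum_congr rfl fun m _ => ?_)
      rw [coeffLM_smul, norm_mul, mul_pow, Complex.norm_real, Real.norm_eq_abs, sq_abs]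
    · filter_upwards [Lp.coeFn_smul c f, hfa] with s h1 h2
      rw [h1, Pi.smul_apply, h2, smul_eq_mul]

/-- The Sobolev norm `‖f‖_ε² = ∑ (ℓ + 1/2)^{2ε} f_ℓ²` on `𝔥_ε`, with `f_ℓ = f_{ℓ 0}`. -/
def sobolevNorm (ε : ℝ) (f : L2S2) : ℝ :=
  Real.sqrt (∑' l : ℕ, ((l : ℝ) + 1 / 2) ^ (2 * ε) * ‖coeffLM f l 0‖ ^ 2)

/-- The class in `L²(S²)` of a test function. -/
def TestFn.toL2 (f : TestFn) : L2S2 :=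
  ContinuousMap.toLp 2 area ℝ (⟨f.1, f.1.contMDiff.continuous⟩ : C(S2, ℝ))

/-- The dual of `𝔥_ε`, as a subset of `𝒮'`: the restrictions to `𝒮` of the linear functionals on
`𝔥_ε` that are bounded for the Sobolev norm. -/
def sobolevDual (ε : ℝ) : Set Distr :=
  {T | ∃ L : symSobolev ε →ₗ[ℝ] ℝ,
    (∃ K : ℝ, ∀ f : symSobolev ε, |L f| ≤ K * sobolevNorm ε f.1) ∧
    ∀ f : TestFn, ∃ hf : f.toL2 ∈ symSobolev ε, L ⟨f.toL2, hf⟩ = T f}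

/-- The symmetric square integrable functions, as a subset of `𝒮'`. -/
def symL2 : Set Distr :=
  {T | ∃ g : L2S2, IsSymmetricL2 g ∧ ∀ f : TestFn, T f = ∫ s, f.1 s * g s ∂area}

/-- The classical configurations `𝒮`, as a subset of `𝒮'`. -/
def classical : Set Distr :=
  {T | ∃ g : TestFn, ∀ f : TestFn, T f = pairing f g}

/-- The set `Z_t(Δ)` of the `T` with `|T(Y_{ℓ 0})| < |z_ℓ(t)| (2 log Δ_ℓ)^{1/2}` for all
sufficiently large `ℓ`. -/
def Zset (ρ ν : ℕ → ℝ) (t : ℝ) (Δ : ℕ → ℝ) : Set Distr :=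
  {T | ∃ N : ℕ, ∀ l : ℕ, N ≤ l → |T (Y l)| < ‖mode ρ ν l t‖ * Real.sqrt (2 * Real.log (Δ l))}

end

end Gowdy

namespace Gowdy

noncomputable section

/-! ### Legendre polynomials -/

/-! Everything becomes diagonal in the zonal harmonics. Taking coefficients identifies 𝒮 with the
rapidly decreasing sequences (`coeff_decay`, `eq_zero_of_coeff_eq_zero`, `synth`), and the expansion
of a test function converges in the C^∞ topology (`tendsto_sum_coeff_smul_Y`). So a distribution is
determined by its coordinates T(Y_ℓ), these countably many functions generate the cylinder
σ-algebra, and every polynomially bounded sequence is the coordinate sequence of some distribution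
(`exists_distr`).

Complex structure: for each ℓ, the passage from the amplitude b_ℓ to the pair (Q_ℓ, P_ℓ) is a real
2×2 system whose determinant is a fixed nonzero constant, by the Legendre Wronskian (`mode_det`).
Solving it, multiplying b_ℓ by i and substituting back gives the four blocks of J as multipliers;
the multiplier of B is -2|z_ℓ|². Polynomial bounds in ℓ make these multipliers act on 𝒮.

Measure: the product of the centred Gaussians with variances |z_ℓ|² on ℝ^ℕ charges only sequences of
at most linear growth, so it can be pushed forward to 𝒮' (`exists_isGaussianWithCov`). Conversely, a
measure with the given characteristic functional has independent Gaussian coordinates, which gives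
uniqueness and the finite-dimensional laws.

Supports: membership in each set is a condition on the coordinates, namely ∑ (ℓ+1/2)^(-2ε) T_ℓ² < ∞
for the Sobolev dual and ∑ T_ℓ² < ∞ for L². Two facts about the variances decide both: |z_ℓ|² =
O(1/ℓ), from an almost conserved quadratic form for Bonnet's recursion (`bonnet_sq_le`), and ∑
|z_ℓ|² = ∞, from the constancy of the discrete Wronskian (`legendre_casoratian`). The first makes
the expectation of the weighted sum finite (`ae_summable_mul_sq`); the second makes E exp(-∑ T_ℓ²)
vanish (`ae_not_summable_sq`). The sets Z(Δ) are handled by the two Borel–Cantelli lemmas and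
two-sided Gaussian tail bounds of order 1/(Δ √log Δ). -/

lemma legP_rec (n : ℕ) (x : ℝ) : ((n : ℝ) + 2) * (legP (n + 2)).eval x =
    (2 * (n : ℝ) + 3) * x * (legP (n + 1)).eval x - ((n : ℝ) + 1) * (legP n).eval x := by
  have h : (n : ℝ) + 2 ≠ 0 := by positivity
  simp only [legP, Polynomial.eval_mul, Polynomial.eval_sub, Polynomial.eval_C,
    Polynomial.eval_X]
  field_simp

lemma legP_derivative_rec (n : ℕ) (x : ℝ) :
    ((n : ℝ) + 2) * (legP (n + 2)).derivative.eval x =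
    (2 * (n : ℝ) + 3) * ((legP (n + 1)).eval x + x * (legP (n + 1)).derivative.eval x)
      - ((n : ℝ) + 1) * (legP n).derivative.eval x := by
  have h : (n : ℝ) + 2 ≠ 0 := by positivity
  simp only [legP, Polynomial.derivative_mul, Polynomial.derivative_sub, Polynomial.derivative_C,
    Polynomial.derivative_X, Polynomial.eval_mul, Polynomial.eval_sub, Polynomial.eval_add,
    Polynomial.eval_C, Polynomial.eval_X, zero_mul, zero_add, mul_one]
  field_simp

/-- The two identities must be carried together: the differentiated recursion turns the first at n
into the second at n + 1, and that together with both at n gives the first at n + 1. -/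
lemma legP_derivative_aux (x : ℝ) (n : ℕ) :
    x * (legP (n + 1)).derivative.eval x - (legP n).derivative.eval x
      = ((n : ℝ) + 1) * (legP (n + 1)).eval x ∧
    (legP (n + 1)).derivative.eval x - x * (legP n).derivative.eval x
      = ((n : ℝ) + 1) * (legP n).eval x := by
  induction n with
  | zero => simp [legP]
  | succ n ih =>
    obtain ⟨hA, hB⟩ := ih
    have r := legP_rec n x
    have r' := legP_derivative_rec n x
    have h : (n : ℝ) + 2 ≠ 0 := by positivity
    have hB' : (legP (n + 1 + 1)).derivative.eval x - x * (legP (n + 1)).derivative.eval x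
        = ((n + 1 : ℕ) + 1 : ℝ) * (legP (n + 1)).eval x := by
      apply mul_left_cancel₀ h
      push_cast
      linear_combination r' + ((n : ℝ) + 1) * hA
    refine ⟨?_, hB'⟩
    push_cast at hB' ⊢
    linear_combination x * hB' - r - hB + x * hA

/-- This has the same shape as the derivative formula in `hasDerivAt_legQ`, so that the Wronskian of
P and Q reduces to their Casoratian. -/
lemma legP_derivative_succ (n : ℕ) (x : ℝ) :
    (1 - x ^ 2) * (legP n).derivative.eval x
      = ((n : ℝ) + 1) * (x * (legP n).eval x - (legP (n + 1)).eval x) := by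
  obtain ⟨hA, hB⟩ := legP_derivative_aux x n
  linear_combination x * hB - hA

lemma legP_derivative_add_two (n : ℕ) :
    (legP (n + 2)).derivative
      = (legP n).derivative + Polynomial.C (2 * (n : ℝ) + 3) * legP (n + 1) := by
  refine Polynomial.funext fun x => ?_
  have hA := (legP_derivative_aux x n).1
  have hB := (legP_derivative_aux x (n + 1)).2
  simp only [Polynomial.eval_add, Polynomial.eval_mul, Polynomial.eval_C]
  push_cast at hB
  linear_combination hA + hB

lemma legP_eval_one (n : ℕ) : (legP n).eval 1 = 1 := by
  induction n using Nat.twoStepInduction with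
  | zero => simp [legP]
  | one => simp [legP]
  | more n h0 h1 =>
    have h : (n : ℝ) + 2 ≠ 0 := by positivity
    apply mul_left_cancel₀ h
    rw [legP_rec, h0, h1]
    ring

lemma legP_eval_neg (n : ℕ) (x : ℝ) : (legP n).eval (-x) = (-1) ^ n * (legP n).eval x := by
  induction n using Nat.twoStepInduction with
  | zero => simp [legP]
  | one => simp [legP]
  | more n h0 h1 =>
    have h : (n : ℝ) + 2 ≠ 0 := by positivity
    apply mul_left_cancel₀ h
    rw [legP_rec, h0, h1]
    linear_combination -(-1) ^ n * legP_rec n x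

/-- Writing E_n for the left side, (n+2)² E_{n+1} = (n+1)² E_n + (2n+3)(1-x²) P_{n+1}². Completing
the square gives (1-x²) P_{n+1}² ≤ E_n, and (n+1)² + (2n+3) = (n+2)², so the bound is inherited as
an average. It is an elementary route to |P_n| ≤ 1 on [-1, 1]. -/
lemma legP_energy_le (x : ℝ) (n : ℕ) :
    (legP (n + 1)).eval x ^ 2 - 2 * x * (legP (n + 1)).eval x * (legP n).eval x
      + (legP n).eval x ^ 2 ≤ 1 - x ^ 2 := by
  induction n with
  | zero => simp only [legP, Polynomial.eval_X, Polynomial.eval_one]; linarith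
  | succ n ih =>
    have r := legP_rec n x
    have h : (0 : ℝ) < ((n : ℝ) + 2) ^ 2 := by positivity
    refine le_of_mul_le_mul_left ?_ h
    set a := (legP (n + 1)).eval x
    set b := (legP n).eval x
    set c := (legP (n + 1 + 1)).eval x
    have e : ((n : ℝ) + 2) ^ 2 * (c ^ 2 - 2 * x * c * a + a ^ 2)
        = ((n : ℝ) + 1) ^ 2 * (a ^ 2 - 2 * x * a * b + b ^ 2)
          + (2 * n + 3) * ((1 - x ^ 2) * a ^ 2) := by
      linear_combination (((n : ℝ) + 2) * c + (2 * (n : ℝ) + 3) * x * a - ((n : ℝ) + 1) * b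
        - 2 * x * (n + 2) * a) * r
    have h2 : (1 - x ^ 2) * a ^ 2 ≤ 1 - x ^ 2 := by nlinarith [sq_nonneg (b - x * a)]
    rw [e]
    have hn : (0 : ℝ) ≤ n := n.cast_nonneg
    nlinarith [mul_le_mul_of_nonneg_left ih (sq_nonneg ((n : ℝ) + 1)),
      mul_le_mul_of_nonneg_left h2 (by positivity : (0 : ℝ) ≤ 2 * n + 3)]

lemma abs_legP_le_one (n : ℕ) {x : ℝ} (hx : |x| ≤ 1) : |(legP n).eval x| ≤ 1 := by
  have hx2 : x ^ 2 ≤ 1 := (sq_le_one_iff_abs_le_one x).2 hx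
  rcases hx2.lt_or_eq with h | h
  · rw [← sq_le_one_iff_abs_le_one]
    have h1 := legP_energy_le x n
    have h2 : (1 - x ^ 2) * (legP n).eval x ^ 2 ≤ (1 - x ^ 2) * 1 := by
      nlinarith [sq_nonneg ((legP (n + 1)).eval x - x * (legP n).eval x)]
    exact le_of_mul_le_mul_left h2 (by linarith)
  · rcases mul_eq_zero.1 (show (x - 1) * (x + 1) = 0 by linear_combination h) with h | h
    · obtain rfl : x = 1 := by linarith
      simp [legP_eval_one]
    · obtain rfl : x = -1 := by linarith
      simp [legP_eval_neg, legP_eval_one]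

/-- Each differentiation costs two powers of the degree: P'_{n+2} = P'_n + (2n+3) P_{n+1} trades a
derivative for a sum over lower degrees, and (n+1)² + (2n+3) ≤ (n+3)². The outer induction is on the
order, the inner one on the degree. -/
lemma abs_iterate_derivative_legP_le (i n : ℕ) {x : ℝ} (hx : |x| ≤ 1) :
    |(Polynomial.derivative^[i] (legP n)).eval x| ≤ ((n : ℝ) + 1) ^ (2 * i) := by
  induction i generalizing n with
  | zero => simpa using abs_legP_le_one n hx
  | succ i ih =>
    induction n using Nat.twoStepInduction with
    | zero => simp [legP]
    | one =>
      rw [Function.iterate_succ_apply]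
      simp only [legP, Polynomial.derivative_X]
      rcases i with _ | i
      · norm_num
      · simp only [Function.iterate_succ_apply, Polynomial.derivative_one,
          Polynomial.iterate_derivative_zero, Polynomial.eval_zero, abs_zero]
        positivity
    | more n h0 h1 =>
      rw [Function.iterate_succ_apply, legP_derivative_add_two, iterate_map_add,
        Polynomial.iterate_derivative_C_mul, ← Function.iterate_succ_apply, Polynomial.eval_add,
        Polynomial.eval_mul, Polynomial.eval_C]
      have hn : (0 : ℝ) ≤ n := n.cast_nonneg
      have h2 := ih (n + 1)
      have e1 : ((n : ℝ) + 1) ^ (2 * i) ≤ ((n : ℝ) + 3) ^ (2 * i) := by gcongr; norm_num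
      have e2 : ((n + 1 : ℕ) + 1 : ℝ) ^ (2 * i) ≤ ((n : ℝ) + 3) ^ (2 * i) :=
        pow_le_pow_left₀ (by positivity) (by push_cast; linarith) _
      calc _ ≤ ((n : ℝ) + 1) ^ (2 * (i + 1)) + (2 * (n : ℝ) + 3) * ((n + 1 : ℕ) + 1 : ℝ) ^ (2 * i) := by
            refine (abs_add_le _ _).trans (add_le_add h0 ?_)
            rw [abs_mul, abs_of_nonneg (by positivity : (0 : ℝ) ≤ 2 * n + 3)]
            exact mul_le_mul_of_nonneg_left h2 (by positivity)
        _ ≤ ((n : ℝ) + 3) ^ (2 * i) * ((n : ℝ) + 1) ^ 2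
            + (2 * (n : ℝ) + 3) * ((n : ℝ) + 3) ^ (2 * i) := by
            rw [mul_add 2, pow_add]
            gcongr
        _ ≤ ((n : ℝ) + 3) ^ (2 * i) * ((n : ℝ) + 3) ^ 2 := by
            have : (0 : ℝ) ≤ ((n : ℝ) + 3) ^ (2 * i) := by positivity
            nlinarith
        _ = _ := by push_cast; rw [mul_add 2, pow_add]; congr 2 <;> ring

/-! ### Orthogonality -/

lemma intervalIntegrable_eval (p : Polynomial ℝ) (a b : ℝ) :
    IntervalIntegrable (fun x => p.eval x) volume a b :=
  p.continuous.intervalIntegrable a b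

/-- Integration of polynomials over `[-1, 1]`. -/
def polyInt : Polynomial ℝ →ₗ[ℝ] ℝ where
  toFun p := ∫ x in (-1 : ℝ)..1, p.eval x
  map_add' p q := by
    simp only [Polynomial.eval_add]
    exact intervalIntegral.integral_add (intervalIntegrable_eval p _ _)
      (intervalIntegrable_eval q _ _)
  map_smul' c p := by
    simp only [Polynomial.eval_smul, smul_eq_mul, RingHom.id_apply]
    exact intervalIntegral.integral_const_mul _ _

lemma polyInt_apply (p : Polynomial ℝ) : polyInt p = ∫ x in (-1 : ℝ)..1, p.eval x := rfl

/-- A primitive of (2n+3) P_{n+1} is P_{n+2} - P_n, which vanishes at both endpoints by the values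
at 1 and parity. -/
lemma polyInt_legP_succ (n : ℕ) : polyInt (legP (n + 1)) = 0 := by
  have h : (2 * (n : ℝ) + 3) ≠ 0 := by positivity
  apply mul_left_cancel₀ h
  have e : (Polynomial.derivative (legP (n + 2) - legP n)) = (2 * (n : ℝ) + 3) • legP (n + 1) := by
    rw [Polynomial.derivative_sub, legP_derivative_add_two, Polynomial.smul_eq_C_mul]
    ring
  rw [← smul_eq_mul, ← map_smul, ← e, mul_zero, polyInt_apply,
    intervalIntegral.integral_eq_sub_of_hasDerivAt (fun x _ => Polynomial.hasDerivAt _ x)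
      (intervalIntegrable_eval _ _ _)]
  simp only [Polynomial.eval_sub, legP_eval_neg, legP_eval_one]
  ring

lemma X_mul_legP (n : ℕ) : Polynomial.X * legP (n + 1) =
    (((n : ℝ) + 2) / (2 * n + 3)) • legP (n + 2) + (((n : ℝ) + 1) / (2 * n + 3)) • legP n := by
  refine Polynomial.funext fun x => ?_
  have r := legP_rec n x
  have h : (2 * (n : ℝ) + 3) ≠ 0 := by positivity
  simp only [Polynomial.eval_mul, Polynomial.eval_X, Polynomial.eval_add, Polynomial.eval_smul,
    smul_eq_mul]
  field_simp
  linear_combination -r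

/-- Polynomials orthogonal to the Legendre polynomials of degree greater than `k`. -/
def orthAbove (k : ℕ) : Submodule ℝ (Polynomial ℝ) where
  carrier := {p | ∀ l, k < l → polyInt (p * legP l) = 0}
  zero_mem' := fun l _ => by simp
  add_mem' := fun {p q} hp hq l hl => by rw [add_mul, map_add, hp l hl, hq l hl, add_zero]
  smul_mem' := fun c p hp l hl => by rw [smul_mul_assoc, map_smul, hp l hl, smul_zero]

lemma orthAbove_mono {j k : ℕ} (h : j ≤ k) : orthAbove j ≤ orthAbove k :=
  fun _ hp l hl => hp l (h.trans_lt hl)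

lemma one_mem_orthAbove : (1 : Polynomial ℝ) ∈ orthAbove 0 := fun l hl => by
  obtain ⟨n, rfl⟩ := Nat.exists_eq_succ_of_ne_zero hl.ne'
  rw [one_mul, polyInt_legP_succ]

/-- Multiplication by X can be moved onto P_l, where it produces only the neighbours l ± 1. Hence
every sequence generated from 1 by a three-term recursion respects the filtration; this serves both
the Legendre and the Chebyshev polynomials. -/
lemma X_mul_mem_orthAbove {k : ℕ} {p : Polynomial ℝ} (hp : p ∈ orthAbove k) :
    Polynomial.X * p ∈ orthAbove (k + 1) := fun l hl => by
  obtain ⟨n, rfl⟩ := Nat.exists_eq_succ_of_ne_zero (Nat.ne_zero_of_lt hl)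
  rw [mul_comm Polynomial.X, mul_assoc, X_mul_legP, mul_add, map_add, mul_smul_comm, mul_smul_comm,
    map_smul, map_smul, hp n (by omega), hp (n + 2) (by omega)]
  simp

lemma legP_mem_orthAbove (n : ℕ) : legP n ∈ orthAbove n := by
  induction n using Nat.twoStepInduction with
  | zero => exact one_mem_orthAbove
  | one => simpa [legP] using X_mul_mem_orthAbove one_mem_orthAbove
  | more n h0 h1 =>
    rw [legP, ← Polynomial.smul_eq_C_mul, mul_assoc, ← Polynomial.smul_eq_C_mul,
      ← Polynomial.smul_eq_C_mul]
    exact Submodule.smul_mem _ _ (Submodule.sub_mem _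
      (Submodule.smul_mem _ _ (X_mul_mem_orthAbove h1))
      (Submodule.smul_mem _ _ (orthAbove_mono (by omega) h0)))

lemma chebyshev_mem_orthAbove (n : ℕ) : Polynomial.Chebyshev.T ℝ n ∈ orthAbove n := by
  induction n using Nat.twoStepInduction with
  | zero => simpa using one_mem_orthAbove
  | one => simpa using X_mul_mem_orthAbove one_mem_orthAbove
  | more n h0 h1 =>
    have e : Polynomial.Chebyshev.T ℝ ((n + 2 : ℕ) : ℤ) =
        (2 : ℝ) • (Polynomial.X * Polynomial.Chebyshev.T ℝ ((n + 1 : ℕ) : ℤ))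
          - Polynomial.Chebyshev.T ℝ (n : ℤ) := by
      push_cast
      rw [Polynomial.Chebyshev.T_add_two, Polynomial.smul_eq_C_mul, ← mul_assoc]
      rfl
    rw [e]
    exact Submodule.sub_mem _ (Submodule.smul_mem _ _ (X_mul_mem_orthAbove h1))
      (orthAbove_mono (by omega) h0)

lemma polyInt_legP_mul_of_ne {m n : ℕ} (h : m ≠ n) : polyInt (legP m * legP n) = 0 := by
  rcases h.lt_or_gt with h | h
  · exact legP_mem_orthAbove m n h
  · rw [mul_comm]
    exact legP_mem_orthAbove n m h

/-- The integral of X P_{n+1} P_n is computed twice, expanding X P_{n+1} or X P_n; comparison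
relates consecutive norms. -/
lemma polyInt_legP_sq (n : ℕ) : (2 * (n : ℝ) + 1) * polyInt (legP n * legP n) = 2 := by
  induction n with
  | zero => simp [legP, polyInt_apply]; norm_num
  | succ n ih =>
    have h : (2 * (n : ℝ) + 3) ≠ 0 := by positivity
    have h' : (2 * (n : ℝ) + 1) ≠ 0 := by positivity
    have h1 : polyInt (Polynomial.X * legP (n + 1) * legP n)
        = ((n : ℝ) + 1) / (2 * n + 3) * polyInt (legP n * legP n) := by
      rw [X_mul_legP, add_mul, map_add, smul_mul_assoc, smul_mul_assoc, map_smul, map_smul,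
        polyInt_legP_mul_of_ne (by omega)]
      simp
    have h2 : polyInt (Polynomial.X * legP (n + 1) * legP n)
        = ((n : ℝ) + 1) / (2 * n + 1) * polyInt (legP (n + 1) * legP (n + 1)) := by
      rw [mul_right_comm]
      rcases n with _ | n
      · simp [legP]
      · rw [X_mul_legP, add_mul, map_add, smul_mul_assoc, smul_mul_assoc, map_smul, map_smul,
          polyInt_legP_mul_of_ne (show n ≠ n + 1 + 1 by omega), smul_zero, add_zero, smul_eq_mul]
        push_cast
        congr 2 <;> ring
    rw [h1] at h2
    push_cast
    field_simp at h2
    linear_combination -h2 + ih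

lemma span_range_legP : Submodule.span ℝ (range legP) = ⊤ := by
  have hX (p : Polynomial ℝ) (hp : p ∈ Submodule.span ℝ (range legP)) :
      Polynomial.X * p ∈ Submodule.span ℝ (range legP) := by
    induction hp using Submodule.span_induction with
    | mem q hq =>
      obtain ⟨n, rfl⟩ := hq
      have hm (k : ℕ) : legP k ∈ Submodule.span ℝ (range legP) :=
        Submodule.subset_span (mem_range_self k)
      rcases n with _ | n
      · simpa [legP] using hm 1
      · rw [X_mul_legP]
        exact Submodule.add_mem _ (Submodule.smul_mem _ _ (hm _)) (Submodule.smul_mem _ _ (hm _))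
    | zero => simp
    | add p q _ _ hp hq => rw [mul_add]; exact Submodule.add_mem _ hp hq
    | smul c p _ hp => rw [mul_smul_comm]; exact Submodule.smul_mem _ _ hp
  rw [eq_top_iff]
  rintro p -
  induction p using Polynomial.induction_on' with
  | add p q hp hq => exact Submodule.add_mem _ hp hq
  | monomial n a =>
    rw [← Polynomial.C_mul_X_pow_eq_monomial, ← Polynomial.smul_eq_C_mul]
    refine Submodule.smul_mem _ _ ?_
    induction n with
    | zero => exact Submodule.subset_span ⟨0, by simp [legP]⟩
    | succ n ih => rw [pow_succ']; exact hX _ ih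

/-! ### Legendre functions of the second kind -/

lemma legQ_rec (n : ℕ) (x : ℝ) : ((n : ℝ) + 2) * legQ (n + 2) x =
    (2 * (n : ℝ) + 3) * x * legQ (n + 1) x - ((n : ℝ) + 1) * legQ n x := by
  have h : (n : ℝ) + 2 ≠ 0 := by positivity
  simp only [legQ]
  field_simp

/-- The formula propagates along Bonnet's recursion, so the logarithm enters only for n = 0 and n =
1. -/
lemma hasDerivAt_legQ (n : ℕ) {x : ℝ} (hx : x ∈ Ioo (-1 : ℝ) 1) :
    HasDerivAt (legQ n) (((n : ℝ) + 1) * (x * legQ n x - legQ (n + 1) x) / (1 - x ^ 2)) x := by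
  have h1 : 1 + x ≠ 0 := by linarith [hx.1]
  have h2 : 1 - x ≠ 0 := by linarith [hx.2]
  have h3 : 1 - x ^ 2 ≠ 0 := by
    rw [show 1 - x ^ 2 = (1 + x) * (1 - x) by ring]
    exact mul_ne_zero h1 h2
  have hd0 : HasDerivAt (fun x : ℝ => (1 / 2) * Real.log ((1 + x) / (1 - x)))
      (1 / (1 - x ^ 2)) x := by
    have h := ((((hasDerivAt_id x).const_add 1).div ((hasDerivAt_id x).const_sub 1) h2).log
      (div_ne_zero h1 h2)).const_mul (1 / 2 : ℝ)
    refine h.congr_deriv ?_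
    simp only [id_eq, Pi.div_apply]
    rw [show 1 - x ^ 2 = (1 + x) * (1 - x) by ring]
    field_simp
    ring
  induction n using Nat.twoStepInduction with
  | zero =>
    refine hd0.congr_deriv ?_
    simp only [legQ]
    congr 1
    push_cast
    ring
  | one =>
    refine (((hasDerivAt_id x).mul hd0).sub_const 1).congr_deriv ?_
    have r := legQ_rec 0 x
    simp only [Nat.zero_add, CharP.cast_eq_zero] at r
    rw [eq_div_iff h3]
    simp only [legQ, id_eq, zero_add] at r ⊢
    push_cast
    field_simp
    ring
  | more n h0 h1 =>
    have h : (n : ℝ) + 2 ≠ 0 := by positivity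
    have h' : (n : ℝ) + 3 ≠ 0 := by positivity
    have e := ((((hasDerivAt_id x).const_mul (2 * (n : ℝ) + 3)).mul h1).sub
      (h0.const_mul ((n : ℝ) + 1))).const_mul (1 / ((n : ℝ) + 2))
    refine e.congr_deriv ?_
    have r := legQ_rec n x
    have r' := legQ_rec (n + 1) x
    simp only [id_eq]
    push_cast at r' ⊢
    rw [one_div, inv_mul_eq_iff_eq_mul₀ h]
    field_simp
    simp only [add_assoc] at r r' ⊢
    norm_num at r r' ⊢
    linear_combination ((n : ℝ) + 2) * r' - (n + 1) * x * r

/-- P and Q solve the same second-order recursion, so their discrete Wronskian, multiplied by n + 1,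
does not depend on n. It yields both the continuous Wronskian and the divergence of ∑ |z_ℓ|². -/
lemma legendre_casoratian (n : ℕ) (x : ℝ) :
    ((n : ℝ) + 1) * ((legP (n + 1)).eval x * legQ n x - (legP n).eval x * legQ (n + 1) x) = 1 := by
  induction n with
  | zero => simp [legP, legQ]
  | succ n ih =>
    have r := legP_rec n x
    have r' := legQ_rec n x
    push_cast
    linear_combination legQ (n + 1) x * r - (legP (n + 1)).eval x * r' + ih

/-! ### Decay in the degree -/

/-- A discrete Gronwall inequality: the product of the factors 1 + c/(m+1)² is controlled by a
telescoping exponential. -/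
lemma bounded_of_le_one_add_mul {u : ℕ → ℝ} {c : ℝ} (hc : 0 ≤ c) (M : ℕ) (hM : 1 ≤ M)
    (hu : ∀ m, M ≤ m → 0 ≤ u m)
    (h : ∀ m, M ≤ m → u (m + 1) ≤ u m * (1 + c / ((m : ℝ) + 1) ^ 2)) :
    ∀ m, M ≤ m → u m ≤ u M * Real.exp (c / M) := by
  -- The weight exp(c/m) makes the sequence nonincreasing, because 1/(m+1)² + 1/(m+1) ≤ 1/m.
  have key : ∀ m, M ≤ m → u m * Real.exp (c / m) ≤ u M * Real.exp (c / M) := by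
    intro m hm
    induction m, hm using Nat.le_induction with
    | base => exact le_rfl
    | succ m hm ih =>
      refine le_trans ?_ ih
      have hm0 : (0 : ℝ) < m := by exact_mod_cast lt_of_lt_of_le Nat.one_pos (hM.trans hm)
      have e1 : 1 + c / ((m : ℝ) + 1) ^ 2 ≤ Real.exp (c / ((m : ℝ) + 1) ^ 2) := by
        rw [add_comm]; exact Real.add_one_le_exp _
      calc u (m + 1) * Real.exp (c / ((m + 1 : ℕ) : ℝ))
          ≤ (u m * Real.exp (c / ((m : ℝ) + 1) ^ 2)) * Real.exp (c / ((m + 1 : ℕ) : ℝ)) := by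
            gcongr
            exact (h m hm).trans (mul_le_mul_of_nonneg_left e1 (hu m hm))
        _ = u m * Real.exp (c / ((m : ℝ) + 1) ^ 2 + c / ((m + 1 : ℕ) : ℝ)) := by
            rw [mul_assoc, Real.exp_add]
        _ ≤ u m * Real.exp (c / m) := by
            refine mul_le_mul_of_nonneg_left (Real.exp_le_exp.2 ?_) (hu m hm)
            have : 1 / ((m : ℝ) + 1) ^ 2 + 1 / ((m : ℝ) + 1) ≤ 1 / m := by
              rw [div_add_div _ _ (by positivity) (by positivity), div_le_div_iff₀ (by positivity) hm0]
              nlinarith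
            push_cast
            have := mul_le_mul_of_nonneg_left this hc
            simpa only [mul_add, mul_one_div] using this
  intro m hm
  refine le_trans ?_ (key m hm)
  exact le_mul_of_one_le_right (hu m hm) (Real.one_le_exp (by positivity))

/-- The quadratic form F_m in (p_m, p_{m-1}) is almost conserved by the recursion: it is comparable
to m (p_m² + p_{m-1}²) and grows at most by a factor 1 + O(1/m²) per step. So m p_m² stays bounded.
Only the recursion is used, hence the estimate covers P and Q alike. -/
lemma bonnet_sq_le {x : ℝ} (hx : x ^ 2 < 1) {p : ℕ → ℝ}
    (hp : ∀ n : ℕ, ((n : ℝ) + 2) * p (n + 2)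
      = (2 * (n : ℝ) + 3) * x * p (n + 1) - ((n : ℝ) + 1) * p n) :
    ∃ C : ℝ, ∀ n : ℕ, p n ^ 2 ≤ C / ((n : ℝ) + 1) := by
  set s := 1 - x ^ 2 with hs
  have hs0 : 0 < s := by linarith
  have hs1 : s ≤ 1 := by nlinarith [sq_nonneg x]
  -- The shifts ±1/2 cancel the leading part of the increment F_{m+1} - F_m. The determinant of the
  -- form is s m² - 1/4, which is positive as soon as s m ≥ 1 and m ≥ 1.
  let F : ℕ → ℝ := fun m => ((m : ℝ) + 1 / 2) * p m ^ 2 - 2 * x * m * p m * p (m - 1)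
    + ((m : ℝ) - 1 / 2) * p (m - 1) ^ 2
  obtain ⟨M, hM1, hMs⟩ : ∃ M : ℕ, 1 ≤ M ∧ 1 ≤ s * M := by
    obtain ⟨M, hM⟩ := exists_nat_ge (1 / s)
    refine ⟨M + 1, by omega, ?_⟩
    rw [div_le_iff₀ hs0] at hM
    push_cast
    nlinarith
  have hm1 (m : ℕ) (hm : M ≤ m) : (1 : ℝ) ≤ m := by exact_mod_cast hM1.trans hm
  have hms (m : ℕ) (hm : M ≤ m) : 1 ≤ s * m := by
    have : (M : ℝ) ≤ m := by exact_mod_cast hm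
    nlinarith
  have hFb (m : ℕ) (hm : M ≤ m) : s * m / 2 * p (m - 1) ^ 2 ≤ F m := by
    have h1 := hm1 m hm
    have h2 := hms m hm
    have h3 : (0 : ℝ) < (m : ℝ) + 1 / 2 := by linarith
    refine le_of_mul_le_mul_left ?_ h3
    have e : ((m : ℝ) + 1 / 2) * F m = (((m : ℝ) + 1 / 2) * p m - x * m * p (m - 1)) ^ 2
        + p (m - 1) ^ 2 * (s * m ^ 2 - 1 / 4) := by simp only [F, hs]; ring
    rw [e]
    have : ((m : ℝ) + 1 / 2) * (s * m / 2) ≤ s * m ^ 2 - 1 / 4 := by nlinarith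
    nlinarith [sq_nonneg (((m : ℝ) + 1 / 2) * p m - x * m * p (m - 1)),
      mul_le_mul_of_nonneg_right this (sq_nonneg (p (m - 1)))]
  have hFa (m : ℕ) (hm : M ≤ m) : s * m / 2 * p m ^ 2 ≤ F m := by
    have h1 := hm1 m hm
    have h2 := hms m hm
    have h3 : (0 : ℝ) < (m : ℝ) - 1 / 2 := by linarith
    refine le_of_mul_le_mul_left ?_ h3
    have e : ((m : ℝ) - 1 / 2) * F m = (((m : ℝ) - 1 / 2) * p (m - 1) - x * m * p m) ^ 2
        + p m ^ 2 * (s * m ^ 2 - 1 / 4) := by simp only [F, hs]; ring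
    rw [e]
    have : ((m : ℝ) - 1 / 2) * (s * m / 2) ≤ s * m ^ 2 - 1 / 4 := by nlinarith
    nlinarith [sq_nonneg (((m : ℝ) - 1 / 2) * p (m - 1) - x * m * p m),
      mul_le_mul_of_nonneg_right this (sq_nonneg (p m))]
  have hFnn (m : ℕ) (hm : M ≤ m) : 0 ≤ F m := le_trans (by positivity) (hFa m hm)
  have hstep (m : ℕ) (hm : M ≤ m) : F (m + 1) ≤ F m * (1 + (2 / s) / ((m : ℝ) + 1) ^ 2) := by
    obtain ⟨n, rfl⟩ := Nat.exists_eq_succ_of_ne_zero (by have := hM1.trans hm; omega : m ≠ 0)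
    have h1 := hm1 _ hm
    have hb := hFb _ hm
    have r := hp n
    simp only [Nat.succ_eq_add_one, Nat.add_sub_cancel] at hb h1 ⊢
    push_cast at hb h1 ⊢
    set m : ℝ := (n : ℝ) + 1 with hmdef
    set a := p (n + 1)
    set b := p n
    set c := p (n + 1 + 1) with hc
    have r' : (m + 1) * c = (2 * m + 1) * x * a - m * b := by
      rw [hc, hmdef]; linear_combination r
    have hF1 : F (n + 1 + 1) = (m + 3 / 2) * c ^ 2 - 2 * x * (m + 1) * c * a + (m + 1 / 2) * a ^ 2 := by
      simp only [F, Nat.add_sub_cancel]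
      push_cast
      rw [← hc, hmdef]; ring
    have hF0 : F (n + 1) = (m + 1 / 2) * a ^ 2 - 2 * x * m * a * b + (m - 1 / 2) * b ^ 2 := by
      simp only [F, Nat.add_sub_cancel]
      push_cast
      rfl
    have hpos : (0 : ℝ) < (m + 1) ^ 2 := by positivity
    have e : (m + 1) ^ 2 * F (n + 1 + 1) = (m + 1) ^ 2 * F (n + 1)
        + (-(2 * m + 1) * x ^ 2 * a ^ 2 + 2 * m * x * a * b + b ^ 2) / 2 := by
      rw [hF1, hF0]
      linear_combination ((m + 3 / 2) * ((m + 1) * c + ((2 * m + 1) * x * a - m * b))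
        - 2 * x * a * (m + 1) ^ 2) * r'
    -- The a² term is negative and absorbs the cross term; what remains is at most m b², which the
    -- lower bound `hFb` controls by F.
    have hinc : (-(2 * m + 1) * x ^ 2 * a ^ 2 + 2 * m * x * a * b + b ^ 2) / 2 ≤ 2 / s * F (n + 1) := by
      have h5 : (-(2 * m + 1) * x ^ 2 * a ^ 2 + 2 * m * x * a * b + b ^ 2) / 2 ≤ m * b ^ 2 := by
        nlinarith [sq_nonneg (x * a), sq_nonneg b, mul_nonneg (by linarith : 0 ≤ m) (sq_nonneg (x * a - b / 2)),
          mul_nonneg (by linarith : 0 ≤ m - 1) (sq_nonneg b)]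
      refine h5.trans ?_
      rw [div_mul_eq_mul_div, le_div_iff₀ hs0]
      linarith
    refine le_of_mul_le_mul_left ?_ hpos
    rw [e]
    have : (m + 1) ^ 2 * (F (n + 1) * (1 + 2 / s / (m + 1) ^ 2))
        = (m + 1) ^ 2 * F (n + 1) + 2 / s * F (n + 1) := by field_simp
    rw [this]
    linarith
  have hbd := bounded_of_le_one_add_mul (by positivity : (0 : ℝ) ≤ 2 / s) M hM1 hFnn hstep
  set K := F M * Real.exp (2 / s / M)
  have hK : 0 ≤ K := mul_nonneg (hFnn M le_rfl) (Real.exp_pos _).le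
  -- The finite sum takes care of the degrees below M, where the form need not be positive.
  refine ⟨4 / s * K + ∑ n ∈ Finset.range M, ((n : ℝ) + 1) * p n ^ 2, fun n => ?_⟩
  have hsum : (0 : ℝ) ≤ ∑ n ∈ Finset.range M, ((n : ℝ) + 1) * p n ^ 2 :=
    Finset.sum_nonneg fun i _ => by positivity
  rw [le_div_iff₀ (by positivity)]
  rcases lt_or_ge n M with hn | hn
  · have := Finset.single_le_sum (f := fun n : ℕ => ((n : ℝ) + 1) * p n ^ 2)
      (fun i _ => by positivity) (Finset.mem_range.2 hn)
    have h4 : 0 ≤ 4 / s * K := by positivity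
    linarith
  · have h1 := (hFa n hn).trans (hbd n hn)
    have h2 := hm1 n hn
    have : p n ^ 2 * ((n : ℝ) + 1) ≤ 4 / s * K := by
      rw [div_mul_eq_mul_div, le_div_iff₀ hs0]
      nlinarith [mul_nonneg hs0.le (sq_nonneg (p n))]
    linarith

/-! ### Coordinates on the sphere -/

lemma S2_ext {s t : S2} (h0 : s.1 0 = t.1 0) (h1 : s.1 1 = t.1 1) (h2 : s.1 2 = t.1 2) : s = t := by
  apply Subtype.ext
  ext i
  fin_cases i
  · exact h0
  · exact h1
  · exact h2

lemma S2_sq (s : S2) : s.1 0 ^ 2 + s.1 1 ^ 2 + s.1 2 ^ 2 = 1 := by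
  have hs : ‖s.1‖ = 1 := mem_sphere_zero_iff_norm.1 s.2
  rw [EuclideanSpace.norm_eq, Real.sqrt_eq_one, Fin.sum_univ_three] at hs
  simpa only [Real.norm_eq_abs, sq_abs] using hs

@[simp] lemma sph_zero (θ σ : ℝ) : (sph θ σ).1 0 = Real.sin θ * Real.cos σ := rfl
@[simp] lemma sph_one (θ σ : ℝ) : (sph θ σ).1 1 = Real.sin θ * Real.sin σ := rfl
@[simp] lemma sph_two (θ σ : ℝ) : (sph θ σ).1 2 = Real.cos θ := rfl
@[simp] lemma rot_coe_zero (a : ℝ) (s : S2) :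
    (rot a s).1 0 = Real.cos a * s.1 0 - Real.sin a * s.1 1 := rfl
@[simp] lemma rot_coe_one (a : ℝ) (s : S2) :
    (rot a s).1 1 = Real.sin a * s.1 0 + Real.cos a * s.1 1 := rfl
@[simp] lemma rot_coe_two (a : ℝ) (s : S2) : (rot a s).1 2 = s.1 2 := rfl

lemma rot_add (a b : ℝ) (s : S2) : rot (a + b) s = rot a (rot b s) := by
  apply S2_ext <;> simp only [rot_coe_zero, rot_coe_one, rot_coe_two, Real.cos_add, Real.sin_add] <;>
    ring

lemma rot_zero (s : S2) : rot 0 s = s := by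
  apply S2_ext <;> simp

lemma rot_sph (a θ σ : ℝ) : rot a (sph θ σ) = sph θ (a + σ) := by
  apply S2_ext <;> simp only [rot_coe_zero, rot_coe_one, rot_coe_two, sph_zero, sph_one, sph_two,
    Real.cos_add, Real.sin_add] <;> ring

lemma exists_eq_sph (s : S2) : ∃ σ, s = sph (Real.arccos (s.1 2)) σ := by
  have h := S2_sq s
  set z : ℂ := ⟨s.1 0, s.1 1⟩ with hz
  have hn : ‖z‖ = Real.sin (Real.arccos (s.1 2)) := by
    rw [Real.sin_arccos, Complex.norm_def, Complex.normSq_mk]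
    congr 1
    linarith
  refine ⟨z.arg, S2_ext ?_ ?_ ?_⟩
  · rw [sph_zero, ← hn, Complex.norm_mul_cos_arg]
  · rw [sph_one, ← hn, Complex.norm_mul_sin_arg]
  · rw [sph_two, Real.cos_arccos] <;> nlinarith [sq_nonneg (s.1 0), sq_nonneg (s.1 1)]

/-- The definition gives a zero derivative only at angle 0, but at every point; the group law moves
it to every angle. -/
lemma TestFn.apply_rot (f : TestFn) (a : ℝ) (s : S2) : f.1 (rot a s) = f.1 s := by
  have h (b : ℝ) : HasDerivAt (fun a : ℝ => f.1 (rot a s)) 0 b := by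
    have h0 := f.2 (rot b s)
    have h1 : HasDerivAt (fun a : ℝ => f.1 (rot (a - b) (rot b s))) 0 b := by
      refine HasDerivAt.comp_sub_const (f := fun a => f.1 (rot a (rot b s))) b b ?_
      rw [sub_self]
      exact h0
    simpa only [← rot_add, sub_add_cancel] using h1
  have := is_const_of_deriv_eq_zero (fun b => (h b).differentiableAt) (fun b => (h b).deriv) a 0
  simpa only [rot_zero] using this

/-- The value of an axisymmetric function at polar angle `θ`. -/
def TestFn.profile (f : TestFn) (θ : ℝ) : ℝ := f.1 (sph θ 0)

lemma TestFn.apply_sph (f : TestFn) (θ σ : ℝ) : f.1 (sph θ σ) = f.profile θ := by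
  rw [TestFn.profile, ← f.apply_rot σ (sph θ 0), rot_sph, add_zero]

lemma TestFn.apply_eq_profile (f : TestFn) (s : S2) :
    f.1 s = f.profile (Real.arccos (s.1 2)) := by
  obtain ⟨σ, hσ⟩ := exists_eq_sph s
  conv_lhs => rw [hσ]
  exact f.apply_sph _ _

/-- Continuing the meridian through a pole amounts to a half turn about the axis. Thus the profile
is an even, periodic, smooth function on the whole line, and its Fourier analysis meets no boundary
terms at the poles. -/
lemma TestFn.profile_neg (f : TestFn) (θ : ℝ) : f.profile (-θ) = f.profile θ := by
  rw [← f.apply_sph (-θ) Real.pi, TestFn.profile]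
  congr 1
  apply S2_ext <;> simp

lemma TestFn.profile_periodic (f : TestFn) : Function.Periodic f.profile (2 * Real.pi) := fun θ => by
  rw [TestFn.profile, TestFn.profile]
  congr 1
  apply S2_ext <;> simp

lemma contDiff_meridian : ContDiff ℝ ∞ (fun θ : ℝ => ((sph θ 0 : S2) : R3)) := by
  rw [contDiff_euclidean]
  intro i
  fin_cases i
  · exact Real.contDiff_sin.mul contDiff_const
  · exact Real.contDiff_sin.mul contDiff_const
  · exact Real.contDiff_cos

lemma TestFn.contDiff_profile (f : TestFn) : ContDiff ℝ ∞ f.profile := by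
  have := Fact.mk (@finrank_euclideanSpace_fin ℝ _ (2 + 1))
  have h : ContMDiff 𝓘(ℝ, ℝ) (𝓡 2) ∞ (fun θ : ℝ => sph θ 0) :=
    contDiff_meridian.contMDiff.codRestrict_sphere (fun θ => (sph θ 0).2)
  exact (f.1.contMDiff.comp h).contDiff

lemma norm_S2 (s : S2) : ‖(s : R3)‖ = 1 := mem_sphere_zero_iff_norm.1 s.2

lemma S2_ne_zero (s : S2) : (s : R3) ≠ 0 := by
  intro h
  have := norm_S2 s
  rw [h, norm_zero] at this
  exact zero_ne_one this

lemma radial_of_ne {x : R3} (h : x ≠ 0) : (radial x : R3) = ‖x‖⁻¹ • x := by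
  rw [radial, dif_neg h]

lemma radial_coe (s : S2) : radial (s : R3) = s := by
  apply Subtype.ext
  rw [radial_of_ne (S2_ne_zero s), norm_S2, inv_one, one_smul]

/-- This connects smoothness on the manifold with the Euclidean derivatives that define the topology
of the test space. -/
lemma contDiffAt_comp_radial (f : Smooth) {x : R3} (hx : x ≠ 0) :
    ContDiffAt ℝ ∞ (fun x : R3 => f (radial x)) x := by
  have := Fact.mk (@finrank_euclideanSpace_fin ℝ _ (2 + 1))
  let U : TopologicalSpace.Opens R3 := ⟨{0}ᶜ, isOpen_compl_singleton⟩
  have h1 : ContMDiff 𝓘(ℝ, R3) 𝓘(ℝ, R3) ∞ (fun y : U => ‖(y : R3)‖⁻¹ • (y : R3)) := by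
    intro y
    have hy : (y : R3) ≠ 0 := y.2
    have : ContMDiffAt 𝓘(ℝ, R3) 𝓘(ℝ, R3) ∞ (fun y : R3 => ‖y‖⁻¹ • y) (y : R3) :=
      ContDiffAt.contMDiffAt (((contDiffAt_norm ℝ hy).inv (norm_ne_zero_iff.2 hy)).smul contDiffAt_id)
    exact contMDiffAt_subtype_iff.2 this
  have h2 : ContMDiff 𝓘(ℝ, R3) (𝓡 2) ∞ (fun y : U => radial (y : R3)) := by
    have hm (y : U) : ‖(y : R3)‖⁻¹ • (y : R3) ∈ Metric.sphere (0 : R3) 1 := by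
      have hy : (y : R3) ≠ 0 := y.2
      rw [← radial_of_ne hy]
      exact (radial (y : R3)).2
    have e : (fun y : U => radial (y : R3)) = Set.codRestrict _ _ hm :=
      funext fun y => Subtype.ext (radial_of_ne y.2)
    rw [e]
    exact h1.codRestrict_sphere hm
  have h3 := (f.contMDiff.comp h2) ⟨x, hx⟩
  exact ((contMDiffAt_subtype_iff (U := U) (x := ⟨x, hx⟩) (f := fun x : R3 => f (radial x))).1
    h3).contDiffAt

/-! ### Integration over the sphere -/

lemma continuous_sph : Continuous (fun p : ℝ × ℝ => sph p.1 p.2) := by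
  refine Continuous.subtype_mk ?_ _
  refine (PiLp.continuous_toLp 2 _).comp ?_
  refine continuous_pi fun i => ?_
  fin_cases i
  · exact (Real.continuous_sin.comp continuous_fst).mul (Real.continuous_cos.comp continuous_snd)
  · exact (Real.continuous_sin.comp continuous_fst).mul (Real.continuous_sin.comp continuous_snd)
  · exact Real.continuous_cos.comp continuous_fst

lemma integral_area {E : Type*} [NormedAddCommGroup E] [NormedSpace ℝ E]
    {h : S2 → E} (hh : Continuous h) :
    ∫ s, h s ∂area = ∫ θ in (0 : ℝ)..Real.pi, ∫ σ in (0 : ℝ)..(2 * Real.pi),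
      Real.sin θ • h (sph θ σ) := by
  have hc : Continuous (fun p : ℝ × ℝ => h (sph p.1 p.2)) := hh.comp continuous_sph
  rw [area, integral_map continuous_sph.aemeasurable
    (hh.stronglyMeasurable_of_hasCompactSupport (HasCompactSupport.of_compactSpace h)).aestronglyMeasurable]
  have hs : Measurable fun p : ℝ × ℝ => (Real.sin p.1).toNNReal :=
    (Real.measurable_sin.comp measurable_fst).real_toNNReal
  have e1 := integral_withDensity_eq_integral_smul
    (μ := (volume : Measure (ℝ × ℝ)).restrict (Ioo 0 Real.pi ×ˢ Ioo 0 (2 * Real.pi))) hs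
    (fun p => h (sph p.1 p.2))
  have e2 : ∫ p : ℝ × ℝ in Ioo 0 Real.pi ×ˢ Ioo 0 (2 * Real.pi),
      (Real.sin p.1).toNNReal • h (sph p.1 p.2)
      = ∫ p : ℝ × ℝ in Ioo 0 Real.pi ×ˢ Ioo 0 (2 * Real.pi), Real.sin p.1 • h (sph p.1 p.2) := by
    refine setIntegral_congr_fun (measurableSet_Ioo.prod measurableSet_Ioo) fun p hp => ?_
    simp only [NNReal.smul_def]
    rw [Real.coe_toNNReal _ (Real.sin_pos_of_pos_of_lt_pi hp.1.1 hp.1.2).le]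
  refine e1.trans (e2.trans ?_)
  have hint : IntegrableOn (fun p : ℝ × ℝ => Real.sin p.1 • h (sph p.1 p.2))
      (Ioo 0 Real.pi ×ˢ Ioo 0 (2 * Real.pi)) (volume.prod volume) := by
    have hcont : Continuous fun p : ℝ × ℝ => Real.sin p.1 • h (sph p.1 p.2) :=
      (Real.continuous_sin.comp continuous_fst).smul hc
    rw [← Measure.volume_eq_prod]
    exact (hcont.continuousOn.integrableOn_compact
      (isCompact_Icc.prod isCompact_Icc)).mono_set
        (prod_mono Ioo_subset_Icc_self Ioo_subset_Icc_self)
  rw [Measure.volume_eq_prod, setIntegral_prod _ hint,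
    intervalIntegral.integral_of_le Real.pi_pos.le, integral_Ioc_eq_integral_Ioo]
  refine setIntegral_congr_fun measurableSet_Ioo fun θ _ => ?_
  simp only
  rw [intervalIntegral.integral_of_le (by positivity), integral_Ioc_eq_integral_Ioo]

lemma TestFn.continuous (f : TestFn) : Continuous (fun s => f.1 s) := f.1.contMDiff.continuous

lemma TestFn.continuous_profile (f : TestFn) : Continuous f.profile := f.contDiff_profile.continuous

lemma pairing_eq (f g : TestFn) : pairing f g
    = 2 * Real.pi * ∫ θ in (0 : ℝ)..Real.pi, f.profile θ * g.profile θ * Real.sin θ := by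
  rw [pairing, integral_area (h := fun s => f.1 s * g.1 s) (f.continuous.mul g.continuous), ← intervalIntegral.integral_const_mul]
  refine intervalIntegral.integral_congr fun θ _ => ?_
  simp only [TestFn.apply_sph, intervalIntegral.integral_const, smul_eq_mul, sub_zero]
  ring

lemma integral_cos_mul_sin (p : Polynomial ℝ) :
    ∫ θ in (0 : ℝ)..Real.pi, p.eval (Real.cos θ) * Real.sin θ = polyInt p := by
  have h := intervalIntegral.integral_comp_mul_deriv (a := 0) (b := Real.pi) (f := Real.cos)
    (f' := fun θ => -Real.sin θ) (g := fun x => p.eval x)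
    (fun x _ => Real.hasDerivAt_cos x) (Real.continuous_sin.neg.continuousOn) p.continuous
  simp only [Function.comp_apply, mul_neg, intervalIntegral.integral_neg, Real.cos_zero,
    Real.cos_pi] at h
  rw [polyInt_apply, intervalIntegral.integral_symm 1 (-1), ← h, neg_neg]

/-- The normalization constant of the zonal harmonics. -/
def normY (l : ℕ) : ℝ := Real.sqrt ((2 * (l : ℝ) + 1) / (4 * Real.pi))

lemma Y_apply (l : ℕ) (s : S2) : (Y l).1 s = normY l * (legP l).eval (s.1 2) := rfl

lemma Y_profile (l : ℕ) (θ : ℝ) : (Y l).profile θ = normY l * (legP l).eval (Real.cos θ) := rfl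

lemma normY_sq (l : ℕ) : normY l ^ 2 = (2 * (l : ℝ) + 1) / (4 * Real.pi) :=
  Real.sq_sqrt (by positivity)

lemma normY_nonneg (l : ℕ) : 0 ≤ normY l := Real.sqrt_nonneg _

lemma normY_pos (l : ℕ) : 0 < normY l := Real.sqrt_pos.2 (by positivity)

lemma normY_le (l : ℕ) : normY l ≤ (l : ℝ) + 1 := by
  refine Real.sqrt_le_iff.2 ⟨by positivity, ?_⟩
  rw [div_le_iff₀ (by positivity)]
  nlinarith [Real.pi_gt_three, sq_nonneg (l : ℝ), (l.cast_nonneg : (0 : ℝ) ≤ l)]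

lemma abs_Y_le (l : ℕ) (s : S2) : |(Y l).1 s| ≤ (l : ℝ) + 1 := by
  rw [Y_apply, abs_mul, abs_of_nonneg (normY_nonneg l)]
  have h : |s.1 2| ≤ 1 := by
    rw [← sq_le_one_iff_abs_le_one]
    nlinarith [S2_sq s, sq_nonneg (s.1 0), sq_nonneg (s.1 1)]
  calc _ ≤ normY l * 1 := mul_le_mul_of_nonneg_left (abs_legP_le_one l h) (normY_nonneg l)
    _ ≤ _ := by rw [mul_one]; exact normY_le l

lemma pairing_Y (l m : ℕ) : pairing (Y l) (Y m) = if l = m then 1 else 0 := by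
  have e : pairing (Y l) (Y m) = 2 * Real.pi * (normY l * normY m * polyInt (legP l * legP m)) := by
    rw [pairing_eq, ← integral_cos_mul_sin, ← intervalIntegral.integral_const_mul (normY l * normY m)]
    congr 1
    refine intervalIntegral.integral_congr fun θ _ => ?_
    simp only [Y_profile, Polynomial.eval_mul]
    ring
  rw [e]
  split_ifs with h
  · subst h
    have h1 := polyInt_legP_sq l
    have h2 := normY_sq l
    rw [← sq, h2]
    have := Real.pi_pos.ne'
    field_simp
    linarith
  · rw [polyInt_legP_mul_of_ne h]
    ring

lemma pairing_comm (f g : TestFn) : pairing f g = pairing g f := by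
  simp only [pairing, mul_comm]

lemma coeff_Y (l m : ℕ) : coeff (Y m) l = if l = m then 1 else 0 := pairing_Y l m

lemma integrable_of_continuous_S2 {E : Type*} [NormedAddCommGroup E] {h : S2 → E}
    (hh : Continuous h) : Integrable h area :=
  hh.integrable_of_hasCompactSupport (HasCompactSupport.of_compactSpace h)

lemma integrable_mul (f g : TestFn) : Integrable (fun s => f.1 s * g.1 s) area :=
  integrable_of_continuous_S2 (f.continuous.mul g.continuous)

/-- The pairing as a bilinear form. -/
def pairingₗ : TestFn →ₗ[ℝ] TestFn →ₗ[ℝ] ℝ :=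
  LinearMap.mk₂ ℝ pairing
    (fun f f' g => by
      simp only [pairing]
      rw [← integral_add (integrable_mul f g) (integrable_mul f' g)]
      congr 1; ext s
      exact add_mul (f.1 s) (f'.1 s) (g.1 s))
    (fun c f g => by
      simp only [pairing, smul_eq_mul]
      rw [← integral_const_mul]
      congr 1; ext s
      exact mul_assoc c (f.1 s) (g.1 s))
    (fun f g g' => by
      simp only [pairing]
      rw [← integral_add (integrable_mul f g) (integrable_mul f g')]
      congr 1; ext s
      exact mul_add (f.1 s) (g.1 s) (g'.1 s))
    (fun c f g => by
      simp only [pairing, smul_eq_mul]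
      rw [← integral_const_mul]
      congr 1; ext s
      exact mul_left_comm (f.1 s) c (g.1 s))

lemma coeff_eq (f : TestFn) (l : ℕ) : coeff f l = pairingₗ (Y l) f := rfl

lemma coeff_add (f g : TestFn) (l : ℕ) : coeff (f + g) l = coeff f l + coeff g l := by
  simp only [coeff_eq, map_add]

lemma coeff_sub (f g : TestFn) (l : ℕ) : coeff (f - g) l = coeff f l - coeff g l := by
  simp only [coeff_eq, map_sub]

lemma coeff_smul (c : ℝ) (f : TestFn) (l : ℕ) : coeff (c • f) l = c * coeff f l := by
  simp only [coeff_eq, map_smul, smul_eq_mul]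

/-! ### Fourier series of the profile -/

lemma periodic_deriv {φ : ℝ → ℝ} {T : ℝ} (hp : Function.Periodic φ T) :
    Function.Periodic (deriv φ) T := fun x => by
  rw [← deriv_comp_add_const]
  congr 1
  exact funext hp

lemma hasDerivAt_cexp_neg (n : ℤ) (x : ℝ) :
    HasDerivAt (fun x : ℝ => Complex.exp (-(Complex.I * n * x)))
      (Complex.exp (-(Complex.I * n * x)) * (-(Complex.I * n))) x := by
  have h : HasDerivAt (fun x : ℝ => -(Complex.I * n * (x : ℂ))) (-(Complex.I * n)) x := by
    exact (((Complex.ofRealCLM.hasDerivAt (x := x)).const_mul (Complex.I * n)).neg).congr_deriv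
      (by simp)
  exact h.cexp

lemma norm_cexp_neg (n : ℤ) (x : ℝ) : ‖Complex.exp (-(Complex.I * n * x))‖ = 1 := by
  have : -(Complex.I * n * x) = ((-(n * x) : ℝ) : ℂ) * Complex.I := by push_cast; ring
  rw [this, Complex.norm_exp_ofReal_mul_I]

lemma cexp_neg_period (n : ℤ) : Complex.exp (-(Complex.I * n * ((2 * Real.pi : ℝ) : ℂ))) = 1 := by
  rw [Complex.exp_eq_one_iff]
  exact ⟨-n, by push_cast; ring⟩

lemma integral_cexp_mul_iteratedDeriv (n : ℤ) (k : ℕ) {φ : ℝ → ℝ} (hφ : ContDiff ℝ ∞ φ)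
    (hp : Function.Periodic φ (2 * Real.pi)) :
    ∫ x in (0 : ℝ)..(2 * Real.pi), Complex.exp (-(Complex.I * n * x)) * (iteratedDeriv k φ x : ℝ)
      = (Complex.I * n) ^ k *
        ∫ x in (0 : ℝ)..(2 * Real.pi), Complex.exp (-(Complex.I * n * x)) * (φ x : ℝ) := by
  induction k generalizing φ with
  | zero => simp
  | succ k ih =>
    have hd := contDiff_infty_iff_deriv.1 hφ
    have hcont : Continuous fun x : ℝ => Complex.exp (-(Complex.I * n * x)) := by fun_prop
    rw [iteratedDeriv_succ', ih hd.2 (periodic_deriv hp), pow_succ, mul_assoc]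
    congr 1
    have hφc : Continuous fun x => (φ x : ℂ) := Complex.continuous_ofReal.comp hφ.continuous
    have hφc' : Continuous fun x => ((deriv φ x : ℝ) : ℂ) :=
      Complex.continuous_ofReal.comp hd.2.continuous
    have e := intervalIntegral.integral_mul_deriv_eq_deriv_mul (a := 0) (b := 2 * Real.pi)
      (u := fun x : ℝ => Complex.exp (-(Complex.I * n * x)))
      (v := fun x => (φ x : ℂ)) (v' := fun x => ((deriv φ x : ℝ) : ℂ))
      (fun x _ => hasDerivAt_cexp_neg n x) (fun x _ => (hd.1 x).hasDerivAt.ofReal_comp)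
      ((hcont.mul continuous_const).intervalIntegrable _ _) (hφc'.intervalIntegrable _ _)
    rw [e]
    have h0 : φ (2 * Real.pi) = φ 0 := by simpa using hp 0
    rw [cexp_neg_period, h0]
    simp only [Complex.ofReal_zero, mul_zero, neg_zero, Complex.exp_zero, sub_self, zero_sub]
    rw [← intervalIntegral.integral_neg, ← intervalIntegral.integral_const_mul]
    congr 1
    ext x
    ring

/-- The decay is stated for an arbitrary bound M of the k-th derivative, so that it stays linear in
f; continuity of distributions later depends on this. The second-derivative bound serves only for
absolute convergence. -/
lemma exists_cos_series {φ : ℝ → ℝ} (hφ : ContDiff ℝ ∞ φ)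
    (hp : Function.Periodic φ (2 * Real.pi)) (he : ∀ x, φ (-x) = φ x)
    (hb : ∃ M, ∀ x, |iteratedDeriv 2 φ x| ≤ M) :
    ∃ d : ℤ → ℝ, (∀ k M, (∀ x, |iteratedDeriv k φ x| ≤ M) → ∀ n : ℤ, |(n : ℝ)| ^ k * |d n| ≤ M) ∧
      ∀ x, HasSum (fun n : ℤ => d n * Real.cos (n * x)) (φ x) := by
  have : Fact (0 < 2 * Real.pi) := ⟨Real.two_pi_pos⟩
  let ψ : ℝ → ℂ := fun x => φ x
  have hψ : Function.Periodic ψ (2 * Real.pi) := fun x => congrArg Complex.ofReal (hp x)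
  have hψc : Continuous ψ := Complex.continuous_ofReal.comp hφ.continuous
  let f : C(AddCircle (2 * Real.pi), ℂ) := ⟨hψ.lift, by
    exact continuous_coinduced_dom.2 hψc⟩
  have hf (x : ℝ) : f (x : AddCircle (2 * Real.pi)) = φ x := hψ.lift_coe x
  have hpi : (2 * Real.pi : ℂ) ≠ 0 := by
    exact_mod_cast Real.two_pi_pos.ne'
  have hfour (n : ℤ) (x : ℝ) : fourier n (x : AddCircle (2 * Real.pi))
      = Complex.exp (Complex.I * n * x) := by
    rw [fourier_coe_apply]
    congr 1
    push_cast
    field_simp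
  have hcoef (n : ℤ) : fourierCoeff f n = (1 / (2 * Real.pi) : ℝ) •
      ∫ x in (0 : ℝ)..(2 * Real.pi), Complex.exp (-(Complex.I * n * x)) * (φ x : ℝ) := by
    rw [fourierCoeff_eq_intervalIntegral f n 0, zero_add]
    congr 1
    refine intervalIntegral.integral_congr fun x _ => ?_
    simp only [hf, hfour, smul_eq_mul]
    congr 2
    push_cast
    ring
  have hdecay (k : ℕ) (M : ℝ) (hM : ∀ x, |iteratedDeriv k φ x| ≤ M) (n : ℤ) :
      |(n : ℝ)| ^ k * ‖fourierCoeff f n‖ ≤ M := by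
    have h1 := integral_cexp_mul_iteratedDeriv n k hφ hp
    have h2 : ‖∫ x in (0 : ℝ)..(2 * Real.pi),
        Complex.exp (-(Complex.I * n * x)) * (iteratedDeriv k φ x : ℝ)‖ ≤ M * |2 * Real.pi - 0| := by
      refine intervalIntegral.norm_integral_le_of_norm_le_const fun x _ => ?_
      rw [norm_mul, norm_cexp_neg, one_mul, Complex.norm_real]
      exact hM x
    rw [h1, norm_mul, norm_pow, norm_mul, Complex.norm_I, one_mul, Complex.norm_intCast, sub_zero,
      abs_of_pos Real.two_pi_pos] at h2
    rw [hcoef, norm_smul, Real.norm_of_nonneg (by positivity)]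
    have := Real.two_pi_pos
    rw [mul_left_comm, one_div, inv_mul_le_iff₀ this]
    linarith
  obtain ⟨M, hM⟩ := hb
  have hsum : Summable (fourierCoeff f) := by
    refine Summable.of_norm_bounded_eventually (g := fun n : ℤ => M * (1 / (n : ℝ) ^ 2))
      ((Real.summable_one_div_int_pow.2 one_lt_two).mul_left M) ?_
    have : ∀ᶠ n : ℤ in cofinite, n ≠ 0 := by
      simpa using (Set.finite_singleton (0 : ℤ)).eventually_cofinite_notMem
    filter_upwards [this] with n hn
    have h3 := hdecay 2 M hM n
    rw [sq_abs] at h3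
    have hn' : (0 : ℝ) < (n : ℝ) ^ 2 := by positivity
    rw [mul_one_div, le_div_iff₀ hn']
    linarith
  refine ⟨fun n => (fourierCoeff f n).re, fun k M hM n => ?_, fun x => ?_⟩
  · refine le_trans ?_ (hdecay k M hM n)
    exact mul_le_mul_of_nonneg_left (Complex.abs_re_le_norm _) (by positivity)
  -- Averaging the series at x and -x turns the exponentials into cosines.
  · have s1 := has_pointwise_sum_fourier_series_of_summable hsum (x : AddCircle (2 * Real.pi))
    have s2 := has_pointwise_sum_fourier_series_of_summable hsum ((-x : ℝ) : AddCircle (2 * Real.pi))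
    rw [hf] at s1 s2
    rw [he] at s2
    have s3 := Complex.hasSum_re ((s1.add s2).mul_left (1 / 2 : ℂ))
    have e1 : ((1 / 2 : ℂ) * ((φ x : ℂ) + φ x)).re = φ x := by
      have : (1 / 2 : ℂ) * ((φ x : ℂ) + φ x) = (φ x : ℂ) := by ring
      rw [this, Complex.ofReal_re]
    rw [e1] at s3
    refine s3.congr_fun fun n => ?_
    rw [hfour, hfour, smul_eq_mul, smul_eq_mul]
    have e2 : (1 / 2 : ℂ) * (fourierCoeff f n * Complex.exp (Complex.I * n * x)
        + fourierCoeff f n * Complex.exp (Complex.I * n * (-x : ℝ)))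
        = fourierCoeff f n * (Real.cos (n * x) : ℝ) := by
      rw [Complex.ofReal_cos, Complex.cos]
      push_cast
      rw [show Complex.I * n * x = n * x * Complex.I by ring,
        show Complex.I * n * -(x : ℂ) = -(n * x) * Complex.I by ring]
      ring
    rw [e2, Complex.re_mul_ofReal]

/-! ### Bounds on derivatives -/

/-- The derivatives up to order `K` of the radially constant extension of `f` are bounded by `M` on
the sphere. -/
def DerivBound (K : ℕ) (M : ℝ) (f : TestFn) : Prop :=
  ∀ i ≤ K, ∀ s : S2, ‖iteratedFDeriv ℝ i (fun x : R3 => f.1 (radial x)) (s : R3)‖ ≤ M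

lemma DerivBound.mono {K K' : ℕ} {M M' : ℝ} {f : TestFn} (h : DerivBound K M f) (hK : K' ≤ K)
    (hM : M ≤ M') : DerivBound K' M' f := fun i hi s => (h i (hi.trans hK) s).trans hM

lemma TestFn.contDiffOn_ext (f : TestFn) :
    ContDiffOn ℝ ∞ (fun x : R3 => f.1 (radial x)) {0}ᶜ :=
  fun _ hx => (contDiffAt_comp_radial f.1 hx).contDiffWithinAt

lemma TestFn.iteratedFDerivWithin_ext (f : TestFn) (i : ℕ) {x : R3} (hx : x ≠ 0) :
    iteratedFDerivWithin ℝ i (fun x : R3 => f.1 (radial x)) {0}ᶜ x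
      = iteratedFDeriv ℝ i (fun x : R3 => f.1 (radial x)) x :=
  iteratedFDerivWithin_of_isOpen i isOpen_compl_singleton hx

lemma TestFn.exists_derivBound (f : TestFn) (K : ℕ) : ∃ M, 0 ≤ M ∧ DerivBound K M f := by
  have h (i : ℕ) : ∃ M, ∀ s : S2,
      ‖iteratedFDeriv ℝ i (fun x : R3 => f.1 (radial x)) (s : R3)‖ ≤ M := by
    have hc : Continuous fun s : S2 =>
        iteratedFDeriv ℝ i (fun x : R3 => f.1 (radial x)) (s : R3) := by
      have h1 := f.contDiffOn_ext.continuousOn_iteratedFDerivWithin (m := i)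
        (by exact_mod_cast le_top) isOpen_compl_singleton.uniqueDiffOn
      have h2 := h1.comp_continuous continuous_subtype_val (fun s : S2 => S2_ne_zero s)
      refine h2.congr fun s => f.iteratedFDerivWithin_ext i (S2_ne_zero s)
    obtain ⟨M, hM⟩ := isCompact_univ.exists_bound_of_continuousOn hc.continuousOn
    exact ⟨M, fun s => hM s (mem_univ s)⟩
  choose M hM using h
  refine ⟨∑ i ∈ Finset.range (K + 1), |M i|, Finset.sum_nonneg fun i _ => abs_nonneg _,
    fun i hi s => ?_⟩
  exact ((hM i s).trans (le_abs_self _)).trans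
    (Finset.single_le_sum (f := fun i => |M i|) (fun _ _ => abs_nonneg _)
      (Finset.mem_range.2 (Nat.lt_succ_of_le hi)))

lemma norm_iteratedFDeriv_meridian_le (i : ℕ) (θ : ℝ) :
    ‖iteratedFDeriv ℝ i (fun θ : ℝ => ((sph θ 0 : S2) : R3)) θ‖ ≤ 2 := by
  have hsc (i : ℕ) : (∀ θ, |iteratedDeriv i Real.sin θ| ≤ 1) ∧ ∀ θ, |iteratedDeriv i Real.cos θ| ≤ 1 := by
    induction i with
    | zero => simpa using ⟨Real.abs_sin_le_one, Real.abs_cos_le_one⟩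
    | succ i ih =>
      rw [Real.iteratedDeriv_add_one_sin, Real.iteratedDeriv_add_one_cos]
      refine ⟨ih.2, fun θ => ?_⟩
      rw [Pi.neg_apply, abs_neg]
      exact ih.1 θ
  let L (v : R3) : ℝ →L[ℝ] R3 := ContinuousLinearMap.toSpanSingleton ℝ v
  have e : (fun θ : ℝ => ((sph θ 0 : S2) : R3))
      = (L (EuclideanSpace.single 0 1) ∘ Real.sin) + (L (EuclideanSpace.single 2 1) ∘ Real.cos) := by
    funext θ
    ext j
    fin_cases j <;> simp [L, sph]
  have hb (v : R3) (hv : ‖v‖ = 1) (u : ℝ → ℝ) (hu : ContDiff ℝ ∞ u)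
      (h1 : ∀ θ, |iteratedDeriv i u θ| ≤ 1) : ‖iteratedFDeriv ℝ i (L v ∘ u) θ‖ ≤ 1 := by
    refine ((L v).norm_iteratedFDeriv_comp_left (N := ∞) hu.contDiffAt
      (by exact_mod_cast le_top)).trans ?_
    rw [norm_iteratedFDeriv_eq_norm_iteratedDeriv, ContinuousLinearMap.norm_toSpanSingleton, hv,
      one_mul]
    exact h1 θ
  have c1 : ContDiff ℝ ∞ (L (EuclideanSpace.single 0 1) ∘ Real.sin) :=
    (ContinuousLinearMap.contDiff _).comp Real.contDiff_sin
  have c2 : ContDiff ℝ ∞ (L (EuclideanSpace.single 2 1) ∘ Real.cos) :=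
    (ContinuousLinearMap.contDiff _).comp Real.contDiff_cos
  rw [e, iteratedFDeriv_add_apply (c1.of_le (by exact_mod_cast le_top)).contDiffAt
    (c2.of_le (by exact_mod_cast le_top)).contDiffAt]
  refine (norm_add_le _ _).trans ?_
  have := hb (EuclideanSpace.single 0 1) (by simp) Real.sin Real.contDiff_sin (hsc i).1
  have := hb (EuclideanSpace.single 2 1) (by simp) Real.cos Real.contDiff_cos (hsc i).2
  linarith

/-- The chain rule bound k! M D^k for the composition of the radial extension with the meridian,
whose derivatives of order i ≥ 1 are at most 2 ≤ 2^i. -/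
lemma abs_iteratedDeriv_profile_le (k : ℕ) {f : TestFn} {M : ℝ} (h : DerivBound k M f) (θ : ℝ) :
    |iteratedDeriv k f.profile θ| ≤ k.factorial * M * 2 ^ k := by
  have e : f.profile = (fun x : R3 => f.1 (radial x)) ∘ fun θ : ℝ => ((sph θ 0 : S2) : R3) := by
    funext θ
    simp only [Function.comp_apply, radial_coe]
    rfl
  rw [← Real.norm_eq_abs, ← norm_iteratedFDeriv_eq_norm_iteratedDeriv, e]
  refine norm_iteratedFDeriv_comp_le' (N := ∞) (t := {0}ᶜ) ?_ isOpen_compl_singleton.uniqueDiffOn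
    f.contDiffOn_ext contDiff_meridian (by exact_mod_cast le_top) θ ?_ ?_
  · rintro _ ⟨θ, rfl⟩
    exact S2_ne_zero _
  · intro i hi
    rw [f.iteratedFDerivWithin_ext i (S2_ne_zero _)]
    exact h i hi _
  · intro i hi _
    exact (norm_iteratedFDeriv_meridian_le i θ).trans (le_self_pow₀ one_le_two (by omega))

/-! ### Decay of the Fourier coefficients and completeness -/

lemma abs_coord_two_le (s : S2) : |s.1 2| ≤ 1 := by
  rw [← sq_le_one_iff_abs_le_one]
  nlinarith [S2_sq s, sq_nonneg (s.1 0), sq_nonneg (s.1 1)]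

lemma continuous_coord (i : Fin 3) : Continuous fun s : S2 => s.1 i :=
  (EuclideanSpace.proj i : R3 →L[ℝ] ℝ).continuous.comp continuous_subtype_val

lemma integral_area_polynomial (p : Polynomial ℝ) :
    ∫ s, p.eval (s.1 2) ∂area = 2 * Real.pi * polyInt p := by
  rw [integral_area (h := fun s => p.eval (s.1 2)) (p.continuous.comp (continuous_coord 2)), ← integral_cos_mul_sin,
    ← intervalIntegral.integral_const_mul]
  refine intervalIntegral.integral_congr fun θ _ => ?_
  simp only [sph_two, intervalIntegral.integral_const, smul_eq_mul, sub_zero]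
  ring

lemma hasSum_integral_area {ι : Type*} [Countable ι] {u : ι → S2 → ℝ} {F : S2 → ℝ} {b : ι → ℝ}
    (hu : ∀ i, Continuous (u i)) (hb : Summable b) (hle : ∀ i s, |u i s| ≤ b i)
    (hF : ∀ s, HasSum (fun i => u i s) (F s)) :
    HasSum (fun i => ∫ s, u i s ∂area) (∫ s, F s ∂area) :=
  hasSum_integral_of_dominated_convergence (fun i _ => b i)
    (fun i => (integrable_of_continuous_S2 (hu i)).aestronglyMeasurable)
    (fun i => ae_of_all _ (hle i)) (ae_of_all _ fun _ => hb) (integrable_const _)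
    (ae_of_all _ hF)

lemma area_univ : area.real univ = 4 * Real.pi := by
  have h := integral_area_polynomial 1
  have h2 : polyInt 1 = 2 := by simp [polyInt_apply]; norm_num
  simp only [Polynomial.eval_one, h2, integral_const, smul_eq_mul, mul_one] at h
  linarith

lemma abs_chebyshev_le (n : ℤ) {x : ℝ} (hx : |x| ≤ 1) :
    |(Polynomial.Chebyshev.T ℝ n).eval x| ≤ 1 := by
  rw [← Real.cos_arccos (abs_le.1 hx).1 (abs_le.1 hx).2, Polynomial.Chebyshev.T_real_cos]
  exact Real.abs_cos_le_one _

lemma polyInt_chebyshev_mul_legP (n : ℤ) (l : ℕ) (h : n.natAbs < l) :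
    polyInt (legP l * Polynomial.Chebyshev.T ℝ n) = 0 := by
  rw [mul_comm]
  rcases Int.natAbs_eq n with h' | h'
  · rw [h']
    exact chebyshev_mem_orthAbove _ l h
  · rw [h', Polynomial.Chebyshev.T_neg]
    exact chebyshev_mem_orthAbove _ l h

/-- Since cos(nθ) = T_n(cos θ), the cosine series of the profile is a series of polynomials in the
height, which can be paired with Legendre polynomials term by term. -/
lemma exists_chebyshev_series (f : TestFn) :
    ∃ d : ℤ → ℝ, (∀ k M, DerivBound k M f →
        ∀ n : ℤ, |(n : ℝ)| ^ k * |d n| ≤ k.factorial * M * 2 ^ k) ∧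
      (Summable fun n => |d n|) ∧
      ∀ s : S2, HasSum (fun n : ℤ => d n * (Polynomial.Chebyshev.T ℝ n).eval (s.1 2)) (f.1 s) := by
  obtain ⟨M, -, hM⟩ := f.exists_derivBound 2
  obtain ⟨d, hd, hs⟩ := exists_cos_series f.contDiff_profile f.profile_periodic f.profile_neg
    ⟨_, abs_iteratedDeriv_profile_le 2 hM⟩
  refine ⟨d, fun k M h n => hd k _ (abs_iteratedDeriv_profile_le k h) n, ?_, fun s => ?_⟩
  · simpa using (hs 0).summable.abs
  · have h := hs (Real.arccos (s.1 2))
    rw [← f.apply_eq_profile] at h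
    refine h.congr_fun fun n => ?_
    rw [← Polynomial.Chebyshev.T_real_cos,
      Real.cos_arccos (abs_le.1 (abs_coord_two_le s)).1 (abs_le.1 (abs_coord_two_le s)).2]

/-- T_n is orthogonal to P_ℓ when |n| < ℓ, so only the terms with |n| ≥ ℓ contribute, and these are
rapidly small. The constant depends on f only through M: this gives rapid decay and, later,
continuity of functionals. -/
lemma coeff_decay (k : ℕ) : ∃ (K : ℕ) (C : ℝ), 0 ≤ C ∧ ∀ (f : TestFn) (M : ℝ), DerivBound K M f →
    ∀ l : ℕ, ((l : ℝ) + 1) ^ k * |coeff f l| ≤ C * M := by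
  set A : ℝ := (0 : ℕ).factorial + (k + 3).factorial * 2 ^ (k + 3) with hA
  have hA0 : 0 ≤ A := by positivity
  have hSum : Summable fun n : ℤ => 1 / (1 + (n : ℝ) ^ 2) := by
    refine Summable.of_norm_bounded_eventually (g := fun n : ℤ => 1 / (n : ℝ) ^ 2)
      (Real.summable_one_div_int_pow.2 one_lt_two) ?_
    have : ∀ᶠ n : ℤ in cofinite, n ≠ 0 := by
      simpa using (Set.finite_singleton (0 : ℤ)).eventually_cofinite_notMem
    filter_upwards [this] with n hn
    have hn' : (0 : ℝ) < (n : ℝ) ^ 2 := by positivity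
    rw [Real.norm_of_nonneg (by positivity)]
    exact one_div_le_one_div_of_le hn' (by linarith)
  set S : ℝ := ∑' n : ℤ, 1 / (1 + (n : ℝ) ^ 2)
  have hS : 0 ≤ S := tsum_nonneg fun n => by positivity
  -- Of the k + 3 derivatives, k give the required power of ℓ, one pays for |Y_ℓ| ≤ ℓ + 1, and two
  -- for summability over n. The factor 4π is the area of the sphere.
  refine ⟨k + 3, 4 * Real.pi * (2 ^ (k + 2) * A * S), by positivity, fun f M hM l => ?_⟩
  have hM0 : 0 ≤ M := (norm_nonneg _).trans (hM 0 (Nat.zero_le _) (sph 0 0))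
  obtain ⟨d, hd, hds, hs⟩ := exists_chebyshev_series f
  -- The constant A has one summand for n = 0, where derivatives give nothing, and one for n ≠ 0.
  have hdn (n : ℤ) : (1 + |(n : ℝ)|) ^ (k + 1) * |d n| ≤ 2 ^ (k + 2) * A * M * (1 / (1 + (n : ℝ) ^ 2)) := by
    rcases eq_or_ne n 0 with rfl | hn
    · have h0 := hd 0 M (hM.mono (Nat.zero_le _) le_rfl) 0
      simp only [pow_zero, one_mul, mul_one] at h0
      simp only [Int.cast_zero, abs_zero, add_zero, one_pow, one_mul, ne_eq, OfNat.ofNat_ne_zero,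
        not_false_eq_true, zero_pow, div_one, mul_one]
      refine h0.trans ?_
      have h1 : ((0 : ℕ).factorial : ℝ) * M ≤ A * M := by
        refine mul_le_mul_of_nonneg_right ?_ hM0
        rw [hA]
        linarith [(by positivity : (0 : ℝ) ≤ (k + 3).factorial * 2 ^ (k + 3))]
      refine h1.trans ?_
      rw [mul_assoc]
      exact le_mul_of_one_le_left (by positivity) (one_le_pow₀ one_le_two)
    · have h3 := hd (k + 3) M hM n
      have hn1 : (1 : ℝ) ≤ |(n : ℝ)| := by
        rw [← Int.cast_abs]
        exact_mod_cast Int.one_le_abs hn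
      have hAM : ((k + 3).factorial : ℝ) * M * 2 ^ (k + 3) ≤ A * M := by
        have : (0 : ℝ) ≤ (0 : ℕ).factorial * M := by positivity
        rw [hA]
        linarith
      have hpos : (0 : ℝ) < 1 + (n : ℝ) ^ 2 := by positivity
      rw [mul_one_div, le_div_iff₀ hpos, ← sq_abs (n : ℝ)]
      set a := |(n : ℝ)|
      calc (1 + a) ^ (k + 1) * |d n| * (1 + a ^ 2)
          ≤ (2 * a) ^ (k + 1) * |d n| * (2 * a ^ 2) := by
            gcongr
            · linarith
            · nlinarith
        _ = 2 ^ (k + 2) * (a ^ (k + 3) * |d n|) := by rw [mul_pow]; ring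
        _ ≤ 2 ^ (k + 2) * (A * M) := by
            exact mul_le_mul_of_nonneg_left (h3.trans hAM) (by positivity)
        _ = _ := by ring
  have hI := hasSum_integral_area
    (u := fun (n : ℤ) s => (Y l).1 s * (d n * (Polynomial.Chebyshev.T ℝ n).eval (s.1 2)))
    (F := fun s => (Y l).1 s * f.1 s) (b := fun n => ((l : ℝ) + 1) * |d n|)
    (fun n => (Y l).continuous.mul (continuous_const.mul
      ((Polynomial.continuous _).comp (continuous_coord 2))))
    (hds.mul_left _)
    (fun n s => by
      rw [abs_mul, abs_mul]
      exact mul_le_mul (abs_Y_le l s) (mul_le_of_le_one_right (abs_nonneg _)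
        (abs_chebyshev_le n (abs_coord_two_le s))) (by positivity) (by positivity))
    (fun s => (hs s).mul_left _)
  have hterm (n : ℤ) :
      ‖∫ s, (Y l).1 s * (d n * (Polynomial.Chebyshev.T ℝ n).eval (s.1 2)) ∂area‖ * ((l : ℝ) + 1) ^ k
        ≤ 4 * Real.pi * (2 ^ (k + 2) * A * M) * (1 / (1 + (n : ℝ) ^ 2)) := by
    rcases lt_or_ge n.natAbs l with hn | hn
    · have : ∫ s, (Y l).1 s * (d n * (Polynomial.Chebyshev.T ℝ n).eval (s.1 2)) ∂area = 0 := by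
        have e (s : S2) : (Y l).1 s * (d n * (Polynomial.Chebyshev.T ℝ n).eval (s.1 2))
            = normY l * d n * (legP l * Polynomial.Chebyshev.T ℝ n).eval (s.1 2) := by
          rw [Y_apply, Polynomial.eval_mul]; ring
        simp only [e]
        rw [integral_const_mul, integral_area_polynomial, polyInt_chebyshev_mul_legP n l hn]
        ring
      rw [this, norm_zero, zero_mul]
      positivity
    · have hln : (l : ℝ) ≤ |(n : ℝ)| := by
        rw [← Int.cast_abs, ← Int.natCast_natAbs]
        exact_mod_cast hn
      have h1 : ‖∫ s, (Y l).1 s * (d n * (Polynomial.Chebyshev.T ℝ n).eval (s.1 2)) ∂area‖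
          ≤ ((l : ℝ) + 1) * |d n| * (4 * Real.pi) := by
        rw [← area_univ]
        refine norm_integral_le_of_norm_le_const (ae_of_all _ fun s => ?_)
        rw [Real.norm_eq_abs, abs_mul, abs_mul]
        exact mul_le_mul (abs_Y_le l s) (mul_le_of_le_one_right (abs_nonneg _)
          (abs_chebyshev_le n (abs_coord_two_le s))) (by positivity) (by positivity)
      calc _ ≤ ((l : ℝ) + 1) * |d n| * (4 * Real.pi) * ((l : ℝ) + 1) ^ k := by gcongr
        _ = 4 * Real.pi * (((l : ℝ) + 1) ^ (k + 1) * |d n|) := by ring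
        _ ≤ 4 * Real.pi * ((1 + |(n : ℝ)|) ^ (k + 1) * |d n|) := by
            have : ((l : ℝ) + 1) ^ (k + 1) ≤ (1 + |(n : ℝ)|) ^ (k + 1) :=
              pow_le_pow_left₀ (by positivity) (by linarith) _
            gcongr
        _ ≤ 4 * Real.pi * (2 ^ (k + 2) * A * M * (1 / (1 + (n : ℝ) ^ 2))) := by
            have := hdn n
            gcongr
        _ = _ := by ring
  have hc : coeff f l = ∫ s, (Y l).1 s * f.1 s ∂area := rfl
  have h2 := (hI.mul_right (((l : ℝ) + 1) ^ k))
  have h3 := h2.norm_le_of_bounded (hSum.hasSum.mul_left (4 * Real.pi * (2 ^ (k + 2) * A * M)))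
    (fun n => by
      rw [norm_mul, Real.norm_of_nonneg (by positivity : (0 : ℝ) ≤ ((l : ℝ) + 1) ^ k)]
      exact hterm n)
  rw [← hc, norm_mul, Real.norm_of_nonneg (by positivity : (0 : ℝ) ≤ ((l : ℝ) + 1) ^ k),
    Real.norm_eq_abs, mul_comm] at h3
  refine h3.trans (le_of_eq ?_)
  ring

/-- A sequence that decays faster than any power. -/
def RapidDecay (a : ℕ → ℝ) : Prop := ∀ k : ℕ, ∃ C : ℝ, ∀ l : ℕ, ((l : ℝ) + 1) ^ k * |a l| ≤ C

lemma rapidDecay_coeff (f : TestFn) : RapidDecay (coeff f) := fun k => by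
  obtain ⟨K, C, -, h⟩ := coeff_decay k
  obtain ⟨M, -, hM⟩ := f.exists_derivBound K
  exact ⟨_, h f M hM⟩

lemma RapidDecay.summable {a : ℕ → ℝ} (ha : RapidDecay a) (k : ℕ) :
    Summable fun l : ℕ => ((l : ℝ) + 1) ^ k * |a l| := by
  obtain ⟨C, hC⟩ := ha (k + 2)
  have hs : Summable fun l : ℕ => C * (1 / ((l : ℝ) + 1) ^ 2) := by
    refine Summable.mul_left _ ?_
    exact_mod_cast (summable_nat_add_iff 1).2 (Real.summable_one_div_nat_pow.2 one_lt_two)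
  refine Summable.of_nonneg_of_le (fun l => by positivity) (fun l => ?_) hs
  rw [mul_one_div, le_div_iff₀ (by positivity)]
  calc _ = ((l : ℝ) + 1) ^ (k + 2) * |a l| := by ring
    _ ≤ C := hC l

/-- Such an f is orthogonal to every polynomial in the height, hence to each term of its own
Chebyshev series, so ∫ f² = 0. -/
lemma eq_zero_of_coeff_eq_zero {f : TestFn} (hf : ∀ l, coeff f l = 0) : f = 0 := by
  have hcont (p : Polynomial ℝ) : Continuous fun s : S2 => f.1 s * p.eval (s.1 2) :=
    f.continuous.mul (p.continuous.comp (continuous_coord 2))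
  let L : Polynomial ℝ →ₗ[ℝ] ℝ :=
    { toFun := fun p => ∫ s, f.1 s * p.eval (s.1 2) ∂area
      map_add' := fun p q => by
        simp only [Polynomial.eval_add, mul_add]
        exact integral_add (integrable_of_continuous_S2 (hcont p))
          (integrable_of_continuous_S2 (hcont q))
      map_smul' := fun c p => by
        simp only [Polynomial.eval_smul, smul_eq_mul, RingHom.id_apply, mul_left_comm]
        exact integral_const_mul _ _ }
  have hL : L = 0 := by
    refine LinearMap.ext_on_range span_range_legP fun l => ?_
    have h := hf l
    have e : coeff f l = normY l * L (legP l) := by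
      change ∫ s, (Y l).1 s * f.1 s ∂area = normY l * ∫ s, f.1 s * (legP l).eval (s.1 2) ∂area
      rw [← integral_const_mul]
      congr 1; ext s
      rw [Y_apply]; ring
    rw [e] at h
    exact (mul_eq_zero.1 h).resolve_left (normY_pos l).ne'
  obtain ⟨d, -, hds, hs⟩ := exists_chebyshev_series f
  obtain ⟨B, hB⟩ := isCompact_univ.exists_bound_of_continuousOn f.continuous.continuousOn
  have hI := hasSum_integral_area
    (u := fun (n : ℤ) s => f.1 s * (d n * (Polynomial.Chebyshev.T ℝ n).eval (s.1 2)))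
    (F := fun s => f.1 s * f.1 s) (b := fun n => B * |d n|)
    (fun n => f.continuous.mul (continuous_const.mul
      ((Polynomial.continuous _).comp (continuous_coord 2))))
    (hds.mul_left _)
    (fun n s => by
      rw [abs_mul, abs_mul]
      exact mul_le_mul (hB s (mem_univ s)) (mul_le_of_le_one_right (abs_nonneg _)
        (abs_chebyshev_le n (abs_coord_two_le s))) (by positivity)
        ((norm_nonneg _).trans (hB s (mem_univ s))))
    (fun s => (hs s).mul_left _)
  have hz (n : ℤ) : ∫ s, f.1 s * (d n * (Polynomial.Chebyshev.T ℝ n).eval (s.1 2)) ∂area = 0 := by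
    have e : L (Polynomial.Chebyshev.T ℝ n) = 0 := by rw [hL]; rfl
    have e2 : ∫ s, f.1 s * (d n * (Polynomial.Chebyshev.T ℝ n).eval (s.1 2)) ∂area
        = d n * L (Polynomial.Chebyshev.T ℝ n) := by
      simp only [mul_left_comm (f.1 _)]
      exact integral_const_mul _ _
    rw [e2, e, mul_zero]
  simp only [hz] at hI
  have h0 : pairing f f = 0 := hI.unique hasSum_zero
  rw [pairing_eq] at h0
  have hpos : (0 : ℝ) < 2 * Real.pi := Real.two_pi_pos
  have h1 := (mul_eq_zero.1 h0).resolve_left hpos.ne'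
  have hin : ∀ θ ∈ Ioo 0 Real.pi, f.profile θ = 0 := by
    intro θ hθ
    by_contra hne
    have : 0 < ∫ θ in (0 : ℝ)..Real.pi, f.profile θ * f.profile θ * Real.sin θ := by
      refine intervalIntegral.integral_pos Real.pi_pos
        ((f.continuous_profile.mul f.continuous_profile).mul Real.continuous_sin).continuousOn
        (fun x hx => mul_nonneg (mul_self_nonneg _) (Real.sin_nonneg_of_nonneg_of_le_pi hx.1.le hx.2))
        ⟨θ, Ioo_subset_Icc_self hθ, mul_pos (mul_self_pos.2 hne)
          (Real.sin_pos_of_pos_of_lt_pi hθ.1 hθ.2)⟩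
    linarith
  -- The density sin θ vanishes at the poles, which are therefore reached by continuity.
  have hcl : ∀ θ ∈ Icc 0 Real.pi, f.profile θ = 0 := by
    have hc : IsClosed {θ | f.profile θ = 0} := isClosed_eq f.continuous_profile continuous_const
    rw [← closure_Ioo Real.pi_pos.ne]
    exact fun θ hθ => hc.closure_subset_iff.2 hin hθ
  refine Subtype.ext (ContMDiffMap.ext fun s => ?_)
  exact (f.apply_eq_profile s).trans (hcl _ ⟨Real.arccos_nonneg _, Real.arccos_le_pi _⟩)

lemma coeff_injective {f g : TestFn} (h : ∀ l, coeff f l = coeff g l) : f = g :=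
  sub_eq_zero.1 (eq_zero_of_coeff_eq_zero fun l => by rw [coeff_sub, h, sub_self])

/-! ### Sums of zonal harmonics with rapidly decreasing coefficients -/

/-- A smooth compactly supported extension of the height function of the sphere that is constant
along rays near the sphere. -/
def heightExt (x : R3) : ℝ :=
  Real.smoothTransition (4 * ‖x‖ ^ 2 - 1) * Real.smoothTransition (4 - ‖x‖ ^ 2) * (‖x‖⁻¹ * x 2)

lemma contDiff_heightExt : ContDiff ℝ ∞ heightExt := by
  rw [contDiff_iff_contDiffAt]
  intro x
  rcases eq_or_ne x 0 with rfl | hx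
  · have h : heightExt =ᶠ[𝓝 (0 : R3)] fun _ => 0 := by
      filter_upwards [Metric.ball_mem_nhds (0 : R3) (by norm_num : (0 : ℝ) < 1 / 2)] with y hy
      rw [mem_ball_zero_iff] at hy
      rw [heightExt, Real.smoothTransition.zero_of_nonpos (by nlinarith [norm_nonneg y]), zero_mul,
        zero_mul]
    exact contDiffAt_const.congr_of_eventuallyEq h
  · have h2 : ContDiff ℝ ∞ (fun x : R3 => x 2) :=
      (EuclideanSpace.proj (2 : Fin 3) : R3 →L[ℝ] ℝ).contDiff
    have hn : ContDiff ℝ ∞ fun x : R3 => ‖x‖ ^ 2 := contDiff_norm_sq ℝ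
    have a1 : ContDiff ℝ ∞ fun x : R3 => Real.smoothTransition (4 * ‖x‖ ^ 2 - 1) :=
      Real.smoothTransition.contDiff.comp ((contDiff_const.mul hn).sub contDiff_const)
    have a2 : ContDiff ℝ ∞ fun x : R3 => Real.smoothTransition (4 - ‖x‖ ^ 2) :=
      Real.smoothTransition.contDiff.comp (contDiff_const.sub hn)
    exact (a1.mul a2).contDiffAt.mul
      (((contDiffAt_norm ℝ hx).inv (norm_ne_zero_iff.2 hx)).mul h2.contDiffAt)

lemma hasCompactSupport_heightExt : HasCompactSupport heightExt := by
  refine HasCompactSupport.intro (isCompact_closedBall (0 : R3) 2) fun x hx => ?_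
  rw [mem_closedBall_zero_iff, not_le] at hx
  rw [heightExt, Real.smoothTransition.zero_of_nonpos (by nlinarith : 4 - ‖x‖ ^ 2 ≤ 0), mul_zero,
    zero_mul]

/-- Keeping the values in [-1, 1] makes the Legendre derivative bounds available at every point of
space, as the termwise differentiation of a global series requires. -/
lemma abs_heightExt_le (x : R3) : |heightExt x| ≤ 1 := by
  have h1 (y : ℝ) : |Real.smoothTransition y| ≤ 1 := by
    rw [abs_of_nonneg (Real.smoothTransition.nonneg y)]
    exact Real.smoothTransition.le_one y
  have h2 : |‖x‖⁻¹ * x 2| ≤ 1 := by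
    rw [abs_mul, abs_of_nonneg (inv_nonneg.2 (norm_nonneg x))]
    have : |x 2| ≤ ‖x‖ := by simpa using PiLp.norm_apply_le x 2
    rcases eq_or_ne x 0 with rfl | hx
    · simp
    · rwa [inv_mul_le_iff₀ (norm_pos_iff.2 hx), mul_one]
  rw [heightExt, abs_mul, abs_mul]
  exact mul_le_one₀ (mul_le_one₀ (h1 _) (abs_nonneg _) (h1 _)) (abs_nonneg _) h2

/-- Both cutoffs equal 1 for 1/2 ≤ ‖x‖² ≤ 3. Agreement on a neighbourhood, and not only on the
sphere, is what makes all derivatives agree. -/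
lemma heightExt_eventuallyEq (s : S2) :
    ∀ᶠ x in 𝓝 (s : R3), heightExt x = (radial x).1 2 := by
  have hc : ContinuousAt (fun x : R3 => ‖x‖ ^ 2) (s : R3) := (continuous_norm.pow 2).continuousAt
  have h1 : ‖(s : R3)‖ ^ 2 = 1 := by rw [norm_S2, one_pow]
  have ha : ∀ᶠ x in 𝓝 (s : R3), ‖x‖ ^ 2 ∈ Ioo (1 / 2 : ℝ) 2 :=
    hc (Ioo_mem_nhds (by simp only [h1]; norm_num) (by simp only [h1]; norm_num))
  filter_upwards [ha] with x hx
  have hx0 : x ≠ 0 := by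
    rintro rfl
    norm_num at hx
  rw [heightExt, Real.smoothTransition.one_of_one_le (by linarith [hx.1]),
    Real.smoothTransition.one_of_one_le (by linarith [hx.2]), radial_of_ne hx0]
  simp

lemma heightExt_coe (s : S2) : heightExt (s : R3) = s.1 2 := by
  rw [(heightExt_eventuallyEq s).self_of_nhds, radial_coe]

lemma iteratedDeriv_polynomial (p : Polynomial ℝ) (i : ℕ) :
    iteratedDeriv i (fun x => p.eval x) = fun x => (Polynomial.derivative^[i] p).eval x := by
  induction i with
  | zero => simp
  | succ i ih =>
    rw [iteratedDeriv_succ, ih]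
    funext x
    rw [Polynomial.deriv, Function.iterate_succ_apply']

/-- A smooth extension of `Y_{ℓ 0}` to Euclidean space. -/
def zonalExt (l : ℕ) (x : R3) : ℝ := normY l * (legP l).eval (heightExt x)

lemma contDiff_zonalExt (l : ℕ) : ContDiff ℝ ∞ (zonalExt l) :=
  contDiff_const.mul ((Polynomial.contDiff_aeval (legP l) ∞).comp contDiff_heightExt)

/-- Two powers of the degree per derivative come from the Legendre polynomial, and one more from the
normalization; the dependence on x is absorbed by the compact support of `heightExt`. -/
lemma exists_norm_iteratedFDeriv_zonalExt_le (n : ℕ) : ∃ B : ℝ, 0 ≤ B ∧ ∀ (l : ℕ) (x : R3),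
    ‖iteratedFDeriv ℝ n (zonalExt l) x‖ ≤ B * ((l : ℝ) + 1) ^ (2 * n + 1) := by
  have hw (i : ℕ) : ∃ D : ℝ, ∀ x, ‖iteratedFDeriv ℝ i heightExt x‖ ≤ D :=
    ((contDiff_heightExt.continuous_iteratedFDeriv
      (by exact_mod_cast le_top)).bounded_above_of_compact_support
      (hasCompactSupport_heightExt.iteratedFDeriv i))
  choose D hD using hw
  set E : ℝ := 1 + ∑ i ∈ Finset.range (n + 1), |D i|
  have hE1 : 1 ≤ E := le_add_of_nonneg_right (Finset.sum_nonneg fun i _ => abs_nonneg _)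
  have hDE (i : ℕ) (hi : i ≤ n) : D i ≤ E :=
    (le_abs_self _).trans ((Finset.single_le_sum (f := fun i => |D i|)
      (fun _ _ => abs_nonneg _) (Finset.mem_range.2 (Nat.lt_succ_of_le hi))).trans
      (le_add_of_nonneg_left zero_le_one))
  refine ⟨n.factorial * E ^ n, by positivity, fun l x => ?_⟩
  have h1 : ‖iteratedFDeriv ℝ n ((fun y : ℝ => normY l * (legP l).eval y) ∘ heightExt) x‖
      ≤ n.factorial * (((l : ℝ) + 1) ^ (2 * n + 1)) * E ^ n := by
    refine norm_iteratedFDeriv_comp_le (N := ∞)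
      (contDiff_const.mul (Polynomial.contDiff_aeval (legP l) ∞)) contDiff_heightExt
      (by exact_mod_cast le_top) x ?_ ?_
    · intro i hi
      have e : (fun y : ℝ => normY l * (legP l).eval y)
          = fun y => (Polynomial.C (normY l) * legP l).eval y := by
        funext y; simp
      rw [norm_iteratedFDeriv_eq_norm_iteratedDeriv, e, iteratedDeriv_polynomial,
        Polynomial.iterate_derivative_C_mul]
      simp only
      rw [Polynomial.eval_mul, Polynomial.eval_C, norm_mul,
        Real.norm_of_nonneg (normY_nonneg l), pow_succ']
      have h2 : ((l : ℝ) + 1) ^ (2 * i) ≤ ((l : ℝ) + 1) ^ (2 * n) :=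
        pow_le_pow_right₀ (by linarith [(l.cast_nonneg : (0 : ℝ) ≤ l)]) (by omega)
      exact mul_le_mul (normY_le l)
        ((abs_iterate_derivative_legP_le i l (abs_heightExt_le x)).trans h2) (norm_nonneg _)
        (by positivity)
    · intro i hi hin
      exact ((hD i x).trans (hDE i hin)).trans (le_self_pow₀ hE1 (by omega))
  refine h1.trans (le_of_eq (by ring))

/-- Polynomially bounded sequences. -/
def PolyBounded (m : ℕ → ℝ) : Prop :=
  ∃ (A : ℝ) (k : ℕ), ∀ l : ℕ, |m l| ≤ A * ((l : ℝ) + 1) ^ k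

lemma RapidDecay.mul {a m : ℕ → ℝ} (ha : RapidDecay a)
    (hm : PolyBounded m) :
    RapidDecay fun l => m l * a l := fun k => by
  obtain ⟨A, j, hA⟩ := hm
  obtain ⟨C, hC⟩ := ha (k + j)
  have hA0 : 0 ≤ A := by simpa using (abs_nonneg _).trans (hA 0)
  refine ⟨A * C, fun l => ?_⟩
  rw [abs_mul]
  calc ((l : ℝ) + 1) ^ k * (|m l| * |a l|)
      ≤ ((l : ℝ) + 1) ^ k * (A * ((l : ℝ) + 1) ^ j * |a l|) := by
        gcongr
        exact hA l
    _ = A * (((l : ℝ) + 1) ^ (k + j) * |a l|) := by ring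
    _ ≤ A * C := mul_le_mul_of_nonneg_left (hC l) hA0

lemma exists_summable_bound {a : ℕ → ℝ} (ha : RapidDecay a) : ∃ v : ℕ → ℕ → ℝ, (∀ k, Summable (v k)) ∧
    ∀ (k l : ℕ) (x : R3), ‖iteratedFDeriv ℝ k (fun x => a l * zonalExt l x) x‖ ≤ v k l := by
  choose B hB0 hB using exists_norm_iteratedFDeriv_zonalExt_le
  refine ⟨fun k l => B k * (((l : ℝ) + 1) ^ (2 * k + 1) * |a l|),
    fun k => (ha.summable (2 * k + 1)).mul_left _, fun k l x => ?_⟩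
  have e : (fun x => a l * zonalExt l x) = a l • zonalExt l := rfl
  rw [e, iteratedFDeriv_const_smul_apply ((contDiff_zonalExt l).of_le
    (by exact_mod_cast le_top)).contDiffAt, norm_smul, Real.norm_eq_abs]
  calc _ ≤ |a l| * (B k * ((l : ℝ) + 1) ^ (2 * k + 1)) :=
        mul_le_mul_of_nonneg_left (hB k l x) (abs_nonneg _)
    _ = _ := by ring

lemma contDiff_tsum_zonalExt {a : ℕ → ℝ} (ha : RapidDecay a) :
    ContDiff ℝ ∞ fun x => ∑' l, a l * zonalExt l x := by
  obtain ⟨v, hv, hle⟩ := exists_summable_bound ha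
  exact contDiff_tsum (N := ⊤) (fun l => contDiff_const.mul (contDiff_zonalExt l))
    (fun k _ => hv k) (fun k l x _ => hle k l x)

lemma zonalExt_coe (l : ℕ) (s : S2) : zonalExt l (s : R3) = (Y l).1 s := by
  rw [zonalExt, heightExt_coe, Y_apply]

/-- The axisymmetric function with the given rapidly decreasing coefficients. -/
def synth (a : ℕ → ℝ) (ha : RapidDecay a) : TestFn :=
  ⟨⟨fun s => ∑' l, a l * (Y l).1 s, by
    have := Fact.mk (@finrank_euclideanSpace_fin ℝ _ (2 + 1))
    have h := (contDiff_tsum_zonalExt ha).contMDiff.comp (contMDiff_coe_sphere (n := 2) (E := R3))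
    refine h.congr fun s => ?_
    simp only [Function.comp_apply, zonalExt_coe]⟩, fun s => by
    have h (b : ℝ) : ∑' l, a l * (Y l).1 (rot b s) = ∑' l, a l * (Y l).1 s := by
      simp only [TestFn.apply_rot]
    have : HasDerivAt (fun b : ℝ => ∑' l, a l * (Y l).1 (rot b s)) 0 0 := by
      simp only [h]
      exact hasDerivAt_const _ _
    exact this⟩

lemma RapidDecay.summable_mul_Y {a : ℕ → ℝ} (ha : RapidDecay a) (s : S2) :
    Summable fun l => a l * (Y l).1 s := by
  refine Summable.of_norm_bounded (ha.summable 1) fun l => ?_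
  rw [norm_mul, mul_comm, pow_one]
  exact mul_le_mul_of_nonneg_right (abs_Y_le l s) (abs_nonneg _)

lemma hasSum_synth {a : ℕ → ℝ} (ha : RapidDecay a) (s : S2) :
    HasSum (fun l => a l * (Y l).1 s) ((synth a ha).1 s) := (ha.summable_mul_Y s).hasSum

lemma hasSum_pairing {a : ℕ → ℝ} (ha : RapidDecay a) {f : TestFn}
    (hf : ∀ s, HasSum (fun l => a l * (Y l).1 s) (f.1 s)) (g : TestFn) :
    HasSum (fun l => a l * coeff g l) (pairing f g) := by
  obtain ⟨B, hB⟩ := isCompact_univ.exists_bound_of_continuousOn g.continuous.continuousOn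
  have h := hasSum_integral_area (u := fun l s => a l * ((Y l).1 s * g.1 s))
    (F := fun s => f.1 s * g.1 s) (b := fun l : ℕ => ((l : ℝ) + 1) ^ 1 * |a l| * B)
    (fun l => continuous_const.mul ((Y l).continuous.mul g.continuous))
    ((ha.summable 1).mul_right B)
    (fun l s => by
      rw [abs_mul, abs_mul, pow_one, mul_comm ((l : ℝ) + 1), mul_assoc]
      have := hB s (mem_univ s)
      have := abs_Y_le l s
      gcongr
      exact hB s (mem_univ s))
    (fun s => by simpa only [mul_assoc] using (hf s).mul_right (g.1 s))
  refine h.congr_fun fun l => ?_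
  exact (integral_const_mul _ _).symm

lemma coeff_synth {a : ℕ → ℝ} (ha : RapidDecay a) (l : ℕ) : coeff (synth a ha) l = a l := by
  have h := hasSum_pairing ha (hasSum_synth ha) (Y l)
  rw [pairing_comm] at h
  refine h.unique ?_
  have h2 := hasSum_ite_eq l (a l)
  refine h2.congr_fun fun m => ?_
  rw [coeff_Y]
  split_ifs with e
  · rw [e, mul_one]
  · rw [mul_zero]

/-- Completeness gives the expansion theorem without a separate convergence argument: the
synthesized function has the same coefficients as f. -/
lemma synth_coeff (f : TestFn) : synth (coeff f) (rapidDecay_coeff f) = f :=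
  coeff_injective fun l => coeff_synth _ l

lemma hasSum_coeff_mul_Y (f : TestFn) (s : S2) : HasSum (fun l => coeff f l * (Y l).1 s) (f.1 s) := by
  have h := hasSum_synth (rapidDecay_coeff f) s
  rwa [synth_coeff] at h

lemma hasSum_coeff_mul_coeff (f g : TestFn) :
    HasSum (fun l => coeff f l * coeff g l) (pairing f g) :=
  hasSum_pairing (rapidDecay_coeff f) (hasSum_coeff_mul_Y f) g

/-- Multiplication of the coefficients by a polynomially bounded sequence. -/
def multiplier (m : ℕ → ℝ) (hm : PolyBounded m) :
    TestFn →ₗ[ℝ] TestFn where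
  toFun f := synth _ ((rapidDecay_coeff f).mul hm)
  map_add' f g := coeff_injective fun l => by
    rw [coeff_synth, coeff_add, coeff_add, coeff_synth, coeff_synth, mul_add]
  map_smul' c f := coeff_injective fun l => by
    rw [coeff_synth, RingHom.id_apply, coeff_smul, coeff_smul, coeff_synth, mul_left_comm]

lemma coeff_multiplier (m : ℕ → ℝ)
    (hm : PolyBounded m) (f : TestFn) (l : ℕ) :
    coeff (multiplier m hm f) l = m l * coeff f l :=
  coeff_synth ((rapidDecay_coeff f).mul hm) l

/-! ### The topology of the test space -/

lemma tendsto_testFn {ι : Type*} {p : Filter ι} {u : ι → TestFn} {f : TestFn} :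
    Tendsto u p (𝓝 f) ↔ ∀ n : ℕ, TendstoUniformly
      (fun i (s : S2) => iteratedFDeriv ℝ n (fun x : R3 => (u i).1 (radial x)) (s : R3))
      (fun s : S2 => iteratedFDeriv ℝ n (fun x : R3 => f.1 (radial x)) (s : R3)) p := by
  rw [tendsto_subtype_rng, nhds_iInf, tendsto_iInf]
  refine forall_congr' fun n => ?_
  rw [nhds_induced, tendsto_comap_iff, UniformFun.tendsto_iff_tendstoUniformly]
  rfl

lemma TestFn.contDiffAt_ext (f : TestFn) (s : S2) :
    ContDiffAt ℝ ∞ (fun x : R3 => f.1 (radial x)) (s : R3) :=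
  contDiffAt_comp_radial f.1 (S2_ne_zero s)

lemma eventually_derivBound (f : TestFn) (K : ℕ) {δ : ℝ} (hδ : 0 < δ) :
    ∀ᶠ g in 𝓝 f, DerivBound K δ (g - f) := by
  have h (i : ℕ) : ∀ᶠ g : TestFn in 𝓝 f, ∀ s : S2,
      ‖iteratedFDeriv ℝ i (fun x : R3 => (g - f).1 (radial x)) (s : R3)‖ ≤ δ := by
    have h1 := Metric.tendstoUniformly_iff.1 ((tendsto_testFn (u := id)).1 (tendsto_id (x := 𝓝 f)) i)
      δ hδ
    filter_upwards [h1] with g hg s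
    have e : (fun x : R3 => (g - f).1 (radial x))
        = (fun x : R3 => g.1 (radial x)) - fun x : R3 => f.1 (radial x) := rfl
    rw [e, iteratedFDeriv_sub_apply ((g.contDiffAt_ext s).of_le (by exact_mod_cast le_top))
      ((f.contDiffAt_ext s).of_le (by exact_mod_cast le_top)), ← dist_eq_norm, dist_comm]
    exact (hg s).le
  have h2 : ∀ᶠ g : TestFn in 𝓝 f, ∀ i ∈ Finset.range (K + 1), ∀ s : S2,
      ‖iteratedFDeriv ℝ i (fun x : R3 => (g - f).1 (radial x)) (s : R3)‖ ≤ δ :=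
    (Finset.eventually_all _).2 fun i _ => h i
  filter_upwards [h2] with g hg i hi
  exact hg i (Finset.mem_range.2 (Nat.lt_succ_of_le hi))

/-- By linearity it suffices to control T(g - f), and g near f means that finitely many derivatives
of g - f are small. -/
lemma continuous_of_derivBound (T : TestFn →ₗ[ℝ] ℝ) {K : ℕ} {C : ℝ} (hC : 0 ≤ C)
    (h : ∀ f M, DerivBound K M f → |T f| ≤ C * M) : Continuous T := by
  rw [continuous_iff_continuousAt]
  intro f
  rw [ContinuousAt, Metric.tendsto_nhds]
  intro ε hε
  filter_upwards [eventually_derivBound f K (show 0 < ε / (C + 1) by positivity)] with g hg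
  rw [Real.dist_eq, ← map_sub]
  refine (h _ _ hg).trans_lt ?_
  rw [mul_div_assoc', div_lt_iff₀ (by positivity)]
  nlinarith

/-- A polynomially bounded sequence defines a distribution. -/
lemma exists_distr {g : ℕ → ℝ} (hg : PolyBounded g) :
    ∃ T : Distr, ∀ f : TestFn, HasSum (fun l => g l * coeff f l) (T f) := by
  have hs (f : TestFn) : Summable fun l => g l * coeff f l := by
    refine Summable.of_norm ?_
    have := ((rapidDecay_coeff f).mul hg).summable 0
    simpa only [pow_zero, one_mul, Real.norm_eq_abs] using this
  let T : TestFn →ₗ[ℝ] ℝ :=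
    { toFun := fun f => ∑' l, g l * coeff f l
      map_add' := fun f f' => by
        simp only [coeff_add, mul_add]
        exact (hs f).tsum_add (hs f')
      map_smul' := fun c f => by
        simp only [coeff_smul, mul_left_comm (g _), RingHom.id_apply, smul_eq_mul]
        exact tsum_mul_left }
  obtain ⟨A, k, hA⟩ := hg
  obtain ⟨K, C, hC, hK⟩ := coeff_decay (k + 2)
  have hA0 : 0 ≤ A := by simpa using (abs_nonneg _).trans (hA 0)
  have hs2 : Summable fun l : ℕ => 1 / ((l : ℝ) + 1) ^ 2 := by
    exact_mod_cast (summable_nat_add_iff 1).2 (Real.summable_one_div_nat_pow.2 one_lt_two)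
  have hT : Continuous T := by
    refine continuous_of_derivBound T (K := K) (C := A * C * ∑' l : ℕ, 1 / ((l : ℝ) + 1) ^ 2)
      (mul_nonneg (mul_nonneg hA0 hC) (tsum_nonneg fun l => by positivity)) fun f M hM => ?_
    have hterm (l : ℕ) : ‖g l * coeff f l‖ ≤ A * C * M * (1 / ((l : ℝ) + 1) ^ 2) := by
      rw [mul_one_div, le_div_iff₀ (by positivity), norm_mul, Real.norm_eq_abs, Real.norm_eq_abs]
      calc _ ≤ A * ((l : ℝ) + 1) ^ k * |coeff f l| * ((l : ℝ) + 1) ^ 2 := by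
            have := hA l
            gcongr
        _ = A * (((l : ℝ) + 1) ^ (k + 2) * |coeff f l|) := by ring
        _ ≤ A * (C * M) := mul_le_mul_of_nonneg_left (hK f M hM l) hA0
        _ = _ := by ring
    have := (hs f).hasSum.norm_le_of_bounded (hs2.hasSum.mul_left (A * C * M)) hterm
    refine this.trans (le_of_eq (by ring))
  exact ⟨⟨T, hT⟩, fun f => (hs f).hasSum⟩

lemma TestFn.coe_sum (s : Finset ℕ) (u : ℕ → TestFn) (x : S2) :
    (∑ l ∈ s, u l).1 x = ∑ l ∈ s, (u l).1 x := by
  induction s using Finset.induction_on with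
  | empty => rfl
  | insert l s hl ih =>
    rw [Finset.sum_insert hl, Finset.sum_insert hl, ← ih]
    rfl

/-- Near the sphere the radial extension of f is the sum of the terms `coeff f l * zonalExt l`,
whose derivatives of each order are dominated by a summable sequence. By continuity, T is then
determined by its coordinates (`Distr.tendsto_sum`). -/
lemma tendsto_sum_coeff_smul_Y (f : TestFn) :
    Tendsto (fun N => ∑ l ∈ Finset.range N, coeff f l • Y l) atTop (𝓝 f) := by
  rw [tendsto_testFn]
  intro n
  have ha := rapidDecay_coeff f
  obtain ⟨v, hv, hle⟩ := exists_summable_bound ha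
  have h := tendstoUniformly_tsum_nat (hv n) (f := fun l (s : S2) =>
    iteratedFDeriv ℝ n (fun x => coeff f l * zonalExt l x) (s : R3)) (fun l s => hle n l s)
  have hsm (l : ℕ) : ContDiff ℝ ∞ fun x => coeff f l * zonalExt l x :=
    contDiff_const.mul (contDiff_zonalExt l)
  have hY (l : ℕ) (s : S2) : ∀ᶠ x in 𝓝 (s : R3), (Y l).1 (radial x) = zonalExt l x := by
    filter_upwards [heightExt_eventuallyEq s] with x hx
    rw [zonalExt, hx, Y_apply]
  have e1 (s : S2) : iteratedFDeriv ℝ n (fun x : R3 => f.1 (radial x)) (s : R3)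
      = ∑' l, iteratedFDeriv ℝ n (fun x => coeff f l * zonalExt l x) (s : R3) := by
    rw [← iteratedFDeriv_tsum_apply (N := ⊤) hsm (fun k _ => hv k) (fun k l x _ => hle k l x)
      le_top]
    refine Filter.EventuallyEq.eq_of_nhds (Filter.EventuallyEq.iteratedFDeriv ℝ ?_ n)
    filter_upwards [heightExt_eventuallyEq s] with x hx
    rw [← (hasSum_coeff_mul_Y f (radial x)).tsum_eq]
    refine tsum_congr fun l => ?_
    rw [zonalExt, hx, Y_apply]
  have e2 (N : ℕ) (s : S2) : iteratedFDeriv ℝ n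
      (fun x : R3 => (∑ l ∈ Finset.range N, coeff f l • Y l).1 (radial x)) (s : R3)
      = ∑ l ∈ Finset.range N, iteratedFDeriv ℝ n (fun x => coeff f l * zonalExt l x) (s : R3) := by
    rw [← iteratedFDeriv_fun_sum_apply (f := fun l x => coeff f l * zonalExt l x)
      fun l _ => ((hsm l).of_le (by exact_mod_cast le_top)).contDiffAt]
    refine Filter.EventuallyEq.eq_of_nhds (Filter.EventuallyEq.iteratedFDeriv ℝ ?_ n)
    filter_upwards [heightExt_eventuallyEq s] with x hx
    rw [TestFn.coe_sum]
    refine Finset.sum_congr rfl fun l _ => ?_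
    rw [zonalExt, hx]
    rfl
  simp only [e1, e2]
  exact h

lemma Distr.tendsto_sum (T : Distr) (f : TestFn) :
    Tendsto (fun N => ∑ l ∈ Finset.range N, T (Y l) * coeff f l) atTop (𝓝 (T f)) := by
  have h := (T.continuous.tendsto f).comp (tendsto_sum_coeff_smul_Y f)
  refine h.congr fun N => ?_
  simp only [Function.comp_apply, map_sum, map_smul, smul_eq_mul, mul_comm]

/-! ### Mode functions -/

/-- The Liouville transform `(sin t / 2)^{1/2} R(cos t)`. -/
def liouville (R : ℝ → ℝ) (t : ℝ) : ℝ := Real.sqrt (Real.sin t) * (1 / Real.sqrt 2 * R (Real.cos t))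

/-- The derivative of the Liouville transform of a function with value `r` and derivative `r'` at
`cos t`. -/
def liouvilleDeriv (r r' t : ℝ) : ℝ :=
  Real.cos t / (2 * Real.sqrt (Real.sin t)) * (1 / Real.sqrt 2 * r)
    + Real.sqrt (Real.sin t) * (1 / Real.sqrt 2 * (r' * -Real.sin t))

lemma hasDerivAt_liouville {R : ℝ → ℝ} {r' t : ℝ} (ht : t ∈ Ioo 0 Real.pi)
    (hR : HasDerivAt R r' (Real.cos t)) :
    HasDerivAt (liouville R) (liouvilleDeriv (R (Real.cos t)) r' t) t := by
  have hs : Real.sin t ≠ 0 := (Real.sin_pos_of_pos_of_lt_pi ht.1 ht.2).ne'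
  exact ((Real.hasDerivAt_sin t).sqrt hs).mul
    ((hR.comp t (Real.hasDerivAt_cos t)).const_mul (1 / Real.sqrt 2))

/-- The Legendre Wronskian is 1/(1-x²). The squared prefactor sin t / 2 and the factor -sin t from
the chain rule turn it into a constant and reverse the sign. -/
lemma liouville_wronskian {p q : ℝ → ℝ} {p' q' t : ℝ} (ht : t ∈ Ioo 0 Real.pi)
    (h : (1 - Real.cos t ^ 2) * (p (Real.cos t) * q' - p' * q (Real.cos t)) = 1) :
    liouville q t * liouvilleDeriv (p (Real.cos t)) p' t
      - liouville p t * liouvilleDeriv (q (Real.cos t)) q' t = 1 / 2 := by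
  have hs : 0 < Real.sin t := Real.sin_pos_of_pos_of_lt_pi ht.1 ht.2
  have h1 : Real.sqrt (Real.sin t) ^ 2 = Real.sin t := Real.sq_sqrt hs.le
  have h2 : (1 / Real.sqrt 2) ^ 2 = 1 / 2 := by rw [div_pow, Real.sq_sqrt zero_le_two, one_pow]
  have h3 := Real.sin_sq_add_cos_sq t
  unfold liouville liouvilleDeriv
  set w := Real.sqrt (Real.sin t)
  set k := 1 / Real.sqrt 2
  set c := Real.cos t
  set s := Real.sin t
  linear_combination (k ^ 2 * s * (p c * q' - p' * q c)) * h1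
    + (s ^ 2 * (p c * q' - p' * q c)) * h2 + (1 / 2) * (p c * q' - p' * q c) * h3 + (1 / 2) * h

lemma cos_mem_Ioo {t : ℝ} (ht : t ∈ Ioo 0 Real.pi) : Real.cos t ∈ Ioo (-1 : ℝ) 1 := by
  have hs := Real.sin_pos_of_pos_of_lt_pi ht.1 ht.2
  have h := Real.sin_sq_add_cos_sq t
  constructor <;> nlinarith

lemma cos_sq_lt_one {t : ℝ} (ht : t ∈ Ioo 0 Real.pi) : Real.cos t ^ 2 < 1 := by
  have h := cos_mem_Ioo ht
  nlinarith [h.1, h.2]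

/-- The function `ũ_ℓ`. -/
def uMode (l : ℕ) : ℝ → ℝ := liouville fun x => (legP l).eval x

/-- The function `ṽ_ℓ`. -/
def vMode (l : ℕ) : ℝ → ℝ := liouville (legQ l)

/-- The derivative of `ũ_ℓ`. -/
def uMode' (l : ℕ) (t : ℝ) : ℝ :=
  liouvilleDeriv ((legP l).eval (Real.cos t)) ((legP l).derivative.eval (Real.cos t)) t

/-- The derivative of `ṽ_ℓ`. -/
def vMode' (l : ℕ) (t : ℝ) : ℝ :=
  liouvilleDeriv (legQ l (Real.cos t)) (((l : ℝ) + 1) *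
    (Real.cos t * legQ l (Real.cos t) - legQ (l + 1) (Real.cos t)) / (1 - Real.cos t ^ 2)) t

lemma hasDerivAt_uMode (l : ℕ) {t : ℝ} (ht : t ∈ Ioo 0 Real.pi) :
    HasDerivAt (uMode l) (uMode' l t) t :=
  hasDerivAt_liouville ht ((legP l).hasDerivAt _)

lemma hasDerivAt_vMode (l : ℕ) {t : ℝ} (ht : t ∈ Ioo 0 Real.pi) :
    HasDerivAt (vMode l) (vMode' l t) t :=
  hasDerivAt_liouville ht (hasDerivAt_legQ l (cos_mem_Ioo ht))

lemma mode_wronskian (l : ℕ) {t : ℝ} (ht : t ∈ Ioo 0 Real.pi) :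
    vMode l t * uMode' l t - uMode l t * vMode' l t = 1 / 2 := by
  refine liouville_wronskian (p := fun x => (legP l).eval x) (q := legQ l) ht ?_
  have hc : 1 - Real.cos t ^ 2 ≠ 0 := by linarith [cos_sq_lt_one ht]
  have h1 := legendre_casoratian l (Real.cos t)
  have h2 := legP_derivative_succ l (Real.cos t)
  rw [mul_sub, mul_left_comm, mul_div_cancel₀ _ hc]
  linear_combination h1 - legQ l (Real.cos t) * h2

/-- The real part of the mode function. -/
def modeRe (ρ ν : ℕ → ℝ) (l : ℕ) (t : ℝ) : ℝ := ρ l * uMode l t + ν l * vMode l t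

/-- The imaginary part of the mode function. -/
def modeIm (ρ : ℕ → ℝ) (l : ℕ) (t : ℝ) : ℝ := (ρ l)⁻¹ * vMode l t

/-- The real part of the derivative of the mode function. -/
def modeRe' (ρ ν : ℕ → ℝ) (l : ℕ) (t : ℝ) : ℝ := ρ l * uMode' l t + ν l * vMode' l t

/-- The imaginary part of the derivative of the mode function. -/
def modeIm' (ρ : ℕ → ℝ) (l : ℕ) (t : ℝ) : ℝ := (ρ l)⁻¹ * vMode' l t

lemma mode_eq (ρ ν : ℕ → ℝ) (l : ℕ) (t : ℝ) :
    mode ρ ν l t = (modeRe ρ ν l t : ℂ) + Complex.I * (modeIm ρ l t : ℂ) := by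
  simp only [mode, modeRe, modeIm, uMode, vMode, liouville]
  push_cast
  ring

lemma deriv_mode (ρ ν : ℕ → ℝ) (l : ℕ) {t : ℝ} (ht : t ∈ Ioo 0 Real.pi) :
    deriv (mode ρ ν l) t = (modeRe' ρ ν l t : ℂ) + Complex.I * (modeIm' ρ l t : ℂ) := by
  have e : mode ρ ν l = fun t => (modeRe ρ ν l t : ℂ) + Complex.I * (modeIm ρ l t : ℂ) :=
    funext fun t => mode_eq ρ ν l t
  have h1 : HasDerivAt (modeRe ρ ν l) (modeRe' ρ ν l t) t :=
    ((hasDerivAt_uMode l ht).const_mul _).add ((hasDerivAt_vMode l ht).const_mul _)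
  have h2 : HasDerivAt (modeIm ρ l) (modeIm' ρ l t) t := (hasDerivAt_vMode l ht).const_mul _
  rw [e]
  exact (h1.ofReal_comp.add (h2.ofReal_comp.const_mul Complex.I)).deriv

lemma norm_mode_sq (ρ ν : ℕ → ℝ) (l : ℕ) (t : ℝ) :
    ‖mode ρ ν l t‖ ^ 2 = modeRe ρ ν l t ^ 2 + modeIm ρ l t ^ 2 := by
  rw [mode_eq, Complex.sq_norm, mul_comm, Complex.normSq_add_mul_I]

/-- The parameter ν drops out and ρ cancels against its inverse. This determinant gives both z_ℓ ≠ 0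
and the unique solvability for the amplitudes. -/
lemma mode_det {ρ ν : ℕ → ℝ} (l : ℕ) (hρ : 0 < ρ l) {t : ℝ} (ht : t ∈ Ioo 0 Real.pi) :
    modeIm ρ l t * modeRe' ρ ν l t - modeRe ρ ν l t * modeIm' ρ l t = 1 / 2 := by
  rw [← mode_wronskian l ht]
  simp only [modeIm, modeIm', modeRe, modeRe']
  field_simp
  ring

lemma mode_ne_zero {ρ ν : ℕ → ℝ} (l : ℕ) (hρ : 0 < ρ l) {t : ℝ} (ht : t ∈ Ioo 0 Real.pi) :
    mode ρ ν l t ≠ 0 := by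
  intro h
  have h1 := norm_mode_sq ρ ν l t
  rw [h, norm_zero] at h1
  have h2 : modeRe ρ ν l t = 0 := by nlinarith [sq_nonneg (modeRe ρ ν l t), sq_nonneg (modeIm ρ l t)]
  have h3 : modeIm ρ l t = 0 := by nlinarith [sq_nonneg (modeRe ρ ν l t), sq_nonneg (modeIm ρ l t)]
  have := mode_det (ν := ν) l hρ ht
  rw [h2, h3] at this
  norm_num at this

lemma hasModes_iff (ρ ν : ℕ → ℝ) {t : ℝ} (ht : t ∈ Ioo 0 Real.pi) (b : ℕ → ℂ)
    (X : TestFn × TestFn) : HasModes ρ ν t b X ↔ ∀ l,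
      coeff X.1 l = 2 * ((b l).re * modeRe ρ ν l t - (b l).im * modeIm ρ l t) ∧
      coeff X.2 l = 2 * ((b l).re * modeRe' ρ ν l t - (b l).im * modeIm' ρ l t) := by
  refine forall_congr' fun l => ?_
  rw [Complex.add_conj, Complex.add_conj, Complex.ofReal_inj, Complex.ofReal_inj, mode_eq,
    deriv_mode ρ ν l ht]
  simp

/-! ### Bounds for the mode functions -/

/-- The ℓ² hypotheses are needed only through these bounds: ρ_ℓ tends to a positive limit, so its
inverses are bounded too. -/
lemma exists_bounds_of_summable {ρ ν : ℕ → ℝ}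
    (hρ : Summable fun l => (ρ l - Real.sqrt (Real.pi / 2)) ^ 2)
    (hν : Summable fun l => ν l ^ 2) :
    ∃ R : ℝ, ∀ l, ρ l ≤ R ∧ (ρ l)⁻¹ ≤ R ∧ |ν l| ≤ R := by
  have hlim {u : ℕ → ℝ} (hu : Summable fun l => u l ^ 2) : Tendsto u atTop (𝓝 0) := by
    have h := (Real.continuous_sqrt.tendsto 0).comp hu.tendsto_atTop_zero
    rw [Real.sqrt_zero] at h
    refine squeeze_zero_norm (fun l => ?_) h
    rw [Function.comp_apply, Real.sqrt_sq_eq_abs, Real.norm_eq_abs]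
  have h1 : Tendsto ρ atTop (𝓝 (Real.sqrt (Real.pi / 2))) := by
    simpa using (hlim hρ).add_const (Real.sqrt (Real.pi / 2))
  have hpos : 0 < Real.sqrt (Real.pi / 2) := Real.sqrt_pos.2 (by positivity)
  obtain ⟨R1, hR1⟩ := h1.bddAbove_range
  obtain ⟨R2, hR2⟩ := (h1.inv₀ hpos.ne').bddAbove_range
  obtain ⟨R3, hR3⟩ := (hlim hν).abs.bddAbove_range
  exact ⟨max R1 (max R2 R3), fun l => ⟨(hR1 ⟨l, rfl⟩).trans (le_max_left _ _),
    (hR2 ⟨l, rfl⟩).trans ((le_max_left _ _).trans (le_max_right _ _)),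
    (hR3 ⟨l, rfl⟩).trans ((le_max_right _ _).trans (le_max_right _ _))⟩⟩

lemma exists_legendre_sq_le {x : ℝ} (hx : x ^ 2 < 1) : ∃ C : ℝ, ∀ l : ℕ,
    (legP l).eval x ^ 2 ≤ C / ((l : ℝ) + 1) ∧ legQ l x ^ 2 ≤ C / ((l : ℝ) + 1) := by
  obtain ⟨C1, h1⟩ := bonnet_sq_le hx (p := fun l => (legP l).eval x) fun n => legP_rec n x
  obtain ⟨C2, h2⟩ := bonnet_sq_le hx (p := fun l => legQ l x) fun n => legQ_rec n x
  refine ⟨max C1 C2, fun l => ⟨(h1 l).trans ?_, (h2 l).trans ?_⟩⟩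
  · exact div_le_div_of_nonneg_right (le_max_left _ _) (by positivity)
  · exact div_le_div_of_nonneg_right (le_max_right _ _) (by positivity)

lemma liouville_sq (R : ℝ → ℝ) {t : ℝ} (ht : t ∈ Ioo 0 Real.pi) :
    liouville R t ^ 2 = Real.sin t / 2 * R (Real.cos t) ^ 2 := by
  have hs : 0 < Real.sin t := Real.sin_pos_of_pos_of_lt_pi ht.1 ht.2
  rw [liouville, mul_pow, mul_pow, Real.sq_sqrt hs.le, div_pow, Real.sq_sqrt zero_le_two]
  ring

lemma exists_mode_sq_le {t : ℝ} (ht : t ∈ Ioo 0 Real.pi) : ∃ C : ℝ, ∀ l : ℕ,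
    uMode l t ^ 2 ≤ C / ((l : ℝ) + 1) ∧ vMode l t ^ 2 ≤ C / ((l : ℝ) + 1) := by
  obtain ⟨C, hC⟩ := exists_legendre_sq_le (cos_sq_lt_one ht)
  have hs1 : Real.sin t / 2 ≤ 1 := by linarith [Real.sin_le_one t]
  refine ⟨C, fun l => ⟨?_, ?_⟩⟩
  · rw [uMode, liouville_sq _ ht]
    exact (mul_le_of_le_one_left (sq_nonneg _) hs1).trans (hC l).1
  · rw [vMode, liouville_sq _ ht]
    exact (mul_le_of_le_one_left (sq_nonneg _) hs1).trans (hC l).2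

/-- The Casoratian writes 1/(ℓ+1) as P_{ℓ+1} Q_ℓ - P_ℓ Q_{ℓ+1}, at most half the sum of the four
squares; summability would force the harmonic series to converge. -/
lemma not_summable_mode_sq {t : ℝ} (ht : t ∈ Ioo 0 Real.pi) :
    ¬ Summable fun l => uMode l t ^ 2 + vMode l t ^ 2 := by
  intro h
  have hs : 0 < Real.sin t := Real.sin_pos_of_pos_of_lt_pi ht.1 ht.2
  have h2 := ((h.add ((summable_nat_add_iff 1).2 h)).mul_left (1 / Real.sin t))
  have h3 : Summable fun l : ℕ => 1 / ((l + 1 : ℕ) : ℝ) := by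
    refine Summable.of_nonneg_of_le (fun l => by positivity) (fun l => ?_) h2
    have hc := legendre_casoratian l (Real.cos t)
    simp only [uMode, vMode, liouville_sq _ ht]
    set a := (legP (l + 1)).eval (Real.cos t)
    set b := legQ l (Real.cos t)
    set c := (legP l).eval (Real.cos t)
    set d := legQ (l + 1) (Real.cos t)
    have e : 1 / ((l + 1 : ℕ) : ℝ) = a * b - c * d := by
      have : ((l : ℝ) + 1) ≠ 0 := by positivity
      push_cast
      rw [div_eq_iff this, mul_comm, hc]
    have e2 : 1 / Real.sin t * (Real.sin t / 2 * c ^ 2 + Real.sin t / 2 * b ^ 2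
        + (Real.sin t / 2 * a ^ 2 + Real.sin t / 2 * d ^ 2))
        = (a ^ 2 + b ^ 2 + c ^ 2 + d ^ 2) / 2 := by
      field_simp
      ring
    rw [e, e2]
    nlinarith [sq_nonneg (a - b), sq_nonneg (c + d)]
  exact Real.not_summable_one_div_natCast ((summable_nat_add_iff 1).1 h3)

lemma PolyBounded.of_abs_le {m : ℕ → ℝ} {A : ℝ} (h : ∀ l, |m l| ≤ A) : PolyBounded m :=
  ⟨A, 0, fun l => by simpa using h l⟩

lemma PolyBounded.add {m n : ℕ → ℝ} (hm : PolyBounded m) (hn : PolyBounded n) :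
    PolyBounded fun l => m l + n l := by
  obtain ⟨A, j, hA⟩ := hm
  obtain ⟨B, k, hB⟩ := hn
  have hA0 : 0 ≤ A := by simpa using (abs_nonneg _).trans (hA 0)
  have hB0 : 0 ≤ B := by simpa using (abs_nonneg _).trans (hB 0)
  refine ⟨A + B, j + k, fun l => ?_⟩
  have h1 : (1 : ℝ) ≤ (l : ℝ) + 1 := by linarith [(l.cast_nonneg : (0 : ℝ) ≤ l)]
  rw [add_mul]
  refine (abs_add_le _ _).trans (add_le_add ((hA l).trans ?_) ((hB l).trans ?_))
  · exact mul_le_mul_of_nonneg_left (pow_le_pow_right₀ h1 (by omega)) hA0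
  · exact mul_le_mul_of_nonneg_left (pow_le_pow_right₀ h1 (by omega)) hB0

lemma PolyBounded.mul {m n : ℕ → ℝ} (hm : PolyBounded m) (hn : PolyBounded n) :
    PolyBounded fun l => m l * n l := by
  obtain ⟨A, j, hA⟩ := hm
  obtain ⟨B, k, hB⟩ := hn
  refine ⟨A * B, j + k, fun l => ?_⟩
  rw [abs_mul, pow_add]
  calc _ ≤ (A * ((l : ℝ) + 1) ^ j) * (B * ((l : ℝ) + 1) ^ k) :=
        mul_le_mul (hA l) (hB l) (abs_nonneg _) ((abs_nonneg _).trans (hA l))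
    _ = _ := by ring

lemma polyBounded_const (c : ℝ) : PolyBounded fun _ => c := .of_abs_le fun _ => le_rfl

lemma polyBounded_succ : PolyBounded fun l => (l : ℝ) + 1 :=
  ⟨1, 1, fun l => by rw [abs_of_nonneg (by positivity)]; simp⟩

lemma PolyBounded.comp_succ {m : ℕ → ℝ} (hm : PolyBounded m) : PolyBounded fun l => m (l + 1) := by
  obtain ⟨A, k, hA⟩ := hm
  have hA0 : 0 ≤ A := by simpa using (abs_nonneg _).trans (hA 0)
  refine ⟨A * 2 ^ k, k, fun l => (hA _).trans ?_⟩
  rw [mul_assoc, ← mul_pow]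
  refine mul_le_mul_of_nonneg_left (pow_le_pow_left₀ (by positivity) ?_ _) hA0
  push_cast
  linarith [(l.cast_nonneg : (0 : ℝ) ≤ l)]

lemma PolyBounded.of_sq_le {m : ℕ → ℝ} {C : ℝ} (h : ∀ l : ℕ, m l ^ 2 ≤ C / ((l : ℝ) + 1)) :
    PolyBounded m := by
  refine .of_abs_le (A := 1 + C) fun l => ?_
  have hC : 0 ≤ C := by simpa using (sq_nonneg _).trans (h 0)
  have h1 : C / ((l : ℝ) + 1) ≤ C :=
    div_le_self hC (by linarith [(l.cast_nonneg : (0 : ℝ) ≤ l)])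
  have h2 := (h l).trans h1
  rw [← sq_abs] at h2
  nlinarith [sq_nonneg (|m l| - 1), abs_nonneg (m l)]

lemma PolyBounded.liouvilleDeriv {r r' : ℕ → ℝ} (hr : PolyBounded r) (hr' : PolyBounded r') (t : ℝ) :
    PolyBounded fun l => liouvilleDeriv (r l) (r' l) t :=
  ((polyBounded_const _).mul ((polyBounded_const _).mul hr)).add
    ((polyBounded_const _).mul ((polyBounded_const _).mul (hr'.mul (polyBounded_const _))))

lemma polyBounded_modes {t : ℝ} (ht : t ∈ Ioo 0 Real.pi) :
    PolyBounded (uMode · t) ∧ PolyBounded (vMode · t) ∧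
    PolyBounded (uMode' · t) ∧ PolyBounded (vMode' · t) := by
  obtain ⟨C, hC⟩ := exists_mode_sq_le ht
  obtain ⟨D, hD⟩ := exists_legendre_sq_le (cos_sq_lt_one ht)
  have hp : PolyBounded fun l => (legP l).eval (Real.cos t) := .of_sq_le fun l => (hD l).1
  have hq : PolyBounded fun l => legQ l (Real.cos t) := .of_sq_le fun l => (hD l).2
  have hc : 1 - Real.cos t ^ 2 ≠ 0 := by linarith [cos_sq_lt_one ht]
  have key {r : ℕ → ℝ} (hr : PolyBounded r) : PolyBounded fun l : ℕ => ((l : ℝ) + 1) *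
      (Real.cos t * r l - r (l + 1)) / (1 - Real.cos t ^ 2) := by
    have := (polyBounded_succ.mul (((polyBounded_const (Real.cos t)).mul hr).add
      ((polyBounded_const (-1)).mul hr.comp_succ))).mul (polyBounded_const (1 - Real.cos t ^ 2)⁻¹)
    convert this using 2
    ring
  refine ⟨.of_sq_le fun l => (hC l).1, .of_sq_le fun l => (hC l).2,
    hp.liouvilleDeriv ?_ t, hq.liouvilleDeriv (key hq) t⟩
  convert key hp using 2 with l
  rw [eq_div_iff hc, mul_comm]
  exact legP_derivative_succ l _

lemma polyBounded_mode_parts {ρ ν : ℕ → ℝ} {R : ℝ} (hρ_pos : ∀ l, 0 < ρ l)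
    (hR : ∀ l, ρ l ≤ R ∧ (ρ l)⁻¹ ≤ R ∧ |ν l| ≤ R) {t : ℝ} (ht : t ∈ Ioo 0 Real.pi) :
    PolyBounded (modeRe ρ ν · t) ∧ PolyBounded (modeIm ρ · t) ∧
    PolyBounded (modeRe' ρ ν · t) ∧ PolyBounded (modeIm' ρ · t) := by
  obtain ⟨hu, hv, hu', hv'⟩ := polyBounded_modes ht
  have h1 : PolyBounded ρ := .of_abs_le fun l => by
    rw [abs_of_pos (hρ_pos l)]; exact (hR l).1
  have h2 : PolyBounded fun l => (ρ l)⁻¹ := .of_abs_le fun l => by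
    rw [abs_of_pos (inv_pos.2 (hρ_pos l))]; exact (hR l).2.1
  have h3 : PolyBounded ν := .of_abs_le fun l => (hR l).2.2
  exact ⟨(h1.mul hu).add (h3.mul hv), h2.mul hv, (h1.mul hu').add (h3.mul hv'), h2.mul hv'⟩

lemma exists_norm_mode_sq_le {ρ ν : ℕ → ℝ} {R : ℝ} (hρ_pos : ∀ l, 0 < ρ l)
    (hR : ∀ l, ρ l ≤ R ∧ (ρ l)⁻¹ ≤ R ∧ |ν l| ≤ R) {t : ℝ} (ht : t ∈ Ioo 0 Real.pi) :
    ∃ C : ℝ, ∀ l : ℕ, ‖mode ρ ν l t‖ ^ 2 ≤ C / ((l : ℝ) + 1) := by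
  obtain ⟨C, hC⟩ := exists_mode_sq_le ht
  -- The real part has two terms, whose squared sum costs 4 R² C; the imaginary part adds R² C.
  refine ⟨5 * R ^ 2 * C, fun l => ?_⟩
  obtain ⟨h1, h2, h3⟩ := hR l
  obtain ⟨hu, hv⟩ := hC l
  have hR0 : 0 ≤ R := (hρ_pos l).le.trans h1
  have e1 : ρ l ^ 2 ≤ R ^ 2 := pow_le_pow_left₀ (hρ_pos l).le h1 2
  have e2 : (ρ l)⁻¹ ^ 2 ≤ R ^ 2 := pow_le_pow_left₀ (inv_pos.2 (hρ_pos l)).le h2 2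
  have e3 : ν l ^ 2 ≤ R ^ 2 := by rw [← sq_abs]; exact pow_le_pow_left₀ (abs_nonneg _) h3 2
  rw [norm_mode_sq, modeRe, modeIm, mul_pow, mul_div_assoc]
  have f1 : ρ l ^ 2 * uMode l t ^ 2 ≤ R ^ 2 * (C / ((l : ℝ) + 1)) :=
    mul_le_mul e1 hu (sq_nonneg _) (sq_nonneg _)
  have f2 : (ρ l)⁻¹ ^ 2 * vMode l t ^ 2 ≤ R ^ 2 * (C / ((l : ℝ) + 1)) :=
    mul_le_mul e2 hv (sq_nonneg _) (sq_nonneg _)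
  have f3 : ν l ^ 2 * vMode l t ^ 2 ≤ R ^ 2 * (C / ((l : ℝ) + 1)) :=
    mul_le_mul e3 hv (sq_nonneg _) (sq_nonneg _)
  nlinarith [sq_nonneg (ρ l * uMode l t - ν l * vMode l t)]

/-- The relations defining z_ℓ from u and v can be inverted with bounded coefficients, so u² + v² ≤
const · |z|², and `not_summable_mode_sq` applies. -/
lemma not_summable_norm_mode_sq {ρ ν : ℕ → ℝ} {R : ℝ} (hρ_pos : ∀ l, 0 < ρ l)
    (hR : ∀ l, ρ l ≤ R ∧ (ρ l)⁻¹ ≤ R ∧ |ν l| ≤ R) {t : ℝ} (ht : t ∈ Ioo 0 Real.pi) :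
    ¬ Summable fun l => ‖mode ρ ν l t‖ ^ 2 := by
  intro h
  refine not_summable_mode_sq ht (Summable.of_nonneg_of_le (fun l => by positivity) (fun l => ?_)
    (h.mul_left (2 * R ^ 2 + 2 * R ^ 2 * (R ^ 2 * R ^ 2) + R ^ 2)))
  obtain ⟨h1, h2, h3⟩ := hR l
  have hR0 : 0 ≤ R := (hρ_pos l).le.trans h1
  have e1 : ρ l ^ 2 ≤ R ^ 2 := pow_le_pow_left₀ (hρ_pos l).le h1 2
  have e2 : (ρ l)⁻¹ ^ 2 ≤ R ^ 2 := pow_le_pow_left₀ (inv_pos.2 (hρ_pos l)).le h2 2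
  have e3 : ν l ^ 2 ≤ R ^ 2 := by rw [← sq_abs]; exact pow_le_pow_left₀ (abs_nonneg _) h3 2
  have hne := (hρ_pos l).ne'
  rw [norm_mode_sq]
  set a := modeRe ρ ν l t with ha
  set b := modeIm ρ l t with hb
  have ev : vMode l t = ρ l * b := by rw [hb, modeIm]; field_simp
  have eu : uMode l t = (ρ l)⁻¹ * (a - ν l * (ρ l * b)) := by
    rw [← ev, ha, modeRe]; field_simp; ring
  have g1 : ν l ^ 2 * ρ l ^ 2 ≤ R ^ 2 * R ^ 2 := mul_le_mul e3 e1 (sq_nonneg _) (sq_nonneg _)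
  have g2 : (a - ν l * (ρ l * b)) ^ 2 ≤ 2 * a ^ 2 + 2 * (R ^ 2 * R ^ 2) * b ^ 2 := by
    nlinarith [sq_nonneg (a + ν l * (ρ l * b)), mul_le_mul_of_nonneg_right g1 (sq_nonneg b)]
  have g3 : uMode l t ^ 2 ≤ R ^ 2 * (2 * a ^ 2 + 2 * (R ^ 2 * R ^ 2) * b ^ 2) := by
    rw [eu, mul_pow]
    exact mul_le_mul e2 g2 (sq_nonneg _) (sq_nonneg _)
  have g4 : vMode l t ^ 2 ≤ R ^ 2 * b ^ 2 := by
    rw [ev, mul_pow]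
    exact mul_le_mul_of_nonneg_right e1 (sq_nonneg _)
  have hp : 0 ≤ 2 * R ^ 2 * (R ^ 2 * R ^ 2) * a ^ 2 + R ^ 2 * a ^ 2 + 2 * R ^ 2 * b ^ 2 := by positivity
  linarith

/-! ### The complex structure -/

lemma exists_complexStructure {ρ ν : ℕ → ℝ} {R : ℝ} (hρ_pos : ∀ l, 0 < ρ l)
    (hR : ∀ l, ρ l ≤ R ∧ (ρ l)⁻¹ ≤ R ∧ |ν l| ≤ R) {t : ℝ} (ht : t ∈ Ioo 0 Real.pi) :
    ∃ J : (TestFn × TestFn) →ₗ[ℝ] (TestFn × TestFn),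
      (IsComplexStructureAt ρ ν t J ∧ ∀ J', IsComplexStructureAt ρ ν t J' → J' = J) ∧
      ∀ P l, coeff (((-(1 / 2 : ℝ)) • blockB J) P) l = ‖mode ρ ν l t‖ ^ 2 * coeff P l := by
  obtain ⟨h1, h2, h1', h2'⟩ := polyBounded_mode_parts hρ_pos hR ht
  have hA : PolyBounded fun l => 2 * (modeRe ρ ν l t * modeRe' ρ ν l t + modeIm ρ l t * modeIm' ρ l t) :=
    (polyBounded_const 2).mul ((h1.mul h1').add (h2.mul h2'))
  have hB : PolyBounded fun l => -2 * (modeRe ρ ν l t * modeRe ρ ν l t + modeIm ρ l t * modeIm ρ l t) :=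
    (polyBounded_const (-2)).mul ((h1.mul h1).add (h2.mul h2))
  have hD : PolyBounded fun l =>
      2 * (modeRe' ρ ν l t * modeRe' ρ ν l t + modeIm' ρ l t * modeIm' ρ l t) :=
    (polyBounded_const 2).mul ((h1'.mul h1').add (h2'.mul h2'))
  have hC : PolyBounded fun l =>
      -2 * (modeRe ρ ν l t * modeRe' ρ ν l t + modeIm ρ l t * modeIm' ρ l t) :=
    (polyBounded_const (-2)).mul ((h1.mul h1').add (h2.mul h2'))
  -- The multipliers result from solving for b_ℓ, replacing it by i b_ℓ and substituting back; the
  -- Q-from-P entry is -2|z_ℓ|².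
  let J : (TestFn × TestFn) →ₗ[ℝ] (TestFn × TestFn) :=
    ((multiplier _ hA).coprod (multiplier _ hB)).prod ((multiplier _ hD).coprod (multiplier _ hC))
  have hJ1 (X : TestFn × TestFn) (l : ℕ) : coeff (J X).1 l
      = 2 * (modeRe ρ ν l t * modeRe' ρ ν l t + modeIm ρ l t * modeIm' ρ l t) * coeff X.1 l
      + -2 * (modeRe ρ ν l t * modeRe ρ ν l t + modeIm ρ l t * modeIm ρ l t) * coeff X.2 l := by
    change coeff (multiplier _ hA X.1 + multiplier _ hB X.2) l = _
    rw [coeff_add, coeff_multiplier, coeff_multiplier]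
  have hJ2 (X : TestFn × TestFn) (l : ℕ) : coeff (J X).2 l
      = 2 * (modeRe' ρ ν l t * modeRe' ρ ν l t + modeIm' ρ l t * modeIm' ρ l t) * coeff X.1 l
      + -2 * (modeRe ρ ν l t * modeRe' ρ ν l t + modeIm ρ l t * modeIm' ρ l t) * coeff X.2 l := by
    change coeff (multiplier _ hD X.1 + multiplier _ hC X.2) l = _
    rw [coeff_add, coeff_multiplier, coeff_multiplier]
  have hJ : IsComplexStructureAt ρ ν t J := by
    intro X b hb
    rw [hasModes_iff ρ ν ht] at hb ⊢
    intro l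
    obtain ⟨e1, e2⟩ := hb l
    have hdet := mode_det (ν := ν) l (hρ_pos l) ht
    rw [hJ1, hJ2, e1, e2]
    simp only [Complex.mul_re, Complex.mul_im, Complex.I_re, Complex.I_im, zero_mul, one_mul,
      zero_sub, zero_add]
    set zr := modeRe ρ ν l t
    set zi := modeIm ρ l t
    set wr := modeRe' ρ ν l t
    set wi := modeIm' ρ l t
    set x := (b l).re
    set y := (b l).im
    constructor
    · linear_combination (-4 * (x * zi + y * zr)) * hdet
    · linear_combination (-4 * (x * wi + y * wr)) * hdet
  refine ⟨J, ⟨hJ, fun J' hJ' => ?_⟩, fun P l => ?_⟩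
  · refine LinearMap.ext fun X => ?_
    -- Cramer's rule with determinant 1/2. Every pair of Cauchy data thus has amplitudes, so the
    -- defining property fixes J on the whole space.
    let b : ℕ → ℂ := fun l =>
      ⟨modeIm ρ l t * coeff X.2 l - modeIm' ρ l t * coeff X.1 l,
        modeRe ρ ν l t * coeff X.2 l - modeRe' ρ ν l t * coeff X.1 l⟩
    have hb : HasModes ρ ν t b X := by
      rw [hasModes_iff ρ ν ht]
      intro l
      have hdet := mode_det (ν := ν) l (hρ_pos l) ht
      simp only [b]
      constructor
      · linear_combination (-2 * coeff X.1 l) * hdet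
      · linear_combination (-2 * coeff X.2 l) * hdet
    have m1 := (hasModes_iff ρ ν ht _ _).1 (hJ X b hb)
    have m2 := (hasModes_iff ρ ν ht _ _).1 (hJ' X b hb)
    exact Prod.ext (coeff_injective fun l => (m2 l).1.trans (m1 l).1.symm)
      (coeff_injective fun l => (m2 l).2.trans (m1 l).2.symm)
  · have e : ((-(1 / 2 : ℝ)) • blockB J) P = (-(1 / 2 : ℝ)) • (J (0, P)).1 := rfl
    rw [e, coeff_smul, hJ1, norm_mode_sq]
    simp only [coeff_eq, map_zero]
    ring

/-! ### Gaussian tails -/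

lemma gaussianPDFReal_std (x : ℝ) :
    gaussianPDFReal 0 1 x = (Real.sqrt (2 * Real.pi))⁻¹ * Real.exp (-x ^ 2 / 2) := by
  simp [gaussianPDFReal]

lemma integral_Ioi_mul_exp (a : ℝ) : IntegrableOn (fun x : ℝ => x * Real.exp (-x ^ 2 / 2)) (Ioi a) ∧
    ∫ x in Ioi a, x * Real.exp (-x ^ 2 / 2) = Real.exp (-a ^ 2 / 2) := by
  have hint : Integrable (fun x : ℝ => x * Real.exp (-x ^ 2 / 2)) := by
    refine (integrable_mul_exp_neg_mul_sq (b := 1 / 2) (by norm_num)).congr (ae_of_all _ fun x => ?_)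
    simp only
    congr 2
    ring
  have hd (x : ℝ) : HasDerivAt (fun x : ℝ => -Real.exp (-x ^ 2 / 2)) (x * Real.exp (-x ^ 2 / 2)) x := by
    refine (((((hasDerivAt_id x).pow 2).neg).div_const 2).exp.neg).congr_deriv ?_
    simp
    ring
  have hlim : Tendsto (fun x : ℝ => -Real.exp (-x ^ 2 / 2)) atTop (𝓝 (-0)) := by
    refine (Real.tendsto_exp_atBot.comp ?_).neg
    have : Tendsto (fun x : ℝ => x ^ 2 / 2) atTop atTop :=
      (tendsto_pow_atTop two_ne_zero).atTop_div_const two_pos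
    refine (tendsto_neg_atTop_atBot.comp this).congr fun x => ?_
    simp only [Function.comp_apply, neg_div]
  refine ⟨hint.integrableOn, ?_⟩
  rw [integral_Ioi_of_hasDerivAt_of_tendsto' (fun x _ => hd x) hint.integrableOn hlim]
  ring

lemma gaussianReal_Ici_le {a : ℝ} (ha : 0 < a) :
    gaussianReal 0 1 (Ici a) ≤ ENNReal.ofReal ((1 / 2) * (Real.exp (-a ^ 2 / 2) / a)) := by
  rw [gaussianReal_apply_eq_integral 0 one_ne_zero, integral_Ici_eq_integral_Ioi]
  refine ENNReal.ofReal_le_ofReal ?_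
  obtain ⟨h1, h2⟩ := integral_Ioi_mul_exp a
  -- The bound 1/2 makes the two tails together have constant 1.
  have hk : (Real.sqrt (2 * Real.pi))⁻¹ ≤ 1 / 2 := by
    rw [← one_div]
    refine one_div_le_one_div_of_le two_pos (Real.le_sqrt_of_sq_le ?_)
    linarith [Real.pi_gt_three]
  calc ∫ x in Ioi a, gaussianPDFReal 0 1 x
      ≤ ∫ x in Ioi a, (1 / 2 / a) * (x * Real.exp (-x ^ 2 / 2)) := by
        refine setIntegral_mono_on (integrable_gaussianPDFReal 0 1).integrableOn (h1.const_mul _)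
          measurableSet_Ioi fun x hx => ?_
        rw [gaussianPDFReal_std, ← mul_assoc]
        refine mul_le_mul_of_nonneg_right (hk.trans ?_) (Real.exp_pos _).le
        rw [div_mul_eq_mul_div, le_div_iff₀ ha]
        exact mul_le_mul_of_nonneg_left (mem_Ioi.1 hx).le (by norm_num)
    _ = _ := by
        rw [integral_const_mul, h2]
        ring

lemma gaussianReal_abs_ge_le {a : ℝ} (ha : 0 < a) :
    gaussianReal 0 1 {x | a ≤ |x|} ≤ ENNReal.ofReal (Real.exp (-a ^ 2 / 2) / a) := by
  have e : {x : ℝ | a ≤ |x|} = Ici a ∪ (fun x => -x) ⁻¹' Ici a := by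
    ext x
    simp only [mem_ofPred_eq, le_abs, mem_union, mem_Ici, mem_preimage]
  have hs : gaussianReal 0 1 ((fun x => -x) ⁻¹' Ici a) = gaussianReal 0 1 (Ici a) := by
    rw [← Measure.map_apply measurable_neg measurableSet_Ici, gaussianReal_map_neg, neg_zero]
  rw [e]
  refine (measure_union_le _ _).trans ?_
  rw [hs]
  refine (add_le_add (gaussianReal_Ici_le ha) (gaussianReal_Ici_le ha)).trans (le_of_eq ?_)
  rw [← ENNReal.ofReal_add (by positivity) (by positivity)]
  congr 1
  ring

/-- The density is integrated over [a, a+δ] with δ = 1/(a+1) only. There x² ≤ a² + 2aδ + δ² ≤ a² +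
3, which costs the factor exp(-3/2). -/
lemma le_gaussianReal_abs_ge {a : ℝ} (ha : 0 ≤ a) :
    ENNReal.ofReal ((Real.sqrt (2 * Real.pi))⁻¹ * Real.exp (-(3 / 2)) *
      (Real.exp (-a ^ 2 / 2) / (a + 1))) ≤ gaussianReal 0 1 {x | a ≤ |x|} := by
  set δ := 1 / (a + 1) with hδ
  have hδ0 : 0 < δ := by positivity
  have hδ1 : δ ≤ 1 := by rw [hδ, div_le_one (by positivity)]; linarith
  have haδ : a * δ ≤ 1 := by rw [hδ, mul_one_div, div_le_one (by positivity)]; linarith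
  have hsub : Icc a (a + δ) ⊆ {x : ℝ | a ≤ |x|} := fun x hx => hx.1.trans (le_abs_self x)
  refine le_trans ?_ (measure_mono hsub)
  rw [gaussianReal_apply_eq_integral 0 one_ne_zero]
  refine ENNReal.ofReal_le_ofReal ?_
  have h1 : ∫ x in Icc a (a + δ), (Real.sqrt (2 * Real.pi))⁻¹ * Real.exp (-(3 / 2)) *
      Real.exp (-a ^ 2 / 2) ≤ ∫ x in Icc a (a + δ), gaussianPDFReal 0 1 x := by
    refine setIntegral_mono_on (continuous_const.integrableOn_Icc) (integrable_gaussianPDFReal 0 1).integrableOn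
      measurableSet_Icc fun x hx => ?_
    rw [gaussianPDFReal_std, mul_assoc, ← Real.exp_add]
    refine mul_le_mul_of_nonneg_left (Real.exp_le_exp.2 ?_) (by positivity)
    have : x ^ 2 ≤ (a + δ) ^ 2 := pow_le_pow_left₀ (ha.trans hx.1) hx.2 2
    nlinarith
  refine le_trans (le_of_eq ?_) h1
  rw [setIntegral_const, smul_eq_mul, Real.volume_real_Icc_of_le (by linarith), hδ]
  ring

/-- The probability that a standard Gaussian variable exceeds `√(2 log D)` in modulus. -/
def tailProb (D : ℝ) : ℝ≥0∞ := gaussianReal 0 1 {x | Real.sqrt (2 * Real.log D) ≤ |x|}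

lemma exp_neg_sqrt_log {D : ℝ} (hD : 1 < D) :
    Real.exp (-Real.sqrt (2 * Real.log D) ^ 2 / 2) = 1 / D := by
  have hl := Real.log_pos hD
  rw [Real.sq_sqrt (by positivity), neg_div, mul_div_cancel_left₀ _ two_ne_zero, Real.exp_neg,
    Real.exp_log (by linarith), one_div]

lemma tailProb_le {D : ℝ} (hD : 1 < D) :
    tailProb D ≤ ENNReal.ofReal (1 / (D * Real.sqrt (Real.log D))) := by
  have hl := Real.log_pos hD
  refine (gaussianReal_abs_ge_le (Real.sqrt_pos.2 (by positivity))).trans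
    (ENNReal.ofReal_le_ofReal ?_)
  rw [exp_neg_sqrt_log hD, div_div]
  have h0 : 0 < Real.sqrt (Real.log D) := Real.sqrt_pos.2 hl
  refine one_div_le_one_div_of_le (by positivity) (mul_le_mul_of_nonneg_left ?_ (by linarith))
  exact Real.sqrt_le_sqrt (by linarith)

/-- The minimum with 1 is unavoidable: as D decreases to 1 the quotient is unbounded while a
probability is not. -/
lemma exists_le_tailProb : ∃ c : ℝ, 0 < c ∧ ∀ D : ℝ, 1 < D →
    ENNReal.ofReal (c * min 1 (1 / (D * Real.sqrt (Real.log D)))) ≤ tailProb D := by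
  set k := (Real.sqrt (2 * Real.pi))⁻¹ * Real.exp (-(3 / 2)) with hk
  have hk0 : 0 < k := by positivity
  refine ⟨k / 4, by positivity, fun D hD => ?_⟩
  have hl := Real.log_pos hD
  have hD0 : 0 < D := by linarith
  refine le_trans (ENNReal.ofReal_le_ofReal ?_) (le_gaussianReal_abs_ge (Real.sqrt_nonneg _))
  rw [div_mul_eq_mul_div, mul_div_assoc]
  refine mul_le_mul_of_nonneg_left ?_ hk0.le
  set a := Real.sqrt (2 * Real.log D) with ha
  have ha0 : 0 < a := Real.sqrt_pos.2 (by positivity)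
  rcases lt_or_ge a 1 with h | h
  · have h1 : (1 / 2 : ℝ) ≤ Real.exp (-a ^ 2 / 2) := by
      refine le_trans ?_ (Real.add_one_le_exp _)
      nlinarith
    calc _ ≤ (1 : ℝ) / 4 := by gcongr; exact min_le_left _ _
      _ ≤ Real.exp (-a ^ 2 / 2) / 2 := by linarith
      _ ≤ _ := div_le_div_of_nonneg_left (Real.exp_pos _).le (by positivity) (by linarith)
  · rw [ha, exp_neg_sqrt_log hD, ← ha, div_div]
    have h0 : 0 < Real.sqrt (Real.log D) := Real.sqrt_pos.2 hl
    have h2 : a ≤ 2 * Real.sqrt (Real.log D) := by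
      rw [ha, Real.sqrt_le_left (by positivity), mul_pow, Real.sq_sqrt hl.le]
      linarith
    calc _ ≤ 1 / (D * Real.sqrt (Real.log D)) / 4 := by gcongr; exact min_le_right _ _
      _ = 1 / (D * (4 * Real.sqrt (Real.log D))) := by rw [div_div]; congr 1; ring
      _ ≤ 1 / (D * (a + 1)) := by
          refine one_div_le_one_div_of_le (by positivity) (mul_le_mul_of_nonneg_left ?_ hD0.le)
          linarith

lemma gaussianReal_abs_ge (r : ℝ≥0) (hr : 0 < r) (D : ℝ) :
    gaussianReal 0 (r ^ 2) {x | r * Real.sqrt (2 * Real.log D) ≤ |x|} = tailProb D := by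
  have h := gaussianReal_map_const_mul (μ := 0) (v := 1) (r : ℝ)
  have e : (NNReal.mk ((r : ℝ) ^ 2) (sq_nonneg _) * 1) = r ^ 2 := by
    rw [mul_one]; ext; simp
  rw [mul_zero, e] at h
  have hms : MeasurableSet {x : ℝ | r * Real.sqrt (2 * Real.log D) ≤ |x|} :=
    measurableSet_le measurable_const measurable_norm
  rw [← h, Measure.map_apply (measurable_const_mul _) hms, tailProb]
  congr 1
  ext x
  have hr' : (0 : ℝ) < r := hr
  simp only [mem_preimage, mem_ofPred_eq, abs_mul, abs_of_pos hr', mul_le_mul_iff_right₀ hr']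

/-! ### Sequences of independent Gaussian variables -/

section Independent

variable {Ω : Type*} [MeasurableSpace Ω] {μ : Measure Ω} {X : ℕ → Ω → ℝ} {v : ℕ → ℝ≥0}

lemma lintegral_sq_of_map_eq (hm : ∀ l, Measurable (X l))
    (hX : ∀ l, μ.map (X l) = gaussianReal 0 (v l)) (l : ℕ) :
    ∫⁻ w, ENNReal.ofReal (X l w ^ 2) ∂μ = v l := by
  have h1 : ∫⁻ w, ENNReal.ofReal (X l w ^ 2) ∂μ
      = ∫⁻ x, ENNReal.ofReal (x ^ 2) ∂(gaussianReal 0 (v l)) := by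
    rw [← hX l, lintegral_map (by fun_prop) (hm l)]
  have hL : MemLp (fun x : ℝ => x) 2 (gaussianReal 0 (v l)) := memLp_id_gaussianReal 2
  have h2 : ∫ x, x ^ 2 ∂(gaussianReal 0 (v l)) = v l := by
    have h3 := variance_id_gaussianReal (μ := 0) (v := v l)
    rw [variance_of_integral_eq_zero aemeasurable_id (by simp)] at h3
    simpa using h3
  rw [h1, ← ofReal_integral_eq_lintegral_ofReal hL.integrable_sq (ae_of_all _ fun x => sq_nonneg x)]
  rw [h2, ENNReal.ofReal_coe_nnreal]

/-- By Tonelli the expectation of the series is ∑ c_l v_l < ∞. Independence plays no role. -/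
lemma ae_summable_mul_sq (hm : ∀ l, Measurable (X l))
    (hX : ∀ l, μ.map (X l) = gaussianReal 0 (v l)) {c : ℕ → ℝ} (hc : ∀ l, 0 ≤ c l)
    (hs : Summable fun l => c l * v l) : ∀ᵐ w ∂μ, Summable fun l => c l * X l w ^ 2 := by
  have h1 (l : ℕ) : ∫⁻ w, ENNReal.ofReal (c l * X l w ^ 2) ∂μ = ENNReal.ofReal (c l * v l) := by
    simp only [ENNReal.ofReal_mul (hc l)]
    rw [lintegral_const_mul _ (by fun_prop), lintegral_sq_of_map_eq hm hX, ENNReal.ofReal_coe_nnreal]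
  have h2 : ∫⁻ w, ∑' l, ENNReal.ofReal (c l * X l w ^ 2) ∂μ ≠ ⊤ := by
    rw [lintegral_tsum fun l => by fun_prop]
    simp only [h1]
    exact hs.tsum_ofReal_ne_top
  have h4 : Measurable fun w => ∑' l, ENNReal.ofReal (c l * X l w ^ 2) :=
    Measurable.tsum fun l => by fun_prop
  filter_upwards [ae_lt_top h4 h2] with w hw
  have h3 := ENNReal.summable_toReal hw.ne
  refine h3.congr fun l => ?_
  rw [ENNReal.toReal_ofReal (mul_nonneg (hc l) (sq_nonneg _))]

lemma integral_exp_neg_sq_gaussianReal {v : ℝ≥0} (hv : v ≠ 0) :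
    ∫ x, Real.exp (-x ^ 2) ∂(gaussianReal 0 v) = (Real.sqrt (1 + 2 * v))⁻¹ := by
  have hv0 : (0 : ℝ) < v := by positivity
  rw [integral_gaussianReal_eq_integral_smul hv]
  have e (x : ℝ) : gaussianPDFReal 0 v x • Real.exp (-x ^ 2)
      = (Real.sqrt (2 * Real.pi * v))⁻¹ * Real.exp (-(1 / (2 * v) + 1) * x ^ 2) := by
    rw [gaussianPDFReal_def, smul_eq_mul, mul_assoc, ← Real.exp_add]
    congr 2
    field_simp
    ring
  simp only [e]
  rw [integral_const_mul, integral_gaussian, ← Real.sqrt_inv, ← Real.sqrt_inv, ← Real.sqrt_mul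
    (by positivity)]
  congr 1
  have := Real.pi_pos
  field_simp

lemma one_add_sum_le_prod (a : ℕ → ℝ) (ha : ∀ l, 0 ≤ a l) (n : ℕ) :
    1 + ∑ l ∈ Finset.range n, a l ≤ ∏ l ∈ Finset.range n, (1 + a l) := by
  induction n with
  | zero => simp
  | succ n ih =>
    rw [Finset.sum_range_succ, Finset.prod_range_succ]
    have h1 : 0 ≤ ∑ l ∈ Finset.range n, a l := Finset.sum_nonneg fun l _ => ha l
    nlinarith [mul_le_mul_of_nonneg_right ih (by linarith [ha n] : 0 ≤ 1 + a n), mul_nonneg h1 (ha n)]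

/-- By independence E exp(-∑_{l<n} X_l²) = ∏ (1 + 2 v_l)^(-1/2), which tends to 0 because ∏ (1 + 2
v_l) ≥ 1 + 2 ∑ v_l. The argument works for variances tending to 0. -/
lemma ae_not_summable_sq (hI : iIndepFun X μ) (hm : ∀ l, Measurable (X l))
    (hX : ∀ l, μ.map (X l) = gaussianReal 0 (v l)) (hv : ∀ l, v l ≠ 0)
    (hs : ¬ Summable fun l => (v l : ℝ)) : ∀ᵐ w ∂μ, ¬ Summable fun l => X l w ^ 2 := by
  have : IsProbabilityMeasure μ := hI.isProbabilityMeasure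
  have hmgf (n : ℕ) : ∫ w, Real.exp (-∑ l ∈ Finset.range n, X l w ^ 2) ∂μ
      = ∏ l ∈ Finset.range n, (Real.sqrt (1 + 2 * v l))⁻¹ := by
    have hI2 : iIndepFun (fun l w => X l w ^ 2) μ :=
      hI.comp (fun _ x => x ^ 2) fun _ => by fun_prop
    have h := hI2.mgf_sum (t := -1) (fun l => (hm l).pow_const 2) (Finset.range n)
    have e1 : mgf (∑ l ∈ Finset.range n, fun w => X l w ^ 2) μ (-1)
        = ∫ w, Real.exp (-∑ l ∈ Finset.range n, X l w ^ 2) ∂μ := by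
      simp only [mgf, Finset.sum_apply, neg_one_mul]
    rw [← e1, h]
    refine Finset.prod_congr rfl fun l _ => ?_
    rw [← integral_exp_neg_sq_gaussianReal (hv l), ← hX l, integral_map (hm l).aemeasurable
      (by fun_prop)]
    simp only [mgf, neg_one_mul]
  have hlim : Tendsto (fun n => ∏ l ∈ Finset.range n, (Real.sqrt (1 + 2 * v l))⁻¹) atTop (𝓝 0) := by
    have h1 : Tendsto (fun n => ∑ l ∈ Finset.range n, (2 * v l : ℝ)) atTop atTop := by
      refine (not_summable_iff_tendsto_nat_atTop_of_nonneg fun l => by positivity).1 fun h => hs ?_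
      simpa using h.mul_left (1 / 2 : ℝ)
    have h2 : Tendsto (fun n => ∏ l ∈ Finset.range n, (1 + 2 * v l : ℝ)) atTop atTop := by
      refine tendsto_atTop_mono (fun n => ?_) h1
      have := one_add_sum_le_prod (fun l => (2 * v l : ℝ)) (fun l => by positivity) n
      linarith
    have h3 := tendsto_inv_atTop_zero.comp (Real.tendsto_sqrt_atTop.comp h2)
    refine h3.congr fun n => ?_
    simp only [Function.comp_apply]
    rw [Real.sqrt_eq_rpow, ← Real.finsetProd_rpow _ _ (fun l _ => by positivity),
      ← Finset.prod_inv_distrib]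
    simp only [Real.sqrt_eq_rpow]
  -- Markov's inequality: on this event the exponential is at least exp(-K) for every n.
  have hK (K : ℕ) : μ {w | ∀ n, ∑ l ∈ Finset.range n, X l w ^ 2 ≤ K} = 0 := by
    set A := {w | ∀ n, ∑ l ∈ Finset.range n, X l w ^ 2 ≤ (K : ℝ)} with hA
    have hle (n : ℕ) : μ.real A * Real.exp (-K)
        ≤ ∏ l ∈ Finset.range n, (Real.sqrt (1 + 2 * v l))⁻¹ := by
      have hmeas : Measurable fun w => Real.exp (-∑ l ∈ Finset.range n, X l w ^ 2) := by fun_prop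
      have hint : Integrable (fun w => Real.exp (-∑ l ∈ Finset.range n, X l w ^ 2)) μ := by
        refine Integrable.of_bound hmeas.aestronglyMeasurable 1 (ae_of_all _ fun w => ?_)
        rw [Real.norm_of_nonneg (Real.exp_pos _).le, Real.exp_le_one_iff, neg_nonpos]
        exact Finset.sum_nonneg fun l _ => sq_nonneg _
      have h := mul_meas_ge_le_integral_of_nonneg (μ := μ) (ae_of_all _ fun w => (Real.exp_pos
        (-∑ l ∈ Finset.range n, X l w ^ 2)).le) hint (Real.exp (-K))
      rw [hmgf, mul_comm] at h
      refine le_trans (mul_le_mul_of_nonneg_right (measureReal_mono fun w hw => ?_)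
        (Real.exp_pos _).le) h
      exact Real.exp_le_exp.2 (neg_le_neg (hw n))
    have h0 : μ.real A * Real.exp (-K) ≤ 0 := ge_of_tendsto' hlim hle
    have h1 : μ.real A = 0 := le_antisymm (by
      by_contra hc
      exact absurd h0 (not_le.2 (mul_pos (not_le.1 hc) (Real.exp_pos _)))) measureReal_nonneg
    exact (measureReal_eq_zero_iff).1 h1
  have hall : ∀ᵐ w ∂μ, ∀ K : ℕ, ¬ ∀ n, ∑ l ∈ Finset.range n, X l w ^ 2 ≤ K :=
    ae_all_iff.2 fun K => by
      rw [ae_iff]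
      simpa only [not_not] using hK K
  filter_upwards [hall] with w hw hsum
  obtain ⟨K, hK⟩ := exists_nat_ge (∑' l, X l w ^ 2)
  exact hw K fun n => (hsum.sum_le_tsum _ fun l _ => sq_nonneg _).trans hK

lemma ae_eventually_abs_lt (hm : ∀ l, Measurable (X l)) {r : ℕ → ℝ≥0} (hr : ∀ l, 0 < r l)
    (hX : ∀ l, μ.map (X l) = gaussianReal 0 (r l ^ 2)) {D : ℕ → ℝ} (hD : ∀ k, 1 ≤ k → 1 < D k)
    (hs : Summable fun k => 1 / (D k * Real.sqrt (Real.log (D k)))) :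
    ∀ᵐ w ∂μ, ∃ N, ∀ l, N ≤ l → |X l w| < r l * Real.sqrt (2 * Real.log (D l)) := by
  set E : ℕ → Set Ω := fun l => {w | r l * Real.sqrt (2 * Real.log (D l)) ≤ |X l w|}
  have hE (l : ℕ) : μ (E l) = tailProb (D l) := by
    rw [← gaussianReal_abs_ge (r l) (hr l), ← hX l, Measure.map_apply (hm l)
      (show MeasurableSet {x : ℝ | r l * Real.sqrt (2 * Real.log (D l)) ≤ |x|} from
        measurableSet_le measurable_const measurable_norm)]
    rfl
  -- The first Borel–Cantelli lemma is applied to the shifted events, because D 0 is unrestricted.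
  have hsum : ∑' l, μ (E (l + 1)) ≠ ⊤ := by
    simp only [hE]
    refine ne_top_of_le_ne_top ((summable_nat_add_iff 1).2 hs).tsum_ofReal_ne_top
      (ENNReal.tsum_le_tsum fun l => tailProb_le (hD _ (by omega)))
  filter_upwards [ae_eventually_notMem hsum] with w hw
  obtain ⟨N, hN⟩ := eventually_atTop.1 hw
  refine ⟨N + 1, fun l hl => ?_⟩
  obtain ⟨k, rfl⟩ := Nat.exists_eq_succ_of_ne_zero (by omega : l ≠ 0)
  exact not_le.1 (hN k (by omega))

lemma ae_frequently_le_abs (hI : iIndepFun X μ) (hm : ∀ l, Measurable (X l)) {r : ℕ → ℝ≥0}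
    (hr : ∀ l, 0 < r l) (hX : ∀ l, μ.map (X l) = gaussianReal 0 (r l ^ 2)) {D : ℕ → ℝ}
    (hD : ∀ k, 1 ≤ k → 1 < D k)
    (hs : ¬ Summable fun k => 1 / (D k * Real.sqrt (Real.log (D k)))) :
    ∀ᵐ w ∂μ, ¬ ∃ N, ∀ l, N ≤ l → |X l w| < r l * Real.sqrt (2 * Real.log (D l)) := by
  have : IsProbabilityMeasure μ := hI.isProbabilityMeasure
  set E : ℕ → Set Ω := fun l => {w | r l * Real.sqrt (2 * Real.log (D l)) ≤ |X l w|} with hEdef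
  have hEm (l : ℕ) : MeasurableSet (E l) := measurableSet_le measurable_const (hm l).norm
  have hE (l : ℕ) : μ (E l) = tailProb (D l) := by
    rw [← gaussianReal_abs_ge (r l) (hr l), ← hX l, Measure.map_apply (hm l)
      (show MeasurableSet {x : ℝ | r l * Real.sqrt (2 * Real.log (D l)) ≤ |x|} from
        measurableSet_le measurable_const measurable_norm)]
    rfl
  have hind : iIndepSet E μ := by
    rw [iIndepSet_iff_meas_biInter hEm]
    intro s
    refine hI.meas_biInter fun l _ => ?_
    exact ⟨{x | r l * Real.sqrt (2 * Real.log (D l)) ≤ |x|},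
      measurableSet_le measurable_const measurable_norm, rfl⟩
  obtain ⟨c, hc, htail⟩ := exists_le_tailProb
  have htop : ∑' l, μ (E l) = ⊤ := by
    by_contra hne
    have h1 : ∑' l, μ (E (l + 1)) ≠ ⊤ :=
      ne_top_of_le_ne_top hne (ENNReal.tsum_comp_le_tsum_of_injective (add_left_injective 1) _)
    set x : ℕ → ℝ := fun k => 1 / (D (k + 1) * Real.sqrt (Real.log (D (k + 1)))) with hx
    have hx0 (k : ℕ) : 0 ≤ x k := by
      have : 0 < D (k + 1) := by linarith [hD (k + 1) (by omega)]
      positivity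
    have h2 : Summable fun k => c * min 1 (x k) := by
      have h3 : ∑' k, ENNReal.ofReal (c * min 1 (x k)) ≠ ⊤ := by
        refine ne_top_of_le_ne_top h1 (ENNReal.tsum_le_tsum fun k => ?_)
        rw [hE]
        exact htail _ (hD _ (by omega))
      refine (ENNReal.summable_toReal h3).congr fun k => ?_
      rw [ENNReal.toReal_ofReal (mul_nonneg hc.le (le_min zero_le_one (hx0 k)))]
    have h4 : Summable fun k => min 1 (x k) := by
      refine (h2.mul_left (1 / c)).congr fun k => ?_
      field_simp
    have h5 : ∀ᶠ k in atTop, min 1 (x k) < 1 := h4.tendsto_atTop_zero.eventually_lt_const one_pos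
    -- The terms of a summable series are eventually below 1, where the minimum is x itself.
    have h6 : Summable x := by
      refine (summable_congr_cofinite ?_).1 h4
      rw [Nat.cofinite_eq_atTop]
      filter_upwards [h5] with k hk
      exact min_eq_right (le_of_lt (by simpa using hk))
    exact hs ((summable_nat_add_iff 1).1 h6)
  have hlim := measure_limsup_eq_one hEm hind htop
  have hae : ∀ᵐ w ∂μ, w ∈ limsup E atTop := by
    exact (prob_compl_eq_zero_iff (MeasurableSet.measurableSet_limsup hEm)).2 hlim
  filter_upwards [hae] with w hw
  rw [mem_limsup_iff_frequently_mem] at hw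
  rintro ⟨N, hN⟩
  obtain ⟨l, hl, hlE⟩ := (frequently_atTop.1 hw) N
  exact absurd (hN l hl) (not_lt.2 hlE)

end Independent

/-! ### The coordinates of a distribution -/

/-- The coordinates `T(Y_{ℓ 0})` of a distribution. -/
def Distr.coord (T : Distr) (l : ℕ) : ℝ := T (Y l)

lemma Distr.measurable_apply (f : TestFn) : Measurable fun T : Distr => T f :=
  Measurable.of_comap_le (le_iSup (fun f : TestFn =>
    MeasurableSpace.comap (fun T : Distr => T f) inferInstance) f)

lemma Distr.measurable_coord_apply (l : ℕ) : Measurable fun T : Distr => T.coord l :=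
  Distr.measurable_apply (Y l)

lemma Distr.measurable_coord : Measurable Distr.coord :=
  measurable_pi_lambda _ Distr.measurable_coord_apply

/-- Each T(f) is a pointwise limit of linear combinations of coordinates. Hence measures on 𝒮' can
be compared, and maps into it tested, on ℝ^ℕ. -/
lemma Distr.measurableSpace_eq_comap :
    instMeasurableSpaceDistr = MeasurableSpace.comap Distr.coord inferInstance := by
  refine le_antisymm (iSup_le fun f => ?_) Distr.measurable_coord.comap_le
  rw [← measurable_iff_comap_le]
  let : MeasurableSpace Distr := MeasurableSpace.comap Distr.coord inferInstance
  refine measurable_of_tendsto_metrizable (f := fun N (T : Distr) =>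
    ∑ l ∈ Finset.range N, T.coord l * coeff f l) (fun N => ?_)
    (tendsto_pi_nhds.2 fun T => T.tendsto_sum f)
  have h (l : ℕ) : Measurable fun T : Distr => T.coord l :=
    (measurable_pi_apply l).comp (comap_measurable Distr.coord)
  exact Finset.measurable_fun_sum _ fun l _ => (h l).mul_const _

lemma Distr.measurable_of_coord {α : Type*} [MeasurableSpace α] {Φ : α → Distr}
    (h : Measurable fun a => (Φ a).coord) : Measurable Φ := by
  rw [measurable_iff_comap_le, Distr.measurableSpace_eq_comap, MeasurableSpace.comap_comp]
  exact h.comap_le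

lemma Distr.measure_ext {μ μ' : Measure Distr} (h : μ.map Distr.coord = μ'.map Distr.coord) :
    μ = μ' := by
  ext s hs
  change MeasurableSet[instMeasurableSpaceDistr] s at hs
  rw [Distr.measurableSpace_eq_comap] at hs
  obtain ⟨t, ht, rfl⟩ := hs
  rw [← Measure.map_apply Distr.measurable_coord ht, h, Measure.map_apply Distr.measurable_coord ht]

/-! ### Gaussian measures with diagonal covariance -/

section Gaussian

variable {C : TestFn →ₗ[ℝ] TestFn} {v : ℕ → ℝ≥0}

lemma hasSum_pairing_diag (hC : ∀ P l, coeff (C P) l = v l * coeff P l) (f g : TestFn) :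
    HasSum (fun l => v l * (coeff f l * coeff g l)) (pairing f (C g)) := by
  refine (hasSum_coeff_mul_coeff f (C g)).congr_fun fun l => ?_
  rw [hC]
  ring

lemma pairing_diag_nonneg (hC : ∀ P l, coeff (C P) l = v l * coeff P l) (f : TestFn) :
    0 ≤ pairing f (C f) :=
  (hasSum_pairing_diag hC f f).nonneg fun l => mul_nonneg (v l).2 (mul_self_nonneg _)

lemma coeff_sum_smul_Y (s : Finset ℕ) (t : ℕ → ℝ) (l : ℕ) :
    coeff (∑ i ∈ s, t i • Y i) l = if l ∈ s then t l else 0 := by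
  rw [coeff_eq, map_sum]
  simp only [← coeff_eq, coeff_smul, coeff_Y]
  simp

lemma pairing_diag_sum (hC : ∀ P l, coeff (C P) l = v l * coeff P l) (s : Finset ℕ) (t : ℕ → ℝ) :
    pairing (∑ i ∈ s, t i • Y i) (C (∑ i ∈ s, t i • Y i)) = ∑ i ∈ s, v i * t i ^ 2 := by
  refine (hasSum_pairing_diag hC _ _).unique ?_
  have h := hasSum_sum_of_ne_finset_zero (L := .unconditional ℕ) (f := fun l => v l * (coeff (∑ i ∈ s, t i • Y i) l *
    coeff (∑ i ∈ s, t i • Y i) l)) (s := s) fun l hl => by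
      rw [coeff_sum_smul_Y, if_neg hl, mul_zero, mul_zero]
  convert h using 1
  refine Finset.sum_congr rfl fun l hl => ?_
  rw [coeff_sum_smul_Y, if_pos hl]
  ring

/-- Testing the generating function on t f, for all real t, gives the full characteristic function
of T(f). -/
lemma map_apply_eq_gaussianReal (hC : ∀ P l, coeff (C P) l = v l * coeff P l) {μ : Measure Distr}
    (hμ : IsGaussianWithCov C μ) (f : TestFn) :
    μ.map (fun T : Distr => T f) = gaussianReal 0 (pairing f (C f)).toNNReal := by
  have := hμ.1
  have hm := Distr.measurable_apply f
  have : IsProbabilityMeasure (μ.map (fun T : Distr => T f)) :=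
    Measure.isProbabilityMeasure_map hm.aemeasurable
  refine Measure.ext_of_charFun (funext fun t => ?_)
  rw [charFun_gaussianReal, charFun_apply_real, integral_map hm.aemeasurable
    (by fun_prop)]
  have h := hμ.2 (t • f)
  have e : pairing (t • f) (C (t • f)) = t ^ 2 * pairing f (C f) := by
    refine (hasSum_pairing_diag hC _ _).unique ?_
    refine ((hasSum_pairing_diag hC f f).mul_left (t ^ 2)).congr_fun fun l => ?_
    rw [coeff_smul]
    ring
  rw [e] at h
  rw [Real.coe_toNNReal _ (pairing_diag_nonneg hC f)]
  convert h using 1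
  · refine integral_congr_ae (ae_of_all _ fun T => ?_)
    simp only [map_smul, smul_eq_mul]
    push_cast
    ring_nf
  · push_cast
    ring_nf

lemma map_coord_eq_gaussianReal (hC : ∀ P l, coeff (C P) l = v l * coeff P l) {μ : Measure Distr}
    (hμ : IsGaussianWithCov C μ) (l : ℕ) :
    μ.map (fun T : Distr => T.coord l) = gaussianReal 0 (v l) := by
  have h := pairing_diag_sum hC {l} 1
  simp only [Finset.sum_singleton, Pi.one_apply, one_smul, one_pow, mul_one] at h
  have h2 := map_apply_eq_gaussianReal hC hμ (Y l)
  rwa [h, Real.toNNReal_coe] at h2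

/-- On a finite combination ∑ t_i Y_i the diagonal quadratic form is a sum, so the joint
characteristic function is a product. -/
lemma iIndepFun_coord (hC : ∀ P l, coeff (C P) l = v l * coeff P l) {μ : Measure Distr}
    (hμ : IsGaussianWithCov C μ) : iIndepFun (fun l (T : Distr) => T.coord l) μ := by
  have := hμ.1
  rw [iIndepFun_iff_finset]
  intro s
  refine (iIndepFun_iff_charFun_pi
    fun i : s => (Distr.measurable_coord_apply i).aemeasurable).2 fun t => ?_
  have hm : Measurable fun T : Distr =>
      WithLp.toLp 2 fun i : s => T.coord i :=
    (WithLp.measurable_toLp 2 _).comp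
      (measurable_pi_lambda _ fun i => Distr.measurable_coord_apply i)
  rw [charFun_apply, integral_map hm.aemeasurable (by fun_prop)]
  set t' : ℕ → ℝ := fun l => if h : l ∈ s then t ⟨l, h⟩ else 0 with ht'
  have et (i : s) : t i = t' i := by simp [ht']
  have h := hμ.2 (∑ i ∈ s, t' i • Y i)
  rw [pairing_diag_sum hC] at h
  have hr (i : s) : charFun (μ.map (fun T : Distr => T.coord i)) (t i)
      = Complex.exp (-((v i * t' i ^ 2 / 2 : ℝ) : ℂ)) := by
    rw [map_coord_eq_gaussianReal hC hμ, charFun_gaussianReal, et]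
    push_cast
    ring_nf
  simp only [hr]
  rw [Finset.prod_coe_sort s fun i => Complex.exp (-((v i * t' i ^ 2 / 2 : ℝ) : ℂ)),
    ← Complex.exp_sum]
  convert h using 1
  · refine integral_congr_ae (ae_of_all _ fun T => ?_)
    simp only [PiLp.inner_apply, map_sum, map_smul, smul_eq_mul]
    rw [mul_comm, ← Finset.sum_coe_sort s]
    simp only [et]
    rfl
  · rw [Finset.sum_div]
    push_cast
    rw [Finset.sum_neg_distrib]

lemma map_coord_eq_infinitePi (hC : ∀ P l, coeff (C P) l = v l * coeff P l) {μ : Measure Distr}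
    (hμ : IsGaussianWithCov C μ) :
    μ.map Distr.coord = Measure.infinitePi fun l => gaussianReal 0 (v l) := by
  have := hμ.1
  have h := (iIndepFun_coord hC hμ).map_fun_eq_infinitePi_map Distr.measurable_coord_apply
  simp only [map_coord_eq_gaussianReal hC hμ] at h
  exact h

lemma IsGaussianWithCov.unique (hC : ∀ P l, coeff (C P) l = v l * coeff P l) {μ μ' : Measure Distr}
    (hμ : IsGaussianWithCov C μ) (hμ' : IsGaussianWithCov C μ') : μ' = μ :=
  Distr.measure_ext (by rw [map_coord_eq_infinitePi hC hμ, map_coord_eq_infinitePi hC hμ'])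

lemma map_coord_fin_eq_pi (hC : ∀ P l, coeff (C P) l = v l * coeff P l) {μ : Measure Distr}
    (hμ : IsGaussianWithCov C μ) (n : ℕ) :
    μ.map (fun (T : Distr) (l : Fin (n + 1)) => T (Y l))
      = Measure.pi fun l : Fin (n + 1) => gaussianReal 0 (v l) := by
  have := hμ.1
  have h := ((iIndepFun_coord hC hμ).precomp (g := fun l : Fin (n + 1) => (l : ℕ))
    Fin.val_injective)
  have h2 := (iIndepFun_iff_map_fun_eq_pi_map
    fun i : Fin (n + 1) => (Distr.measurable_coord_apply i).aemeasurable).1 h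
  simp only [map_coord_eq_gaussianReal hC hμ] at h2
  exact h2

lemma memLp_apply (hC : ∀ P l, coeff (C P) l = v l * coeff P l) {μ : Measure Distr}
    (hμ : IsGaussianWithCov C μ) (f : TestFn) : MemLp (fun T : Distr => T f) 2 μ := by
  have h : MemLp id 2 (μ.map fun T : Distr => T f) := by
    rw [map_apply_eq_gaussianReal hC hμ]
    exact memLp_id_gaussianReal 2
  exact (memLp_map_measure_iff (by fun_prop) (Distr.measurable_apply f).aemeasurable).1 h

lemma integral_apply_eq_zero (hC : ∀ P l, coeff (C P) l = v l * coeff P l) {μ : Measure Distr}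
    (hμ : IsGaussianWithCov C μ) (f : TestFn) : ∫ T : Distr, T f ∂μ = 0 := by
  have h := integral_map (μ := μ) (Distr.measurable_apply f).aemeasurable
    (f := fun x : ℝ => x) (by fun_prop)
  rw [← h, map_apply_eq_gaussianReal hC hμ, integral_id_gaussianReal]

lemma integral_apply_sq (hC : ∀ P l, coeff (C P) l = v l * coeff P l) {μ : Measure Distr}
    (hμ : IsGaussianWithCov C μ) (f : TestFn) : ∫ T : Distr, T f ^ 2 ∂μ = pairing f (C f) := by
  have h := integral_map (μ := μ) (Distr.measurable_apply f).aemeasurable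
    (f := fun x : ℝ => x ^ 2) (by fun_prop)
  have h3 := variance_id_gaussianReal (μ := 0) (v := (pairing f (C f)).toNNReal)
  rw [variance_of_integral_eq_zero aemeasurable_id (by simp),
    Real.coe_toNNReal _ (pairing_diag_nonneg hC f)] at h3
  rw [← h, map_apply_eq_gaussianReal hC hμ]
  exact h3

/-- Polarization of `integral_apply_sq`. -/
lemma integral_apply_mul (hC : ∀ P l, coeff (C P) l = v l * coeff P l) {μ : Measure Distr}
    (hμ : IsGaussianWithCov C μ) (f g : TestFn) :
    ∫ T : Distr, T f * T g ∂μ = pairing f (C g) := by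
  have hf := memLp_apply hC hμ f
  have hg := memLp_apply hC hμ g
  have hfg : Integrable (fun T : Distr => T f * T g) μ := hf.integrable_mul hg
  have h1 := integral_apply_sq hC hμ (f + g)
  have e (T : Distr) : T (f + g) ^ 2 = T f ^ 2 + 2 * (T f * T g) + T g ^ 2 := by
    rw [map_add]
    ring
  simp only [e] at h1
  have hfg2 : Integrable (fun T : Distr => T f ^ 2 + 2 * (T f * T g)) μ :=
    hf.integrable_sq.add (hfg.const_mul 2)
  rw [integral_add hfg2 hg.integrable_sq, integral_add hf.integrable_sq (hfg.const_mul 2), integral_const_mul,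
    integral_apply_sq hC hμ, integral_apply_sq hC hμ] at h1
  have h2 : pairing (f + g) (C (f + g))
      = pairing f (C f) + 2 * pairing f (C g) + pairing g (C g) := by
    refine (hasSum_pairing_diag hC _ _).unique ?_
    refine (((hasSum_pairing_diag hC f f).add ((hasSum_pairing_diag hC f g).mul_left 2)).add
      (hasSum_pairing_diag hC g g)).congr_fun fun l => ?_
    rw [coeff_add]
    ring
  linarith

end Gaussian

/-! ### Existence of the Gaussian measure -/

/-- The sequences from which a distribution will be built. -/
def goodSeq : Set (ℕ → ℝ) := {g | Summable fun l : ℕ => ((l : ℝ) + 1)⁻¹ ^ 2 * g l ^ 2}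

/-- For nonnegative terms summability is finiteness of the extended-valued sum, which is a
measurable function. -/
lemma measurableSet_summable {α : Type*} [MeasurableSpace α] {u : ℕ → α → ℝ}
    (hu : ∀ l, Measurable (u l)) (h0 : ∀ l a, 0 ≤ u l a) :
    MeasurableSet {a | Summable fun l => u l a} := by
  have e : {a | Summable fun l => u l a} = {a | ∑' l, ENNReal.ofReal (u l a) < ⊤} := by
    ext a
    rw [mem_ofPred_eq, mem_ofPred_eq]
    refine ⟨fun h => h.tsum_ofReal_lt_top, fun h => ?_⟩
    refine (ENNReal.summable_toReal h.ne).congr fun l => ?_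
    rw [ENNReal.toReal_ofReal (h0 l a)]
  rw [e]
  exact measurableSet_lt (Measurable.tsum fun l => (hu l).ennreal_ofReal) measurable_const

lemma measurableSet_goodSeq : MeasurableSet goodSeq :=
  measurableSet_summable (u := fun l (g : ℕ → ℝ) => ((l : ℝ) + 1)⁻¹ ^ 2 * g l ^ 2)
    (fun l => by fun_prop) fun l a => by positivity

lemma polyBounded_of_mem_goodSeq {g : ℕ → ℝ} (hg : g ∈ goodSeq) : PolyBounded g := by
  have hg' : Summable fun l : ℕ => ((l : ℝ) + 1)⁻¹ ^ 2 * g l ^ 2 := hg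
  refine ⟨Real.sqrt (∑' l : ℕ, ((l : ℝ) + 1)⁻¹ ^ 2 * g l ^ 2), 1, fun l => ?_⟩
  have h := hg'.le_tsum l fun j _ => by positivity
  rw [← mul_pow] at h
  have h2 := Real.abs_le_sqrt h
  rw [abs_mul, abs_of_pos (by positivity), inv_mul_le_iff₀ (by positivity)] at h2
  linarith

/-- The distribution with the coordinates `g`, if `g` is good. -/
def distrOfSeq (g : ℕ → ℝ) : Distr :=
  open Classical in
  if hg : g ∈ goodSeq then (exists_distr (polyBounded_of_mem_goodSeq hg)).choose else 0

lemma hasSum_distrOfSeq {g : ℕ → ℝ} (hg : g ∈ goodSeq) (f : TestFn) :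
    HasSum (fun l => g l * coeff f l) (distrOfSeq g f) := by
  rw [distrOfSeq, dif_pos hg]
  exact (exists_distr (polyBounded_of_mem_goodSeq hg)).choose_spec f

lemma coord_distrOfSeq {g : ℕ → ℝ} (hg : g ∈ goodSeq) : (distrOfSeq g).coord = g := by
  funext l
  refine (hasSum_distrOfSeq hg (Y l)).unique ?_
  simp only [coeff_Y, mul_ite, mul_one, mul_zero]
  refine (hasSum_ite_eq l (g l)).congr_fun fun j => ?_
  split_ifs with h
  · rw [h]
  · rfl

/-- The choice in the definition is harmless: in coordinates the map is the identity on `goodSeq`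
and 0 elsewhere. -/
lemma measurable_distrOfSeq : Measurable distrOfSeq := by
  refine Distr.measurable_of_coord ?_
  have e : (fun g => (distrOfSeq g).coord) = goodSeq.indicator id := by
    funext g
    by_cases hg : g ∈ goodSeq
    · rw [coord_distrOfSeq hg, indicator_of_mem hg, id]
    · rw [indicator_of_notMem hg, distrOfSeq, dif_neg hg]
      rfl
  rw [e]
  exact measurable_id.indicator measurableSet_goodSeq

lemma ae_mem_goodSeq {v : ℕ → ℝ≥0} {A : ℝ} (hv : ∀ l, (v l : ℝ) ≤ A) :
    ∀ᵐ g ∂(Measure.infinitePi fun l => gaussianReal 0 (v l)), g ∈ goodSeq := by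
  have h1 : Summable fun l : ℕ => ((l : ℝ) + 1)⁻¹ ^ 2 := by
    have := (summable_nat_add_iff 1).2 (Real.summable_nat_pow_inv.2 one_lt_two)
    simpa using this
  have h := ae_summable_mul_sq (X := fun l (g : ℕ → ℝ) => g l) (v := v)
    (fun l => measurable_pi_apply l) (fun l => Measure.infinitePi_map_eval _ l)
    (c := fun l => ((l : ℝ) + 1)⁻¹ ^ 2) (fun l => by positivity)
    ((h1.mul_right A).of_nonneg_of_le (fun l => by positivity)
      fun l => mul_le_mul_of_nonneg_left (hv l) (by positivity))
  filter_upwards [h] with g hg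
  exact hg

lemma integral_exp_sum_infinitePi (v : ℕ → ℝ≥0) (c : ℕ → ℝ) (N : ℕ) :
    ∫ g : ℕ → ℝ, Complex.exp (Complex.I * ((∑ l ∈ Finset.range N, g l * c l : ℝ) : ℂ))
        ∂(Measure.infinitePi fun l => gaussianReal 0 (v l))
      = Complex.exp (-((∑ l ∈ Finset.range N, v l * (c l * c l) : ℝ) / 2 : ℂ)) := by
  set P := Measure.infinitePi fun l => gaussianReal 0 (v l) with hP
  have hI : iIndepFun (fun l (g : ℕ → ℝ) => g l * c l) P :=
    iIndepFun_infinitePi (X := fun l x => x * c l) fun l => by fun_prop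
  have h := hI.restrict (Finset.range N) |>.charFun_map_fun_finsetSum_eq_prod
    (fun l _ => Measurable.aemeasurable (by fun_prop))
  have h1 := congrFun h 1
  rw [charFun_apply_real, integral_map (Measurable.aemeasurable (by fun_prop)) (by fun_prop), Finset.prod_apply] at h1
  have hl (l : ℕ) : charFun (P.map fun g : ℕ → ℝ => g l * c l) 1
      = Complex.exp (-((v l * (c l * c l) : ℝ) / 2 : ℂ)) := by
    have e : charFun (P.map fun g : ℕ → ℝ => g l * c l) 1
        = charFun (P.map fun g : ℕ → ℝ => g l) (c l) := by
      rw [charFun_apply_real, charFun_apply_real, integral_map (Measurable.aemeasurable (by fun_prop)) (by fun_prop),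
        integral_map (Measurable.aemeasurable (by fun_prop)) (by fun_prop)]
      refine integral_congr_ae (ae_of_all _ fun g => ?_)
      simp only
      push_cast
      ring_nf
    rw [e, Measure.infinitePi_map_eval, charFun_gaussianReal]
    push_cast
    ring_nf
  simp only [hl] at h1
  rw [← Complex.exp_sum] at h1
  convert h1 using 1
  · refine integral_congr_ae (ae_of_all _ fun g => ?_)
    simp only
    push_cast
    ring_nf
  · push_cast
    rw [Finset.sum_neg_distrib, Finset.sum_div]

/-- The product measure is carried to 𝒮' by `distrOfSeq`. Its characteristic functional is computed
for partial sums of T(f), which converge almost surely, and passes to the limit by dominated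
convergence. -/
lemma exists_isGaussianWithCov {C : TestFn →ₗ[ℝ] TestFn} {v : ℕ → ℝ≥0}
    (hC : ∀ P l, coeff (C P) l = v l * coeff P l) {A : ℝ} (hv : ∀ l, (v l : ℝ) ≤ A) :
    ∃ μ : Measure Distr, IsGaussianWithCov C μ := by
  set P := Measure.infinitePi fun l => gaussianReal 0 (v l) with hP
  refine ⟨P.map distrOfSeq, Measure.isProbabilityMeasure_map measurable_distrOfSeq.aemeasurable,
    fun f => ?_⟩
  have hm : Measurable fun T : Distr => Complex.exp (Complex.I * (T f : ℂ)) := by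
    have h : Measurable fun x : ℝ => Complex.exp (Complex.I * (x : ℂ)) := by fun_prop
    exact h.comp (Distr.measurable_apply f)
  rw [integral_map measurable_distrOfSeq.aemeasurable hm.aestronglyMeasurable]
  have h1 : Tendsto (fun N => ∫ g : ℕ → ℝ,
      Complex.exp (Complex.I * ((∑ l ∈ Finset.range N, g l * coeff f l : ℝ) : ℂ)) ∂P) atTop
      (𝓝 (∫ g, Complex.exp (Complex.I * (distrOfSeq g f : ℂ)) ∂P)) := by
    refine tendsto_integral_of_dominated_convergence (fun _ => 1) (fun N => ?_)
      (integrable_const _) (fun N => ae_of_all _ fun g => ?_) ?_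
    · exact Measurable.aestronglyMeasurable (by fun_prop)
    · rw [mul_comm, Complex.norm_exp_ofReal_mul_I]
    · filter_upwards [ae_mem_goodSeq hv] with g hg
      have h := (hasSum_distrOfSeq hg f).tendsto_sum_nat
      have hc : Continuous fun x : ℝ => Complex.exp (Complex.I * (x : ℂ)) := by fun_prop
      exact (hc.tendsto _).comp h
  refine tendsto_nhds_unique h1 ?_
  simp only [hP, integral_exp_sum_infinitePi]
  have h2 := (hasSum_pairing_diag hC f f).tendsto_sum_nat
  have hc : Continuous fun x : ℝ => Complex.exp (-((x : ℂ) / 2)) := by fun_prop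
  have h3 := (hc.tendsto _).comp h2
  push_cast
  refine h3.congr fun N => ?_
  simp only [Function.comp_apply]
  push_cast
  rfl

/-! ### Spherical Fourier coefficients of symmetric functions -/

lemma sphHarmNat_sph (l k : ℕ) (θ σ : ℝ) :
    sphHarmNat l k (sph θ σ) = sphHarmNat l k (sph θ 0) * Complex.exp (k * (Complex.I * σ)) := by
  have h : ((Real.sin θ * Real.cos σ : ℝ) : ℂ) + ((Real.sin θ * Real.sin σ : ℝ) : ℂ) * Complex.I
      = ((Real.sin θ : ℝ) : ℂ) * Complex.exp (Complex.I * σ) := by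
    rw [mul_comm Complex.I, Complex.exp_mul_I]
    push_cast
    ring
  simp only [sphHarmNat, sph_zero, sph_one, sph_two, h, Real.cos_zero, Real.sin_zero, mul_one,
    mul_zero, Complex.ofReal_zero, zero_mul, add_zero, mul_pow, Complex.exp_nat_mul]
  ring

lemma sphHarm_sph (l : ℕ) (m : ℤ) (θ σ : ℝ) :
    sphHarm l m (sph θ σ) = sphHarm l m (sph θ 0) * Complex.exp (m * (Complex.I * σ)) := by
  unfold sphHarm
  split_ifs with h
  · rw [sphHarmNat_sph]
    congr 3
    exact_mod_cast Int.toNat_of_nonneg h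
  · rw [sphHarmNat_sph, map_mul, ← Complex.exp_conj, mul_assoc]
    congr 3
    have h2 : (m : ℂ) = -(m.natAbs : ℂ) := by
      have : m = -(m.natAbs : ℤ) := by omega
      exact_mod_cast this
    rw [h2]
    simp

lemma sphHarm_zero (l : ℕ) (s : S2) : sphHarm l 0 s = ((Y l).1 s : ℂ) := by
  have h : ((l.factorial : ℝ) / (l.factorial : ℝ)) = 1 := div_self (by positivity)
  rw [Y_apply, normY]
  simp [sphHarm, sphHarmNat, h]

lemma integral_exp_int_mul (m : ℤ) (hm : m ≠ 0) :
    ∫ σ in (0 : ℝ)..(2 * Real.pi), conj (Complex.exp (m * (Complex.I * σ))) = 0 := by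
  have hc : -(m * Complex.I) ≠ 0 := neg_ne_zero.2 (mul_ne_zero (by exact_mod_cast hm) Complex.I_ne_zero)
  have e (σ : ℝ) : conj (Complex.exp (m * (Complex.I * σ)))
      = Complex.exp (-(m * Complex.I) * σ) := by
    rw [← Complex.exp_conj]
    congr 1
    simp
    ring
  simp only [e]
  rw [integral_exp_mul_complex hc]
  have h1 : Complex.exp (-(m * Complex.I) * ((2 * Real.pi : ℝ) : ℂ)) = 1 := by
    rw [Complex.exp_eq_one_iff]
    refine ⟨-m, ?_⟩
    push_cast
    ring
  rw [h1]
  simp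

lemma TestFn.coeFn_toL2 (f : TestFn) : f.toL2 =ᵐ[area] fun s => f.1 s :=
  ContinuousMap.coeFn_toLp (𝕜 := ℝ) area (⟨f.1, f.1.contMDiff.continuous⟩ : C(S2, ℝ))

lemma coeffLM_toL2_zero (f : TestFn) (l : ℕ) : coeffLM f.toL2 l 0 = coeff f l := by
  rw [coeff, pairing, ← integral_complex_ofReal, coeffLM]
  refine integral_congr_ae ?_
  filter_upwards [f.coeFn_toL2] with s hs
  rw [hs, sphHarm_zero, Complex.conj_ofReal]
  push_cast
  ring

/-- The azimuthal factor e^{-imσ} integrates to zero. So the Sobolev condition on a test function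
involves m = 0 only. -/
lemma coeffLM_toL2_of_ne (f : TestFn) (l : ℕ) {m : ℤ} (hm : m ≠ 0) : coeffLM f.toL2 l m = 0 := by
  have h1 : coeffLM f.toL2 l m = ∫ s, (f.1 s : ℂ) * conj (sphHarm l m s) ∂area := by
    refine integral_congr_ae ?_
    filter_upwards [f.coeFn_toL2] with s hs
    rw [hs]
  have hc : Continuous fun s => (f.1 s : ℂ) * conj (sphHarm l m s) :=
    (Complex.continuous_ofReal.comp f.continuous).mul
      (Complex.continuous_conj.comp (continuous_sphHarm l m))
  rw [h1, integral_area hc]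
  refine (intervalIntegral.integral_congr (g := fun _ => 0) fun θ _ => ?_).trans (by simp)
  have e (σ : ℝ) : Real.sin θ • ((f.1 (sph θ σ) : ℂ) * conj (sphHarm l m (sph θ σ)))
      = ((Real.sin θ : ℂ) * f.profile θ * conj (sphHarm l m (sph θ 0))) *
        conj (Complex.exp (m * (Complex.I * σ))) := by
    rw [f.apply_sph, sphHarm_sph, map_mul, Complex.real_smul]
    ring
  simp only [e]
  rw [intervalIntegral.integral_const_mul, integral_exp_int_mul m hm, mul_zero]

lemma sum_norm_coeffLM_toL2 (f : TestFn) (l : ℕ) :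
    ∑ m ∈ Finset.Icc (-(l : ℤ)) (l : ℤ), ‖coeffLM f.toL2 l m‖ ^ 2 = coeff f l ^ 2 := by
  rw [Finset.sum_eq_single 0]
  · rw [coeffLM_toL2_zero, Complex.norm_real, Real.norm_eq_abs, sq_abs]
  · intro m _ hm
    rw [coeffLM_toL2_of_ne f l hm]
    simp
  · intro h
    simp at h

lemma summable_rpow_mul_coeff_sq (ε : ℝ) (f : TestFn) :
    Summable fun l : ℕ => ((l : ℝ) + 1 / 2) ^ (2 * ε) * coeff f l ^ 2 := by
  obtain ⟨k, hk⟩ := exists_nat_ge |2 * ε|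
  have hb : PolyBounded fun l => ((l : ℝ) + 1 / 2) ^ (2 * ε) := by
    refine ⟨2 ^ k, k, fun l => ?_⟩
    have h0 : (0 : ℝ) < (l : ℝ) + 1 / 2 := by positivity
    rw [abs_of_nonneg (Real.rpow_nonneg h0.le _), ← mul_pow]
    have h2 : (1 : ℝ) ≤ 2 * ((l : ℝ) + 1) := by linarith [(Nat.cast_nonneg l : (0 : ℝ) ≤ l)]
    have h3 : ((l : ℝ) + 1 / 2) ^ (2 * ε) ≤ (2 * ((l : ℝ) + 1)) ^ |2 * ε| := by
      rcases le_total 0 (2 * ε) with h | h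
      · rw [abs_of_nonneg h]
        exact Real.rpow_le_rpow h0.le (by linarith) h
      · rw [abs_of_nonpos h, ← neg_neg (2 * ε), Real.rpow_neg h0.le, ← Real.inv_rpow h0.le, neg_neg]
        refine Real.rpow_le_rpow (by positivity) ?_ (by linarith)
        rw [inv_le_comm₀ h0 (by linarith)]
        refine (inv_le_of_inv_le₀ (by positivity) ?_)
        rw [← one_div, div_le_iff₀ h0]
        nlinarith [(Nat.cast_nonneg l : (0 : ℝ) ≤ l)]
    refine h3.trans ?_
    rw [← Real.rpow_natCast]
    exact Real.rpow_le_rpow_of_exponent_le h2 hk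
  have h := ((rapidDecay_coeff f).mul hb).summable 0
  obtain ⟨B, hB⟩ := rapidDecay_coeff f 0
  refine Summable.of_norm_bounded (h.mul_left B) fun l => ?_
  have h1 := hB l
  rw [pow_zero, one_mul] at h1
  rw [pow_zero, one_mul, pow_two, ← mul_assoc, norm_mul, mul_comm, Real.norm_eq_abs, Real.norm_eq_abs]
  exact mul_le_mul_of_nonneg_right h1 (abs_nonneg _)

lemma toL2_mem_symSobolev (ε : ℝ) (f : TestFn) : f.toL2 ∈ symSobolev ε := by
  refine ⟨?_, fun s => f.1 s, fun a s => f.apply_rot a s, f.coeFn_toL2⟩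
  simp only [MemSobolev, sum_norm_coeffLM_toL2]
  exact summable_rpow_mul_coeff_sq ε f

lemma sobolevNorm_toL2 (ε : ℝ) (f : TestFn) : sobolevNorm ε f.toL2
    = Real.sqrt (∑' l : ℕ, ((l : ℝ) + 1 / 2) ^ (2 * ε) * coeff f l ^ 2) := by
  simp only [sobolevNorm, coeffLM_toL2_zero, Complex.norm_real, Real.norm_eq_abs, sq_abs]

/-! ### The dual of the Sobolev space -/

lemma summable_mul_of_summable_sq {a b : ℕ → ℝ} (ha : Summable fun l => a l ^ 2)
    (hb : Summable fun l => b l ^ 2) : (Summable fun l => a l * b l) ∧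
    |∑' l, a l * b l| ≤ Real.sqrt (∑' l, a l ^ 2) * Real.sqrt (∑' l, b l ^ 2) := by
  have hs : Summable fun l => a l * b l := by
    refine Summable.of_norm_bounded (ha.add hb) fun l => ?_
    rw [Real.norm_eq_abs, abs_le]
    constructor <;> nlinarith [sq_nonneg (a l + b l), sq_nonneg (a l - b l)]
  refine ⟨hs, le_of_tendsto' hs.hasSum.tendsto_sum_nat.abs fun N => ?_⟩
  rw [← Real.sqrt_mul (tsum_nonneg fun l => sq_nonneg _)]
  refine Real.abs_le_sqrt ((Finset.sum_mul_sq_le_sq_mul_sq _ _ _).trans ?_)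
  exact mul_le_mul (ha.sum_le_tsum _ fun l _ => sq_nonneg _) (hb.sum_le_tsum _ fun l _ => sq_nonneg _)
    (Finset.sum_nonneg fun l _ => sq_nonneg _) (tsum_nonneg fun l => sq_nonneg _)

/-- Duality with extremal test functions: f below is chosen so that T(f) = S and ‖f‖ = √S, for S the
N-th partial sum; boundedness then gives S ≤ K² uniformly in N. -/
lemma summable_of_mem_sobolevDual {ε : ℝ} {T : Distr} (hT : T ∈ sobolevDual ε) :
    Summable fun l : ℕ => ((l : ℝ) + 1 / 2) ^ (-(2 * ε)) * T.coord l ^ 2 := by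
  obtain ⟨L, ⟨K, hK⟩, hL⟩ := hT
  have hw (l : ℕ) : 0 < (l : ℝ) + 1 / 2 := by positivity
  refine summable_of_sum_range_le (c := K ^ 2)
    (fun l => mul_nonneg (Real.rpow_nonneg (hw l).le _) (sq_nonneg _)) fun N => ?_
  set x : ℕ → ℝ := fun l => ((l : ℝ) + 1 / 2) ^ (-(2 * ε)) * T.coord l with hx
  set f : TestFn := ∑ l ∈ Finset.range N, x l • Y l with hf
  set S := ∑ l ∈ Finset.range N, ((l : ℝ) + 1 / 2) ^ (-(2 * ε)) * T.coord l ^ 2 with hS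
  have hS0 : 0 ≤ S :=
    Finset.sum_nonneg fun l _ => mul_nonneg (Real.rpow_nonneg (hw l).le _) (sq_nonneg _)
  have h1 : T f = S := by
    rw [hf, map_sum]
    refine Finset.sum_congr rfl fun l _ => ?_
    rw [map_smul, smul_eq_mul]
    change x l * T.coord l = _
    simp only [hx]
    ring
  have h2 : sobolevNorm ε f.toL2 = Real.sqrt S := by
    rw [sobolevNorm_toL2, tsum_eq_sum (s := Finset.range N)]
    · congr 1
      refine Finset.sum_congr rfl fun l hl => ?_
      have h : ((l : ℝ) + 1 / 2) ^ (2 * ε) * ((l : ℝ) + 1 / 2) ^ (-(2 * ε)) = 1 := by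
        rw [← Real.rpow_add (hw l), add_neg_cancel, Real.rpow_zero]
      rw [coeff_sum_smul_Y, if_pos hl]
      simp only [hx]
      linear_combination (((l : ℝ) + 1 / 2) ^ (-(2 * ε)) * T.coord l ^ 2) * h
    · intro l hl
      rw [coeff_sum_smul_Y, if_neg hl]
      simp
  obtain ⟨hfs, hLf⟩ := hL f
  have h3 := hK ⟨f.toL2, hfs⟩
  rw [hLf, h1, h2, abs_of_nonneg hS0] at h3
  have h4 := Real.sq_sqrt hS0
  -- The case S = 0 is separate because division by √S is needed and K carries no sign condition.
  rcases (Real.sqrt_nonneg S).eq_or_lt with h | h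
  · rw [← h4, ← h]
    nlinarith [sq_nonneg K]
  · have h5 : Real.sqrt S ≤ K := by
      refine le_of_mul_le_mul_right ?_ h
      nlinarith
    rw [← h4]
    exact pow_le_pow_left₀ h.le h5 2

/-- The functional ∑ T_ℓ f_ℓ converges and is bounded by Cauchy–Schwarz with weights (ℓ+1/2)^(∓ε);
on 𝒮 it agrees with T by the convergence of the expansion. -/
lemma mem_sobolevDual_of_summable {ε : ℝ} {T : Distr}
    (hT : Summable fun l : ℕ => ((l : ℝ) + 1 / 2) ^ (-(2 * ε)) * T.coord l ^ 2) :
    T ∈ sobolevDual ε := by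
  have hw (l : ℕ) : 0 < (l : ℝ) + 1 / 2 := by positivity
  set a : ℕ → ℝ := fun l => ((l : ℝ) + 1 / 2) ^ (-ε) * T.coord l with ha
  -- Taking the real part gives a real functional directly, with no need to show that these
  -- coefficients are real.
  set b : L2S2 → ℕ → ℝ := fun f l => ((l : ℝ) + 1 / 2) ^ ε * (coeffLM f l 0).re with hb
  have hab (f : L2S2) (l : ℕ) : a l * b f l = T.coord l * (coeffLM f l 0).re := by
    simp only [ha, hb]
    rw [mul_mul_mul_comm, ← Real.rpow_add (hw l), neg_add_cancel, Real.rpow_zero]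
    ring
  have ha2 (l : ℕ) : a l ^ 2 = ((l : ℝ) + 1 / 2) ^ (-(2 * ε)) * T.coord l ^ 2 := by
    simp only [ha]
    rw [mul_pow, ← Real.rpow_natCast, ← Real.rpow_mul (hw l).le]
    congr 2
    push_cast
    ring
  have hb2 (f : L2S2) (l : ℕ) : b f l ^ 2 ≤ ((l : ℝ) + 1 / 2) ^ (2 * ε) * ‖coeffLM f l 0‖ ^ 2 := by
    simp only [hb]
    rw [mul_pow, ← Real.rpow_natCast, ← Real.rpow_mul (hw l).le, mul_comm ε]
    refine mul_le_mul_of_nonneg_left ?_ (Real.rpow_nonneg (hw l).le _)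
    rw [← sq_abs]
    exact pow_le_pow_left₀ (abs_nonneg _) (Complex.abs_re_le_norm _) 2
  have hsn (f : symSobolev ε) :
      Summable fun l : ℕ => ((l : ℝ) + 1 / 2) ^ (2 * ε) * ‖coeffLM f.1 l 0‖ ^ 2 := by
    have hf : Summable _ := f.2.1
    refine hf.of_nonneg_of_le (fun l => mul_nonneg (Real.rpow_nonneg (hw l).le _) (sq_nonneg _))
      fun l => mul_le_mul_of_nonneg_left ?_ (Real.rpow_nonneg (hw l).le _)
    exact Finset.single_le_sum (f := fun m => ‖coeffLM f.1 l m‖ ^ 2) (fun m _ => sq_nonneg _)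
      (Finset.mem_Icc.2 ⟨by omega, by omega⟩)
  have hsb (f : symSobolev ε) : Summable fun l => b f.1 l ^ 2 :=
    (hsn f).of_nonneg_of_le (fun l => sq_nonneg _) (hb2 f.1)
  have hsa : Summable fun l => a l ^ 2 := hT.congr fun l => (ha2 l).symm
  have key (f : symSobolev ε) := summable_mul_of_summable_sq hsa (hsb f)
  refine ⟨{ toFun := fun f => ∑' l, a l * b f.1 l
            map_add' := fun f g => ?_
            map_smul' := fun c f => ?_ }, ⟨Real.sqrt (∑' l, a l ^ 2), fun f => ?_⟩, fun f => ?_⟩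
  · rw [← (key f).1.tsum_add (key g).1]
    refine tsum_congr fun l => ?_
    simp only [hab, Submodule.coe_add, coeffLM_add, Complex.add_re]
    ring
  · rw [RingHom.id_apply, smul_eq_mul, ← tsum_mul_left]
    refine tsum_congr fun l => ?_
    simp only [hab, Submodule.coe_smul, coeffLM_smul, Complex.re_ofReal_mul]
    ring
  · refine (key f).2.trans (mul_le_mul_of_nonneg_left ?_ (Real.sqrt_nonneg _))
    exact Real.sqrt_le_sqrt ((hsb f).tsum_le_tsum (hb2 f.1) (hsn f))
  · refine ⟨toL2_mem_symSobolev ε f, ?_⟩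
    have h := (key ⟨f.toL2, toL2_mem_symSobolev ε f⟩).1.hasSum.tendsto_sum_nat
    refine tendsto_nhds_unique h ((T.tendsto_sum f).congr fun N => ?_)
    refine Finset.sum_congr rfl fun l _ => ?_
    rw [hab, coeffLM_toL2_zero, Complex.ofReal_re, Distr.coord]

lemma sobolevDual_eq (ε : ℝ) : sobolevDual ε
    = {T | Summable fun l : ℕ => ((l : ℝ) + 1 / 2) ^ (-(2 * ε)) * T.coord l ^ 2} :=
  Subset.antisymm (fun _ => summable_of_mem_sobolevDual) fun _ => mem_sobolevDual_of_summable

lemma measurableSet_sobolevDual (ε : ℝ) : MeasurableSet (sobolevDual ε) := by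
  rw [sobolevDual_eq]
  exact measurableSet_summable
    (u := fun (l : ℕ) (T : Distr) => ((l : ℝ) + 1 / 2) ^ (-(2 * ε)) * T.coord l ^ 2)
    (fun l => ((Distr.measurable_coord_apply l).pow_const 2).const_mul _)
    fun l T => mul_nonneg (Real.rpow_nonneg (by positivity) _) (sq_nonneg _)

/-! ### Symmetric square integrable functions -/

lemma inner_toL2 (f : TestFn) (g : L2S2) : inner ℝ f.toL2 g = ∫ s, f.1 s * g s ∂area := by
  rw [L2.inner_def]
  refine integral_congr_ae ?_
  filter_upwards [f.coeFn_toL2] with s hs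
  rw [hs, real_inner_eq_re_inner, RCLike.inner_apply]
  simp [mul_comm]

lemma inner_toL2_toL2 (f g : TestFn) : inner ℝ f.toL2 g.toL2 = pairing f g := by
  rw [inner_toL2]
  refine integral_congr_ae ?_
  filter_upwards [g.coeFn_toL2] with s hs
  rw [hs]

lemma orthonormal_Y : Orthonormal ℝ fun l => (Y l).toL2 := by
  rw [orthonormal_iff_ite]
  intro i j
  rw [inner_toL2_toL2, pairing_Y]

lemma summable_of_mem_symL2 {T : Distr} (hT : T ∈ symL2) : Summable fun l => T.coord l ^ 2 := by
  obtain ⟨g, -, hg⟩ := hT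
  refine (orthonormal_Y.inner_products_summable g).congr fun l => ?_
  rw [inner_toL2, ← hg, Real.norm_eq_abs, sq_abs, Distr.coord]

/-- A subsequence converges almost everywhere. Along an orbit the sequences of values coincide, so
`limUnder` is exactly invariant, including where it takes its default value. -/
lemma isSymmetricL2_of_tendsto {u : ℕ → TestFn} {g : L2S2}
    (h : Tendsto (fun n => (u n).toL2) atTop (𝓝 g)) : IsSymmetricL2 g := by
  obtain ⟨ns, -, hns⟩ := (tendstoInMeasure_of_tendsto_Lp h).exists_seq_tendsto_ae
  refine ⟨fun s => limUnder atTop fun k => (u (ns k)).1 s, fun a s => ?_, ?_⟩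
  · simp only [TestFn.apply_rot]
  · filter_upwards [hns, ae_all_iff.2 fun k => (u (ns k)).coeFn_toL2] with s h1 h2
    simp only [h2] at h1
    exact h1.limUnder_eq.symm

lemma TestFn.toL2_sum_smul (s : Finset ℕ) (t : ℕ → ℝ) :
    (∑ i ∈ s, t i • Y i).toL2 = ∑ i ∈ s, t i • (Y i).toL2 := by
  let F : TestFn →ₗ[ℝ] L2S2 :=
    (ContinuousMap.toLp 2 area ℝ : C(S2, ℝ) →L[ℝ] L2S2).toLinearMap ∘ₗ
    { toFun := fun f => (⟨f.1, f.1.contMDiff.continuous⟩ : C(S2, ℝ))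
      map_add' := fun _ _ => rfl
      map_smul' := fun _ _ => rfl }
  change F _ = ∑ i ∈ s, t i • F (Y i)
  rw [map_sum]
  simp only [map_smul]

/-- Riesz–Fischer for the orthonormal family of zonal harmonics; the converse
`summable_of_mem_symL2` is Bessel's inequality. -/
lemma mem_symL2_of_summable {T : Distr} (hT : Summable fun l => T.coord l ^ 2) : T ∈ symL2 := by
  have hs : Summable fun l => T.coord l • (Y l).toL2 := by
    have h := (orthonormal_Y.orthogonalFamily.summable_iff_norm_sq_summable T.coord).2
      (by simpa only [Real.norm_eq_abs, sq_abs] using hT)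
    simpa only [LinearIsometry.toSpanSingleton_apply] using h
  refine ⟨∑' l, T.coord l • (Y l).toL2, ?_, fun f => ?_⟩
  · refine isSymmetricL2_of_tendsto (u := fun n => ∑ l ∈ Finset.range n, T.coord l • Y l) ?_
    simp only [TestFn.toL2_sum_smul]
    exact hs.hasSum.tendsto_sum_nat
  · rw [← inner_toL2]
    have h := (hs.hasSum.mapL (innerSL ℝ f.toL2)).tendsto_sum_nat
    refine tendsto_nhds_unique ((T.tendsto_sum f).congr fun N => ?_) h
    refine Finset.sum_congr rfl fun l _ => ?_
    simp only [innerSL_apply_apply, inner_smul_right, inner_toL2_toL2]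
    rw [pairing_comm, coeff, Distr.coord]

lemma symL2_eq : symL2 = {T | Summable fun l => T.coord l ^ 2} :=
  Subset.antisymm (fun _ => summable_of_mem_symL2) fun _ => mem_symL2_of_summable

lemma measurableSet_symL2 : MeasurableSet symL2 := by
  rw [symL2_eq]
  exact measurableSet_summable (u := fun (l : ℕ) (T : Distr) => T.coord l ^ 2)
    (fun l => (Distr.measurable_coord_apply l).pow_const 2) fun l T => sq_nonneg _

lemma classical_subset_symL2 : classical ⊆ symL2 := by
  rintro T ⟨g, hg⟩
  refine ⟨g.toL2, ⟨fun s => g.1 s, fun a s => g.apply_rot a s, g.coeFn_toL2⟩, fun f => ?_⟩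
  rw [hg, ← inner_toL2, inner_toL2_toL2]

/-! ### Measures of the sets of distributions -/

section Support

variable {C : TestFn →ₗ[ℝ] TestFn} {ρ ν : ℕ → ℝ} {t : ℝ} {μ : Measure Distr}

/-- With |z_ℓ|² = O(1/ℓ) the weighted variances are O(ℓ^(-1-2ε)), summable exactly because ε > 0. -/
lemma measure_sobolevDual (hC : ∀ P l, coeff (C P) l = ‖mode ρ ν l t‖ ^ 2 * coeff P l)
    (hμ : IsGaussianWithCov C μ) {A : ℝ} (hA : ∀ l, ‖mode ρ ν l t‖ ^ 2 ≤ A / ((l : ℝ) + 1))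
    {ε : ℝ} (hε : 0 < ε) : μ (sobolevDual ε) = 1 := by
  have := hμ.1
  have hC' : ∀ P l, coeff (C P) l = (‖mode ρ ν l t‖₊ ^ 2 : ℝ≥0) * coeff P l := by simpa using hC
  have hw (l : ℕ) : 0 < (l : ℝ) + 1 / 2 := by positivity
  have hs : Summable fun l : ℕ =>
      ((l : ℝ) + 1 / 2) ^ (-(2 * ε)) * ((‖mode ρ ν l t‖₊ ^ 2 : ℝ≥0) : ℝ) := by
    have hA0 : 0 ≤ A := by simpa using (sq_nonneg _).trans (hA 0)
    have h1 : Summable fun l : ℕ => 1 / |(l : ℝ) + 1 / 2| ^ (1 + 2 * ε) :=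
      (Real.summable_one_div_nat_add_rpow (1 / 2) (1 + 2 * ε)).2 (by linarith)
    refine (h1.mul_left A).of_nonneg_of_le
      (fun l => mul_nonneg (Real.rpow_nonneg (hw l).le _) (NNReal.coe_nonneg _)) fun l => ?_
    have h2 : A / ((l : ℝ) + 1) ≤ A / ((l : ℝ) + 1 / 2) :=
      div_le_div_of_nonneg_left hA0 (hw l) (by linarith)
    have h3 : ((‖mode ρ ν l t‖₊ ^ 2 : ℝ≥0) : ℝ) ≤ A / ((l : ℝ) + 1 / 2) := by
      simpa using (hA l).trans h2
    refine (mul_le_mul_of_nonneg_left h3 (Real.rpow_nonneg (hw l).le _)).trans (le_of_eq ?_)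
    rw [abs_of_pos (hw l), Real.rpow_add (hw l), Real.rpow_one, Real.rpow_neg (hw l).le]
    have := (Real.rpow_pos_of_pos (hw l) (2 * ε)).ne'
    have := (hw l).ne'
    field_simp
  have h := ae_summable_mul_sq Distr.measurable_coord_apply (map_coord_eq_gaussianReal hC' hμ)
    (fun l => Real.rpow_nonneg (hw l).le _) hs
  rw [sobolevDual_eq, ← mem_ae_iff_prob_eq_one (sobolevDual_eq ε ▸ measurableSet_sobolevDual ε)]
  exact h

lemma measure_symL2 (hC : ∀ P l, coeff (C P) l = ‖mode ρ ν l t‖ ^ 2 * coeff P l)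
    (hμ : IsGaussianWithCov C μ) (hz : ∀ l, mode ρ ν l t ≠ 0)
    (hs : ¬ Summable fun l => ‖mode ρ ν l t‖ ^ 2) : μ symL2 = 0 := by
  have hC' : ∀ P l, coeff (C P) l = (‖mode ρ ν l t‖₊ ^ 2 : ℝ≥0) * coeff P l := by simpa using hC
  have h := ae_not_summable_sq (iIndepFun_coord hC' hμ) Distr.measurable_coord_apply
    (map_coord_eq_gaussianReal hC' hμ) (fun l => pow_ne_zero 2 (nnnorm_ne_zero_iff.2 (hz l)))
    (by simpa using hs)
  rw [symL2_eq]
  rw [ae_iff] at h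
  simpa only [not_not] using h

lemma measurableSet_Zset (D : ℕ → ℝ) : MeasurableSet (Zset ρ ν t D) := by
  have e : Zset ρ ν t D = ⋃ N : ℕ, ⋂ l : ℕ, ⋂ _ : N ≤ l,
      {T : Distr | |T.coord l| < ‖mode ρ ν l t‖ * Real.sqrt (2 * Real.log (D l))} := by
    ext T
    simp only [mem_iUnion, mem_iInter]
    rfl
  rw [e]
  exact .iUnion fun N => .iInter fun l => .iInter fun _ =>
    measurableSet_lt (Distr.measurable_coord_apply l).norm measurable_const

lemma measure_Zset_eq_one (hC : ∀ P l, coeff (C P) l = ‖mode ρ ν l t‖ ^ 2 * coeff P l)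
    (hμ : IsGaussianWithCov C μ) (hz : ∀ l, mode ρ ν l t ≠ 0) {D : ℕ → ℝ}
    (hD : ∀ k, 1 ≤ k → 1 < D k)
    (hs : Summable fun k => 1 / (D k * Real.sqrt (Real.log (D k)))) : μ (Zset ρ ν t D) = 1 := by
  have := hμ.1
  have hC' : ∀ P l, coeff (C P) l = (‖mode ρ ν l t‖₊ ^ 2 : ℝ≥0) * coeff P l := by simpa using hC
  have h := ae_eventually_abs_lt Distr.measurable_coord_apply
    (fun l => nnnorm_pos.2 (hz l)) (map_coord_eq_gaussianReal hC' hμ) hD hs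
  rw [← mem_ae_iff_prob_eq_one (measurableSet_Zset D)]
  exact h

lemma measure_Zset_eq_zero (hC : ∀ P l, coeff (C P) l = ‖mode ρ ν l t‖ ^ 2 * coeff P l)
    (hμ : IsGaussianWithCov C μ) (hz : ∀ l, mode ρ ν l t ≠ 0) {D : ℕ → ℝ}
    (hD : ∀ k, 1 ≤ k → 1 < D k)
    (hs : ¬ Summable fun k => 1 / (D k * Real.sqrt (Real.log (D k)))) : μ (Zset ρ ν t D) = 0 := by
  have hC' : ∀ P l, coeff (C P) l = (‖mode ρ ν l t‖₊ ^ 2 : ℝ≥0) * coeff P l := by simpa using hC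
  have h := ae_frequently_le_abs (iIndepFun_coord hC' hμ) Distr.measurable_coord_apply
    (fun l => nnnorm_pos.2 (hz l)) (map_coord_eq_gaussianReal hC' hμ) hD hs
  rw [ae_iff] at h
  simp only [not_not] at h
  exact h

end Support

/-! ### Powers -/

lemma one_lt_one_add_rpow {α : ℝ} (hα : 0 < α) (k : ℕ) (hk : 1 ≤ k) : 1 < (1 + (k : ℝ)) ^ α :=
  Real.one_lt_rpow (by have : (1 : ℝ) ≤ k := by exact_mod_cast hk
                       linarith) hα

lemma summable_one_div_rpow_mul_sqrt_log {α : ℝ} (hα : 1 < α) :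
    Summable fun k : ℕ => 1 / ((1 + (k : ℝ)) ^ α * Real.sqrt (Real.log ((1 + (k : ℝ)) ^ α))) := by
  have h2 : 0 < Real.log 2 := Real.log_pos one_lt_two
  have h1 : Summable fun k : ℕ => 1 / |(k : ℝ) + 1| ^ α :=
    (Real.summable_one_div_nat_add_rpow 1 α).2 hα
  refine (h1.mul_right (1 / Real.sqrt (Real.log 2))).of_nonneg_of_le (fun k => by positivity)
    fun k => ?_
  have hk0 : (0 : ℝ) < (k : ℝ) + 1 := by positivity
  rw [abs_of_pos hk0, add_comm (1 : ℝ), one_div_mul_one_div]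
  rcases Nat.eq_zero_or_pos k with rfl | hk
  -- At k = 0 the base is 1, its logarithm 0, and the quotient is 0 by the convention for division
  -- by zero.
  · simp
  · have hk1 : (1 : ℝ) ≤ k := by exact_mod_cast hk
    have h3 : Real.log 2 ≤ Real.log (((k : ℝ) + 1) ^ α) := by
      refine Real.log_le_log two_pos ?_
      calc (2 : ℝ) ≤ (k : ℝ) + 1 := by linarith
        _ ≤ _ := Real.self_le_rpow_of_one_le (by linarith) hα.le
    refine one_div_le_one_div_of_le (mul_pos (Real.rpow_pos_of_pos hk0 _) (Real.sqrt_pos.2 h2)) ?_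
    exact mul_le_mul_of_nonneg_left (Real.sqrt_le_sqrt h3) (Real.rpow_nonneg hk0.le _)

/-- Telescoping comparison with y_k = √log(k+2): since y_{k+1}² - y_k² ≤ 1/(k+2), the increment of y
is at most the term of the series, while y is unbounded. -/
lemma not_summable_one_div_mul_sqrt_log :
    ¬ Summable fun k : ℕ => 1 / ((1 + (k : ℝ)) ^ (1 : ℝ) *
      Real.sqrt (Real.log ((1 + (k : ℝ)) ^ (1 : ℝ)))) := by
  intro hs
  simp only [Real.rpow_one] at hs
  have hs' := (summable_nat_add_iff 1).2 hs
  set y : ℕ → ℝ := fun k => Real.sqrt (Real.log ((k : ℝ) + 2)) with hy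
  have hy0 (k : ℕ) : 0 < y k := Real.sqrt_pos.2 (Real.log_pos (by linarith [(Nat.cast_nonneg k : (0 : ℝ) ≤ k)]))
  have hysq (k : ℕ) : y k ^ 2 = Real.log ((k : ℝ) + 2) :=
    Real.sq_sqrt (Real.log_nonneg (by linarith [(Nat.cast_nonneg k : (0 : ℝ) ≤ k)]))
  have hstep (k : ℕ) : y (k + 1) - y k ≤ 1 / ((1 + ((k + 1 : ℕ) : ℝ)) *
      Real.sqrt (Real.log (1 + ((k + 1 : ℕ) : ℝ)))) := by
    have e : (1 : ℝ) + ((k + 1 : ℕ) : ℝ) = (k : ℝ) + 2 := by push_cast; ring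
    rw [e]
    change _ ≤ 1 / (((k : ℝ) + 2) * y k)
    have hk0 : (0 : ℝ) < (k : ℝ) + 2 := by positivity
    have hmono : y k ≤ y (k + 1) := by
      refine Real.sqrt_le_sqrt (Real.log_le_log hk0 ?_)
      push_cast
      linarith
    have hlog : Real.log (((k + 1 : ℕ) : ℝ) + 2) - Real.log ((k : ℝ) + 2) ≤ 1 / ((k : ℝ) + 2) := by
      have e2 : ((k + 1 : ℕ) : ℝ) + 2 = ((k : ℝ) + 2) * (1 + 1 / ((k : ℝ) + 2)) := by
        push_cast
        field_simp
        ring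
      rw [e2, Real.log_mul hk0.ne' (by positivity), add_sub_cancel_left]
      have := Real.log_le_sub_one_of_pos (x := 1 + 1 / ((k : ℝ) + 2)) (by positivity)
      linarith
    rw [← hysq, ← hysq] at hlog
    rw [← div_div, le_div_iff₀ (hy0 k)]
    refine le_trans ?_ hlog
    nlinarith [hy0 k, hy0 (k + 1)]
  have hbound (n : ℕ) : y n - y 0 ≤ ∑' k : ℕ, 1 / ((1 + ((k + 1 : ℕ) : ℝ)) *
      Real.sqrt (Real.log (1 + ((k + 1 : ℕ) : ℝ)))) := by
    rw [← Finset.sum_range_sub]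
    exact (Finset.sum_le_sum fun k _ => hstep k).trans
      (hs'.sum_le_tsum _ fun k _ => by positivity)
  have hlim : Tendsto y atTop atTop := by
    refine Real.tendsto_sqrt_atTop.comp (Real.tendsto_log_atTop.comp ?_)
    exact tendsto_atTop_add_const_right _ _ tendsto_natCast_atTop_atTop
  obtain ⟨n, hn⟩ := (hlim.eventually_gt_atTop (y 0 + ∑' k : ℕ, 1 / ((1 + ((k + 1 : ℕ) : ℝ)) *
      Real.sqrt (Real.log (1 + ((k + 1 : ℕ) : ℝ)))))).exists
  linarith [hbound n]

end

end Gowdy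

/-! ### Assembly of the theorem -/

theorem mainTheorem6 (ρ ν : ℕ → ℝ) (hρ_pos : ∀ l, 0 < ρ l)
    (hρ : Summable fun l => (ρ l - Real.sqrt (Real.pi / 2)) ^ 2)
    (hν : Summable fun l => ν l ^ 2)
    (t₀ : ℝ) (ht₀ : t₀ ∈ Set.Ioo 0 Real.pi) :
    ∃ J : (Gowdy.TestFn × Gowdy.TestFn) →ₗ[ℝ] (Gowdy.TestFn × Gowdy.TestFn),
      -- `J` is the complex structure on Cauchy data at time `t₀`
      (Gowdy.IsComplexStructureAt ρ ν t₀ J ∧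
        ∀ J', Gowdy.IsComplexStructureAt ρ ν t₀ J' → J' = J) ∧
      -- its block `B` satisfies `-B/2 = diag(|z_ℓ(t₀)|²)`, with nonzero entries
      (∀ l, Gowdy.mode ρ ν l t₀ ≠ 0) ∧
      (∀ (P : Gowdy.TestFn) (s : Gowdy.S2),
        HasSum (fun l => ‖Gowdy.mode ρ ν l t₀‖ ^ 2 * Gowdy.coeff P l * (Gowdy.Y l).1 s)
          (((-(1 / 2 : ℝ)) • Gowdy.blockB J P).1 s)) ∧
      ∃ μ : MeasureTheory.Measure Gowdy.Distr,
        -- `μ` is the unique centred Gaussian measure with covariance operator `-B/2`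
        (Gowdy.IsGaussianWithCov ((-(1 / 2 : ℝ)) • Gowdy.blockB J) μ ∧
          ∀ μ', Gowdy.IsGaussianWithCov ((-(1 / 2 : ℝ)) • Gowdy.blockB J) μ' → μ' = μ) ∧
        -- mean and covariance
        (∀ f : Gowdy.TestFn, MeasureTheory.MemLp (fun T : Gowdy.Distr => T f) 2 μ ∧
          ∫ T : Gowdy.Distr, T f ∂μ = 0) ∧
        (∀ f g : Gowdy.TestFn, ∫ T : Gowdy.Distr, T f * T g ∂μ
          = Gowdy.pairing f ((-(1 / 2 : ℝ)) • Gowdy.blockB J g)) ∧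
        -- restriction to finitely many coordinate directions
        (∀ n : ℕ, μ.map (fun (T : Gowdy.Distr) (l : Fin (n + 1)) => T (Gowdy.Y l))
          = MeasureTheory.Measure.pi (fun l : Fin (n + 1) =>
              ProbabilityTheory.gaussianReal 0 (‖Gowdy.mode ρ ν l t₀‖₊ ^ 2))) ∧
        -- support on the dual of the symmetric Sobolev space
        (∀ ε : ℝ, 0 < ε → MeasurableSet (Gowdy.sobolevDual ε) ∧ μ (Gowdy.sobolevDual ε) = 1) ∧
        -- the symmetric square integrable functions, and the classical configurations, are null
        (MeasurableSet Gowdy.symL2 ∧ μ Gowdy.symL2 = 0) ∧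
        μ Gowdy.classical = 0 ∧
        -- the nonlinear characterization of the support
        (∀ Δ : ℕ → ℝ, (∀ k, 1 ≤ k → 1 < Δ k) →
          MeasurableSet (Gowdy.Zset ρ ν t₀ Δ) ∧
          (Summable (fun k => 1 / (Δ k * Real.sqrt (Real.log (Δ k)))) →
            μ (Gowdy.Zset ρ ν t₀ Δ) = 1) ∧
          (¬ Summable (fun k => 1 / (Δ k * Real.sqrt (Real.log (Δ k)))) →
            μ (Gowdy.Zset ρ ν t₀ Δ) = 0)) ∧
        (∀ α : ℝ, 1 < α → μ (Gowdy.Zset ρ ν t₀ (fun l => (1 + (l : ℝ)) ^ α)) = 1) ∧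
        μ (Gowdy.Zset ρ ν t₀ (fun l => (1 + (l : ℝ)) ^ (1 : ℝ))) = 0 := by
  obtain ⟨R, hR⟩ := Gowdy.exists_bounds_of_summable hρ hν
  obtain ⟨J, hJ, hC⟩ := Gowdy.exists_complexStructure hρ_pos hR ht₀
  obtain ⟨A, hA⟩ := Gowdy.exists_norm_mode_sq_le hρ_pos hR ht₀
  have hz (l : ℕ) : Gowdy.mode ρ ν l t₀ ≠ 0 := Gowdy.mode_ne_zero l (hρ_pos l) ht₀
  have hC' : ∀ P l, Gowdy.coeff (((-(1 / 2 : ℝ)) • Gowdy.blockB J) P) l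
      = ((‖Gowdy.mode ρ ν l t₀‖₊ ^ 2 : ℝ≥0) : ℝ) * Gowdy.coeff P l := by simpa using hC
  have hA0 : 0 ≤ A := by simpa using (sq_nonneg _).trans (hA 0)
  obtain ⟨μ, hμ⟩ := Gowdy.exists_isGaussianWithCov (A := A) hC' fun l => by
    have h : A / ((l : ℝ) + 1) ≤ A :=
      div_le_self hA0 (by linarith [(Nat.cast_nonneg l : (0 : ℝ) ≤ l)])
    simpa using (hA l).trans h
  have hsymL2 := Gowdy.measure_symL2 hC hμ hz (Gowdy.not_summable_norm_mode_sq hρ_pos hR ht₀)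
  refine ⟨J, hJ, hz, fun P s => ?_, μ, ⟨hμ, fun μ' => Gowdy.IsGaussianWithCov.unique hC' hμ⟩,
    fun f => ⟨Gowdy.memLp_apply hC' hμ f, Gowdy.integral_apply_eq_zero hC' hμ f⟩,
    Gowdy.integral_apply_mul hC' hμ, Gowdy.map_coord_fin_eq_pi hC' hμ,
    fun ε hε => ⟨Gowdy.measurableSet_sobolevDual ε, Gowdy.measure_sobolevDual hC hμ hA hε⟩,
    ⟨Gowdy.measurableSet_symL2, hsymL2⟩,
    measure_mono_null Gowdy.classical_subset_symL2 hsymL2,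
    fun Δ hΔ => ⟨Gowdy.measurableSet_Zset Δ, Gowdy.measure_Zset_eq_one hC hμ hz hΔ,
      Gowdy.measure_Zset_eq_zero hC hμ hz hΔ⟩,
    fun α hα => Gowdy.measure_Zset_eq_one hC hμ hz
      (Gowdy.one_lt_one_add_rpow (zero_lt_one.trans hα))
      (Gowdy.summable_one_div_rpow_mul_sqrt_log hα),
    Gowdy.measure_Zset_eq_zero hC hμ hz (Gowdy.one_lt_one_add_rpow zero_lt_one)
      Gowdy.not_summable_one_div_mul_sqrt_log⟩
  -- The remaining goal is the pointwise expansion of -B P/2, whose coefficients are those given by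
  -- `hC`.
  have h := Gowdy.hasSum_coeff_mul_Y (((-(1 / 2 : ℝ)) • Gowdy.blockB J) P) s
  simp only [hC] at h
  exact h
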